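/- Let $(\mathcal M,\mathbf g)$ be a smooth $n$-dimensional Riemannian manifold, $\Omega\subset\mathcal M$ an open set and $0<R\le\infty$. Let $f:\Omega\to[0,R)$ be a parameterizing function, that is, with $S_t=f^{-1}(t)$ and $R_t=f^{-1}([0,t))$: (1) $f$ is Lipschitz continuous on $\Omega$ and smooth on $f^{-1}((0,R))$; (2) $\operatorname{grad} f\neq0$ on $f^{-1}((0,R))$, and the hypersurfaces $S_t$ are compact for all $t\in(0,R)$; (3) for all $t\in(0,R)$ the set $R_t$ is open, its closure is compact and contained in $\Omega$, its boundary is $S_t$, and $1/|\operatorname{grad} f|$ is integrable on $R_t$ with respect to the Riemannian volume. Assume that $f$ is convex, that is, $\nabla^2f(v,v)\ge0$ for all $v\in T_p\mathcal M$ and all $p\in\Omega$ with $f(p)>0$, where $\nabla^2 f$ is the Hessian for the Levi-Civita connection. Then: (a) For every $t\in(0,R)$ with $S_t\ne\emptyset$ the infimum $m(t)=\inf_{S_t}\Delta f/|\operatorname{grad} f|^2$ is finite and $m(t)\ge0$. (b) For every harmonic function $h:\Omega\to\mathbf R$, the integral $H(t)=\int_{S_t}h^2\,|\operatorname{grad}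 f|\,\sigma_t$, where $\sigma_t$ is the Riemannian surface measure of $S_t$, is finite for every $t\in(0,R)$, and $H$ is (weakly) increasing on $(0,R)$. (c) For every $t\in(0,R)$ the set $R_t$ is totally convex: every geodesic in $\Omega$ that starts and ends in $R_t$ is contained in $R_t$. -/

import Mathlib

open scoped Manifold ContDiff Topology ENNReal NNReal Bundle
open MeasureTheory Bundle

noncomputable section

namespace LevelConvexity

/-- The model space of an `n`-dimensional manifold without boundary. -/
abbrev Model (n : ℕ) : Type := EuclideanSpace ℝ (Fin n)

/-- The `i`-th standard basis vector. -/
def basisVec {n : ℕ} (i : Fin n) : Model n := EuclideanSpace.single i (1 : ℝ)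

section Coordinates

variable {n : ℕ} {M : Type*} [TopologicalSpace M] [ChartedSpace (Model n) M]
  [RiemannianBundle (fun x : M => TangentSpace (𝓡 n) x)]

/-- The coordinate vector field `∂_i` of the chart centred at `c`, at the point of `M` whose
coordinates are `y`. -/
def coordField (c : M) (y : Model n) (i : Fin n) :
    TangentSpace (𝓡 n) ((extChartAt (𝓡 n) c).symm y) :=
  mfderiv (𝓡 n) (𝓡 n) (extChartAt (𝓡 n) c).symm y (basisVec i)

/-- The matrix `g_{ij}(y) = ⟨∂_i, ∂_j⟩` of the metric in the chart centred at `c`. -/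
def metricMatrix (c : M) (y : Model n) : Matrix (Fin n) (Fin n) ℝ :=
  Matrix.of fun i j => inner ℝ (coordField c y i) (coordField c y j)

/-- The partial derivative `∂_i F` of a function on the model space. -/
def partialDeriv (i : Fin n) (F : Model n → ℝ) (y : Model n) : ℝ :=
  fderiv ℝ F y (basisVec i)

/-- The Christoffel symbols `Γ^k_{ij}` of the Levi-Civita connection in the chart centred at `c`:
`Γ^k_{ij} = (1/2) ∑_l g^{kl} (∂_i g_{jl} + ∂_j g_{il} - ∂_l g_{ij})`. -/
def christoffel (c : M) (k i j : Fin n) (y : Model n) : ℝ :=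
  (1 / 2 : ℝ) * ∑ l, (metricMatrix c y)⁻¹ k l *
    (partialDeriv i (fun z => metricMatrix c z j l) y
      + partialDeriv j (fun z => metricMatrix c z i l) y
      - partialDeriv l (fun z => metricMatrix c z i j) y)

/-- The function `u` in the coordinates of the chart centred at `c`. -/
def inChart (c : M) (u : M → ℝ) : Model n → ℝ := fun y => u ((extChartAt (𝓡 n) c).symm y)

/-- The components `(∇² u)_{ij} = ∂_i ∂_j u - ∑_k Γ^k_{ij} ∂_k u` of the Hessian at `p`, in the
chart centred at `p`. -/
def hessianMatrix (u : M → ℝ) (p : M) : Matrix (Fin n) (Fin n) ℝ :=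
  Matrix.of fun i j =>
    partialDeriv i (partialDeriv j (inChart p u)) (extChartAt (𝓡 n) p p)
      - ∑ k, christoffel p k i j (extChartAt (𝓡 n) p p)
          * partialDeriv k (inChart p u) (extChartAt (𝓡 n) p p)

/-- The `i`-th component of a tangent vector at `p` in the chart centred at `p`: Mathlib's tangent
space at `p` is the model space, identified through exactly this chart. -/
def component {p : M} (v : TangentSpace (𝓡 n) p) (i : Fin n) : ℝ :=
  (show Model n from v) i

/-- The Hessian `∇² u (v, w)` at `p`, for the Levi-Civita connection. -/
def hessian (u : M → ℝ) (p : M) (v w : TangentSpace (𝓡 n) p) : ℝ :=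
  ∑ i, ∑ j, hessianMatrix u p i j * component v i * component w j

/-- The Laplacian `Δ u = tr_g ∇² u = ∑ g^{ij} (∇² u)_{ij}`. -/
def laplacian (u : M → ℝ) (p : M) : ℝ :=
  ∑ i, ∑ j, (metricMatrix p (extChartAt (𝓡 n) p p))⁻¹ i j * hessianMatrix u p i j

/-- The gradient: the tangent vector with `⟨grad u, v⟩ = du(v)` for all `v`. -/
def grad (u : M → ℝ) (p : M) : TangentSpace (𝓡 n) p :=
  haveI : FiniteDimensional ℝ (TangentSpace (𝓡 n) p) :=
    inferInstanceAs (FiniteDimensional ℝ (Model n))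
  haveI : CompleteSpace (TangentSpace (𝓡 n) p) := FiniteDimensional.complete ℝ _
  (InnerProductSpace.toDual ℝ (TangentSpace (𝓡 n) p)).symm (mfderiv (𝓡 n) 𝓘(ℝ, ℝ) u p)

/-- `γ` is a geodesic on `[a, b]`: it is `C²` and `∇_{γ'} γ' = 0`. At the time `s` the equation
`c_k'' + ∑ Γ^k_{ij} c_i' c_j' = 0` is written in the chart centred at `γ s`, where `c` is the curve
in coordinates. (At the end points it holds by continuity.) -/
def IsGeodesicOn (γ : ℝ → M) (a b : ℝ) : Prop :=
  ContMDiffOn 𝓘(ℝ, ℝ) (𝓡 n) 2 γ (Set.Icc a b) ∧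
  ∀ s ∈ Set.Ioo a b, ∀ k : Fin n,
    let c : Fin n → ℝ → ℝ := fun i τ => extChartAt (𝓡 n) (γ s) (γ τ) i
    deriv (deriv (c k)) s
      + ∑ i, ∑ j, christoffel (γ s) k i j (extChartAt (𝓡 n) (γ s) (γ s))
          * deriv (c i) s * deriv (c j) s = 0

/-- `A` is totally convex in `Ω`: every geodesic in `Ω` that starts and ends in `A` stays in `A`. -/
def IsTotallyConvexIn (Ω A : Set M) : Prop :=
  ∀ (a b : ℝ) (γ : ℝ → M), a ≤ b → IsGeodesicOn (n := n) γ a b →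
    (∀ s ∈ Set.Icc a b, γ s ∈ Ω) → γ a ∈ A → γ b ∈ A → ∀ s ∈ Set.Icc a b, γ s ∈ A

/-- `h` is harmonic on the open set `Ω`. -/
def IsHarmonicOn (h : M → ℝ) (Ω : Set M) : Prop :=
  ContMDiffOn (𝓡 n) 𝓘(ℝ, ℝ) 2 h Ω ∧ ∀ x ∈ Ω, laplacian (n := n) h x = 0

end Coordinates

section Measure

variable {n : ℕ} {M : Type*} [TopologicalSpace M] [ChartedSpace (Model n) M]
  [RiemannianBundle (fun x : M => TangentSpace (𝓡 n) x)]

/-- `ψ` on the open set `U ⊆ ℝᵏ` is a local parametrization of (a `k`-dimensional submanifold)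
`S ⊆ M`: a smooth injective immersion into `M` with values in `S`. -/
def IsLocalParam (k : ℕ) (S : Set M) (ψ : Model k → M) (U : Set (Model k)) : Prop :=
  IsOpen U ∧ ContMDiffOn (𝓡 k) (𝓡 n) ∞ ψ U ∧ Set.InjOn ψ U ∧ Set.MapsTo ψ U S ∧
    ∀ u ∈ U, Function.Injective (mfderiv (𝓡 k) (𝓡 n) ψ u)

/-- The `k`-dimensional area element `√ det (⟨∂_i ψ, ∂_j ψ⟩)` of a parametrization. -/
def areaElement {k : ℕ} (ψ : Model k → M) (u : Model k) : ℝ :=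
  √(Matrix.det (Matrix.of fun i j : Fin k =>
    (inner ℝ (mfderiv (𝓡 k) (𝓡 n) ψ u (basisVec i) : TangentSpace (𝓡 n) (ψ u))
      (mfderiv (𝓡 k) (𝓡 n) ψ u (basisVec j)) : ℝ)))

variable [MeasurableSpace M]

/-- The Riemannian measure of the piece of surface `ψ(U)`, that is
`A ↦ ∫_{U ∩ ψ⁻¹(A)} √ det (⟨∂_i ψ, ∂_j ψ⟩) du`. -/
def paramMeasure {k : ℕ} (ψ : Model k → M) (U : Set (Model k)) : Measure M :=
  Measure.map ψ ((volume.restrict U).withDensity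
    fun u => ENNReal.ofReal (areaElement (n := n) ψ u))

/-- The `k`-dimensional Riemannian measure of a `k`-dimensional embedded submanifold `S` of `M`: the
least measure that dominates the measure of every parametrized piece. On each parametrized piece
`ψ(U)`, which is open in `S`, it is equal to `paramMeasure ψ U`, because these measures agree on
overlaps and countably many pieces cover `S`. -/
def riemannianMeasure (k : ℕ) (S : Set M) : Measure M :=
  sSup {μ : Measure M | ∃ (ψ : Model k → M) (U : Set (Model k)),
    IsLocalParam (n := n) k S ψ U ∧ μ = paramMeasure (n := n) ψ U}

/-- The Riemannian volume measure of `M`. -/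
def vol : Measure M := riemannianMeasure (n := n) n Set.univ

/-- The surface measure of a hypersurface. -/
def surfaceMeasure (S : Set M) : Measure M := riemannianMeasure (n := n) (n - 1) S

end Measure

section LevelSets

variable {n : ℕ} {M : Type*}

/-- The values `t` with `0 < t < R`. -/
def levels (R : EReal) : Set ℝ := {t | 0 < t ∧ (t : EReal) < R}

/-- `S_t = f⁻¹(t)`, for `f` on `Ω`. -/
def levelSet (Ω : Set M) (f : M → ℝ) (t : ℝ) : Set M := {x ∈ Ω | f x = t}

/-- `R_t = f⁻¹([0, t))`, for `f` on `Ω`. -/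
def sublevelSet (Ω : Set M) (f : M → ℝ) (t : ℝ) : Set M := {x ∈ Ω | 0 ≤ f x ∧ f x < t}

variable [TopologicalSpace M] [ChartedSpace (Model n) M]
  [RiemannianBundle (fun x : M => TangentSpace (𝓡 n) x)]

/-- `f : Ω → [0, R)` is a parameterizing function, `0 < R ≤ ∞`. The values of `f : M → ℝ` outside
the open set `Ω` are irrelevant. -/
structure IsParameterizing [MeasurableSpace M] (Ω : Set M) (R : EReal) (f : M → ℝ) : Prop where
  isOpen : IsOpen Ω
  pos : 0 < R
  mem_Ico : ∀ x ∈ Ω, 0 ≤ f x ∧ (f x : EReal) < R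
  /-- `f` is Lipschitz for the Riemannian distance. -/
  lipschitz : ∃ C : ℝ≥0, ∀ x ∈ Ω, ∀ y ∈ Ω,
    edist (f x) (f y) ≤ C * Manifold.riemannianEDist (𝓡 n) x y
  smooth : ContMDiffOn (𝓡 n) 𝓘(ℝ, ℝ) ∞ f {x ∈ Ω | 0 < f x}
  /-- All values in `(0, R)` are regular; thus every `S_t` is an embedded hypersurface. -/
  regular : ∀ x ∈ Ω, 0 < f x → grad (n := n) f x ≠ 0
  /-- The hypersurfaces `S_t` are closed manifolds. -/
  isCompact_levelSet : ∀ t ∈ levels R, IsCompact (levelSet Ω f t)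
  /-- `R_t` is open, relatively compact in `Ω`, and has the boundary `S_t`. -/
  isOpen_sublevelSet : ∀ t ∈ levels R, IsOpen (sublevelSet Ω f t)
  isCompact_closure : ∀ t ∈ levels R, IsCompact (closure (sublevelSet Ω f t))
  closure_subset : ∀ t ∈ levels R, closure (sublevelSet Ω f t) ⊆ Ω
  frontier_eq : ∀ t ∈ levels R, frontier (sublevelSet Ω f t) = levelSet Ω f t
  /-- `1 / |grad f|` is integrable on `R_t` (with the value `∞` where `grad f` vanishes). -/
  integrable : ∀ t ∈ levels R,
    ∫⁻ x in sublevelSet Ω f t, (ENNReal.ofReal ‖grad (n := n) f x‖)⁻¹ ∂(vol (n := n)) < ⊤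

/-- `f : Ω → [0, R)` is convex: its Hessian is nonnegative wherever `f` is positive, which is where
a parameterizing function is smooth. -/
def IsConvexFun (Ω : Set M) (f : M → ℝ) : Prop :=
  ∀ x ∈ Ω, 0 < f x → ∀ v : TangentSpace (𝓡 n) x, 0 ≤ hessian f x v v

/-- The function `Δf / |grad f|²`. -/
def laplaceRatio (f : M → ℝ) (x : M) : ℝ := laplacian (n := n) f x / ‖grad (n := n) f x‖ ^ 2

/-- The sharp lower bound `m(t) = inf_{S_t} Δf / |grad f|²`. -/
def lowerBound (Ω : Set M) (f : M → ℝ) (t : ℝ) : ℝ :=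
  sInf (laplaceRatio (n := n) f '' levelSet Ω f t)

/-- `H(t) = ∫_{S_t} h² |grad f| σ_t`. -/
def weightedL2 [MeasurableSpace M] (Ω : Set M) (f h : M → ℝ) (t : ℝ) : ℝ :=
  ∫ x, h x ^ 2 * ‖grad (n := n) f x‖ ∂(surfaceMeasure (n := n) (levelSet Ω f t))

end LevelSets

end LevelConvexity

end

/-! (a) In coordinates, `Δf` is the contraction of the inverse metric with the Hessian. Both are
positive semidefinite on `{f > 0}`, so `Δf ≥ 0` there and the ratio is bounded below by `0`
(`laplacian_nonneg`).

(c) Along a geodesic `γ` the geodesic equation cancels the acceleration terms, leaving `(f ∘ γ)'' =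
∇²f(γ', γ') ≥ 0` wherever `f ∘ γ > 0`. If `f ∘ γ` reached the level `t > 0`, its maximum would be
attained in the interior. It would be convex near the first maximum point, hence maximal slightly to
the left as well, a contradiction (`lt_of_deriv_deriv_nonneg`).

(b) The classical argument: since `|grad f| = ⟨grad f, ν⟩` for the unit normal `ν` of `S_t`, the
divergence theorem gives `H'(t) = ∫_{S_t} (h² Δf + 2 h ⟨grad h, grad f⟩) / |grad f|`. The first term
is nonnegative by convexity. The second is the flux of `grad (h²)` through `S_t`, which is `2
∫_{R_t} |grad h|² ≥ 0` because `h` is harmonic.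

The proof uses a weak form of this, in which no level set has to be differentiated and no boundary
term appears. Let `N ≤ 0` vanish for large arguments and be constant for small ones, with `N' = η ≥
0` and `η' = ζ`. The coarea formula (`coarea_formula`) turns `∫ ζ H` into `∫ ζ(f) h² |grad f|²`.
Green's formula (`green_formula`) is applied to `η(f) h²` against `f` and to `N(f) h` against `h`.
The mixed terms cancel, so that `∫ ζ H = -∫ η(f) h² Δf + 2 ∫ N(f) |grad h|² ≤ 0`, which is proved as
an inequality in `IsParameterizing.integral_le_zero`. As `N` is constant near the values where `f`
need not be smooth, `N(f)` is `C¹` on all of `Ω`. Taking `ζ(τ) = κ(τ) - κ(τ - δ)` with a bump `κ` at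
`s` and `δ = t - s` gives `∫ κ(τ) (H(τ) - H(τ + δ)) dτ ≤ 0`. Since `H` is continuous, this excludes
`H(s) > H(t)`.

Both integral formulas are proved in parametrizations and glued by partitions of unity.
`IsAdaptedParam.restrict_riemannianMeasure` identifies the measure defined as a supremum with the
density `√det g`. `IsAdaptedParam.laplacian_eq` shows that the Laplacian does not depend on the
chart. -/

noncomputable section

namespace LevelConvexity

set_option linter.unusedSectionVars false

/-! ### The determinant and the inverse of a matrix-valued function -/

section MatrixCalculus

variable {ι : Type*} [Fintype ι] [DecidableEq ι]

/-- The determinant as a function on the normed space of families of entries. -/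
def detEntries (A : ι → ι → ℝ) : ℝ := Matrix.det (Matrix.of A)

lemma contDiff_detEntries {k : ℕ∞ω} : ContDiff ℝ k (detEntries : (ι → ι → ℝ) → ℝ) := by
  unfold detEntries
  simp only [Matrix.det_apply, Matrix.of_apply]
  refine ContDiff.sum fun σ _ => ContDiff.const_smul _ (contDiff_prod fun i _ => ?_)
  fun_prop

/-- Jacobi's formula. Both sides are the derivative at `t = 0` of `det (G + tB) = det G * det (1 + t
G⁻¹B)`, and the last factor is `1 + t tr (G⁻¹B)` up to a polynomial multiple of `t²`. -/
lemma fderiv_detEntries (G B : Matrix ι ι ℝ) (hG : G.det ≠ 0) :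
    fderiv ℝ (detEntries : (ι → ι → ℝ) → ℝ) G B = G.det * (G⁻¹ * B).trace := by
  have h1 : HasDerivAt (fun t : ℝ => detEntries (fun i j => G i j + t * B i j))
      (fderiv ℝ (detEntries : (ι → ι → ℝ) → ℝ) G B) 0 := by
    have hd : HasFDerivAt (detEntries : (ι → ι → ℝ) → ℝ)
        (fderiv ℝ (detEntries : (ι → ι → ℝ) → ℝ) G) (fun i j => G i j + 0 * B i j) := by
      have : (fun i j => G i j + 0 * B i j) = (G : ι → ι → ℝ) := by ext; simp
      rw [this]
      exact ((contDiff_detEntries (k := 1)).differentiable (by simp)).differentiableAt.hasFDerivAt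
    have hl : HasDerivAt (fun t : ℝ => (fun i j => G i j + t * B i j : ι → ι → ℝ)) B 0 := by
      refine hasDerivAt_pi.2 fun i => hasDerivAt_pi.2 fun j => ?_
      simpa using ((hasDerivAt_id (0 : ℝ)).mul_const (B i j)).const_add (G i j)
    exact hd.comp_hasDerivAt (0 : ℝ) hl
  have h2 : HasDerivAt (fun t : ℝ => detEntries (fun i j => G i j + t * B i j))
      (G.det * (G⁻¹ * B).trace) 0 := by
    have key : (fun t : ℝ => detEntries (fun i j => G i j + t * B i j)) = fun t =>
        G.det * (1 + (G⁻¹ * B).trace * t + Polynomial.eval t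
          (1 + (Polynomial.X : Polynomial ℝ) • (G⁻¹ * B).map Polynomial.C).det.divX.divX
            * t ^ 2) := by
      ext t
      rw [← Matrix.det_one_add_smul, ← Matrix.det_mul, mul_add, mul_one, Matrix.mul_smul,
        Matrix.mul_nonsing_inv_cancel_left _ _ (isUnit_iff_ne_zero.2 hG)]
      rfl
    rw [key]
    set p := (1 + (Polynomial.X : Polynomial ℝ) • (G⁻¹ * B).map Polynomial.C).det.divX.divX
    have hp := ((p.hasDerivAt 0).mul ((hasDerivAt_id (0 : ℝ)).pow 2))
    have := (((hasDerivAt_id (0 : ℝ)).const_mul (G⁻¹ * B).trace).const_add 1).add hp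
    have := this.const_mul G.det
    simpa using this
  exact h1.unique h2

end MatrixCalculus

/-! ### Coordinate calculus: Christoffel symbols and the divergence form of the Laplacian. -/

section CoordinateCalculus

variable {n : ℕ}

lemma partialDeriv_congr {F G : Model n → ℝ} {y : Model n} (i : Fin n) (h : F =ᶠ[𝓝 y] G) :
    partialDeriv i F y = partialDeriv i G y := by
  unfold partialDeriv; rw [h.fderiv_eq]

lemma partialDeriv_mul {F G : Model n → ℝ} {y : Model n} (i : Fin n)
    (hF : DifferentiableAt ℝ F y) (hG : DifferentiableAt ℝ G y) :
    partialDeriv i (fun z => F z * G z) y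
      = partialDeriv i F y * G y + F y * partialDeriv i G y := by
  unfold partialDeriv
  rw [fderiv_fun_mul hF hG]
  simp; ring

lemma partialDeriv_sum {ι : Type*} (s : Finset ι) {F : ι → Model n → ℝ} {y : Model n} (i : Fin n)
    (hF : ∀ a ∈ s, DifferentiableAt ℝ (F a) y) :
    partialDeriv i (fun z => ∑ a ∈ s, F a z) y = ∑ a ∈ s, partialDeriv i (F a) y := by
  unfold partialDeriv
  rw [fderiv_fun_sum hF]
  simp

lemma partialDeriv_const (c : ℝ) {y : Model n} (i : Fin n) :
    partialDeriv i (fun _ => c) y = 0 := by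
  simp [partialDeriv]

lemma ContDiffAt.partialDeriv {F : Model n → ℝ} {y : Model n} {k l : ℕ∞ω} (i : Fin n)
    (hF : ContDiffAt ℝ l F y) (h : k + 1 ≤ l) : ContDiffAt ℝ k (partialDeriv i F) y :=
  (hF.fderiv_right h).clm_apply contDiffAt_const

/-- The matrix of partial derivatives of the entries. -/
def partialDerivMatrix (i : Fin n) (g : Model n → Matrix (Fin n) (Fin n) ℝ) (y : Model n) :
    Matrix (Fin n) (Fin n) ℝ :=
  Matrix.of fun a b => partialDeriv i (fun z => g z a b) y

lemma contDiffAt_det {g : Model n → Matrix (Fin n) (Fin n) ℝ} {y : Model n} {k : ℕ∞ω}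
    (hg : ∀ a b, ContDiffAt ℝ k (fun z => g z a b) y) :
    ContDiffAt ℝ k (fun z => (g z).det) y := by
  have : ContDiffAt ℝ k (fun z => (fun a b => g z a b : Fin n → Fin n → ℝ)) y :=
    contDiffAt_pi.2 fun a => contDiffAt_pi.2 fun b => hg a b
  exact (contDiff_detEntries.contDiffAt).comp y this

lemma contDiffAt_inv_apply {g : Model n → Matrix (Fin n) (Fin n) ℝ} {y : Model n} {k : ℕ∞ω}
    (hg : ∀ a b, ContDiffAt ℝ k (fun z => g z a b) y) (hdet : (g y).det ≠ 0) (a b : Fin n) :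
    ContDiffAt ℝ k (fun z => (g z)⁻¹ a b) y := by
  simp only [Matrix.inv_def, Ring.inverse_eq_inv', Matrix.smul_apply, smul_eq_mul,
    Matrix.adjugate_apply]
  refine ((contDiffAt_det hg).inv hdet).mul ?_
  refine contDiffAt_det fun c d => ?_
  by_cases h : c = b
  · subst h; simpa using contDiffAt_const
  · simpa [Matrix.updateRow_ne h] using hg c d

lemma partialDeriv_det {g : Model n → Matrix (Fin n) (Fin n) ℝ} {y : Model n}
    (hg : ∀ a b, ContDiffAt ℝ 1 (fun z => g z a b) y) (hdet : (g y).det ≠ 0) (i : Fin n) :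
    partialDeriv i (fun z => (g z).det) y
      = (g y).det * ((g y)⁻¹ * partialDerivMatrix i g y).trace := by
  rw [← fderiv_detEntries _ _ hdet]
  have h1 : ∀ a b, HasFDerivAt (fun z => g z a b) (fderiv ℝ (fun z => g z a b) y) y :=
    fun a b => ((hg a b).differentiableAt (by simp)).hasFDerivAt
  have h2 : HasFDerivAt (fun z => (fun a b => g z a b : Fin n → Fin n → ℝ))
      (ContinuousLinearMap.pi fun a => ContinuousLinearMap.pi fun b =>
        fderiv ℝ (fun z => g z a b) y) y :=
    hasFDerivAt_pi.2 fun a => hasFDerivAt_pi.2 fun b => h1 a b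
  have h3 : HasFDerivAt (detEntries : (Fin n → Fin n → ℝ) → ℝ)
      (fderiv ℝ (detEntries : (Fin n → Fin n → ℝ) → ℝ) (g y)) (g y) :=
    ((contDiff_detEntries (k := 1)).differentiable (by simp)).differentiableAt.hasFDerivAt
  have h4 := (HasFDerivAt.comp y (f := fun z => (fun a b => g z a b : Fin n → Fin n → ℝ)) h3 h2)
  unfold partialDeriv
  have h5 : (fun z => (g z).det) =
      detEntries ∘ (fun z => (fun a b => g z a b : Fin n → Fin n → ℝ)) := rfl
  rw [h5, h4.fderiv]
  rfl

lemma eventually_det_ne_zero {g : Model n → Matrix (Fin n) (Fin n) ℝ} {y : Model n}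
    (hg : ∀ a b, ContDiffAt ℝ 1 (fun z => g z a b) y) (hdet : (g y).det ≠ 0) :
    ∀ᶠ z in 𝓝 y, (g z).det ≠ 0 :=
  (contDiffAt_det hg).continuousAt.eventually_ne hdet

/-- Differentiate `g⁻¹ g = 1`, which holds in a neighbourhood of `y` because the determinant stays
nonzero there. -/
lemma partialDerivMatrix_inv {g : Model n → Matrix (Fin n) (Fin n) ℝ} {y : Model n}
    (hg : ∀ a b, ContDiffAt ℝ 1 (fun z => g z a b) y) (hdet : (g y).det ≠ 0) (i : Fin n) :
    partialDerivMatrix i (fun z => (g z)⁻¹) y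
      = -((g y)⁻¹ * partialDerivMatrix i g y * (g y)⁻¹) := by
  have hinv := contDiffAt_inv_apply hg hdet
  have key : partialDerivMatrix i (fun z => (g z)⁻¹) y * g y
      + (g y)⁻¹ * partialDerivMatrix i g y = 0 := by
    ext a b
    have h0 : (fun z => ∑ c, (g z)⁻¹ a c * g z c b) =ᶠ[𝓝 y]
        fun _ => (1 : Matrix (Fin n) (Fin n) ℝ) a b := by
      filter_upwards [eventually_det_ne_zero hg hdet] with z hz
      rw [← Matrix.mul_apply, Matrix.nonsing_inv_mul _ (isUnit_iff_ne_zero.2 hz)]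
    have h1 := partialDeriv_congr i h0
    rw [partialDeriv_const, partialDeriv_sum] at h1
    · simp only [Matrix.add_apply, Matrix.mul_apply, Matrix.zero_apply, ← Finset.sum_add_distrib]
      rw [← h1]
      refine Finset.sum_congr rfl fun c _ => ?_
      rw [partialDeriv_mul i ((hinv a c).differentiableAt (by simp))
        ((hg c b).differentiableAt (by simp))]
      rfl
    · exact fun c _ => ((hinv a c).mul (hg c b)).differentiableAt (by simp)
  have h2 := congrArg (· * (g y)⁻¹) (eq_neg_of_add_eq_zero_left key)
  simp only [neg_mul] at h2
  rwa [Matrix.mul_nonsing_inv_cancel_right _ _ (isUnit_iff_ne_zero.2 hdet)] at h2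

/-- The Christoffel symbols of a metric given by its matrix. -/
def coordChristoffel (g : Model n → Matrix (Fin n) (Fin n) ℝ) (k i j : Fin n) (y : Model n) : ℝ :=
  (1 / 2 : ℝ) * ∑ l, (g y)⁻¹ k l *
    (partialDeriv i (fun z => g z j l) y + partialDeriv j (fun z => g z i l) y
      - partialDeriv l (fun z => g z i j) y)

/-- The Laplacian, in coordinates, of a metric given by its matrix. -/
def coordLaplacian (g : Model n → Matrix (Fin n) (Fin n) ℝ) (F : Model n → ℝ) (y : Model n) : ℝ :=
  ∑ i, ∑ j, (g y)⁻¹ i j * (partialDeriv i (partialDeriv j F) y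
    - ∑ k, coordChristoffel g k i j y * partialDeriv k F y)

/-- The contraction `∑ g^{ij} Γ^k_{ij} v_k` in terms of the derivatives of the metric. -/
lemma sum_inv_mul_coordChristoffel {g : Model n → Matrix (Fin n) (Fin n) ℝ} {y : Model n}
    (hsymm : ∀ z a b, g z a b = g z b a) (v : Fin n → ℝ) :
    ∑ i, ∑ j, (g y)⁻¹ i j * ∑ k, coordChristoffel g k i j y * v k
      = ∑ i, ∑ k, ((g y)⁻¹ * partialDerivMatrix i g y * (g y)⁻¹) i k * v k
        - (1 / 2) * ∑ l, ∑ k, ((g y)⁻¹ * partialDerivMatrix l g y).trace * (g y)⁻¹ l k * v k := by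
  have hT : (g y).transpose = g y := by ext a b; exact hsymm y b a
  have hI : ∀ a b, (g y)⁻¹ a b = (g y)⁻¹ b a := fun a b => by
    have := Matrix.transpose_nonsing_inv (g y)
    rw [hT] at this
    exact congrFun (congrFun this b) a
  set G := (g y)⁻¹
  set P : Fin n → Fin n → Fin n → ℝ := fun l a b => partialDeriv l (fun z => g z a b) y with hP
  have hPs : ∀ l a b, P l a b = P l b a := fun l a b => by
    simp only [hP]; congr 1; ext z; exact hsymm z a b
  have hL : ∀ i j k, coordChristoffel g k i j y
      = ∑ l, (1 / 2) * (G k l * (P i j l + P j i l - P l i j)) := fun i j k => by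
    rw [coordChristoffel, Finset.mul_sum]
  have e1 : ∑ i, ∑ j, G i j * ∑ k, coordChristoffel g k i j y * v k
      = (1 / 2) * ∑ i, ∑ j, ∑ k, ∑ l, G i j * G k l * P i j l * v k
        + (1 / 2) * ∑ i, ∑ j, ∑ k, ∑ l, G i j * G k l * P j i l * v k
        - (1 / 2) * ∑ i, ∑ j, ∑ k, ∑ l, G i j * G k l * P l i j * v k := by
    simp only [hL, Finset.mul_sum, Finset.sum_mul, ← Finset.sum_add_distrib,
      ← Finset.sum_sub_distrib]
    refine Finset.sum_congr rfl fun i _ => Finset.sum_congr rfl fun j _ =>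
      Finset.sum_congr rfl fun k _ => Finset.sum_congr rfl fun l _ => ?_
    ring
  -- The first two terms of `Γ^k_{ij}` are exchanged by `i ↔ j`, so they agree after contraction
  -- with the symmetric `g^{ij}`.
  have e2 : ∑ i, ∑ j, ∑ k, ∑ l, G i j * G k l * P j i l * v k
      = ∑ i, ∑ j, ∑ k, ∑ l, G i j * G k l * P i j l * v k := by
    rw [Finset.sum_comm]
    refine Finset.sum_congr rfl fun i _ => Finset.sum_congr rfl fun j _ =>
      Finset.sum_congr rfl fun k _ => Finset.sum_congr rfl fun l _ => ?_
    rw [hI j i]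
  have e3 : ∑ i, ∑ k, (G * partialDerivMatrix i g y * G) i k * v k
      = ∑ i, ∑ j, ∑ k, ∑ l, G i j * G k l * P i j l * v k := by
    refine Finset.sum_congr rfl fun i _ => ?_
    rw [Finset.sum_comm]
    refine Finset.sum_congr rfl fun k _ => ?_
    simp only [Matrix.mul_apply, Finset.sum_mul]
    rw [Finset.sum_comm]
    refine Finset.sum_congr rfl fun j _ => Finset.sum_congr rfl fun l _ => ?_
    rw [hI k l]
    simp only [partialDerivMatrix, Matrix.of_apply, hP]
    ring
  have e4 : ∑ l, ∑ k, (G * partialDerivMatrix l g y).trace * G l k * v k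
      = ∑ i, ∑ j, ∑ k, ∑ l, G i j * G k l * P l i j * v k := by
    simp only [Matrix.trace, Matrix.diag, Matrix.mul_apply, Finset.sum_mul]
    have : ∀ l, ∑ k, ∑ i, ∑ j, G i j * partialDerivMatrix l g y j i * G l k * v k
      = ∑ i, ∑ j, ∑ k, G i j * G k l * P l i j * v k := fun l => by
      rw [Finset.sum_comm]
      refine Finset.sum_congr rfl fun i _ => ?_
      rw [Finset.sum_comm]
      refine Finset.sum_congr rfl fun j _ => Finset.sum_congr rfl fun k _ => ?_
      rw [hPs l i j, hI k l]
      simp only [partialDerivMatrix, Matrix.of_apply, hP]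
      ring
    simp only [this]
    rw [Finset.sum_comm]
    refine Finset.sum_congr rfl fun i _ => ?_
    rw [Finset.sum_comm]
    refine Finset.sum_congr rfl fun j _ => ?_
    rw [Finset.sum_comm]
  rw [e1, e2, e3, e4]
  ring

/-- The divergence form `√g Δ F = ∑ ∂_i (√g g^{ij} ∂_j F)` of the Laplacian. -/
lemma sum_partialDeriv_sqrt_det_mul {g : Model n → Matrix (Fin n) (Fin n) ℝ} {y : Model n}
    {F : Model n → ℝ} (hsymm : ∀ z a b, g z a b = g z b a)
    (hg : ∀ a b, ContDiffAt ℝ 1 (fun z => g z a b) y) (hdet : 0 < (g y).det)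
    (hF : ContDiffAt ℝ 2 F y) :
    ∑ i, partialDeriv i (fun z => √(g z).det * ∑ j, (g z)⁻¹ i j * partialDeriv j F z) y
      = √(g y).det * coordLaplacian g F y := by
  have hinv := contDiffAt_inv_apply hg hdet.ne'
  have hdF : ∀ j, ContDiffAt ℝ 1 (partialDeriv j F) y := fun j =>
    ContDiffAt.partialDeriv j hF (by norm_num)
  have hsq : ContDiffAt ℝ 1 (fun z => √(g z).det) y := (contDiffAt_det hg).sqrt hdet.ne'
  have hpos : 0 < √(g y).det := Real.sqrt_pos.2 hdet
  -- Differentiate `√det g * √det g = det g` with Jacobi's formula, then cancel one factor `√det g`.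
  have hDs : ∀ i, partialDeriv i (fun z => √(g z).det) y
      = √(g y).det * ((1 / 2) * ((g y)⁻¹ * partialDerivMatrix i g y).trace) := fun i => by
    have h1 : partialDeriv i (fun z => √(g z).det * √(g z).det) y
        = partialDeriv i (fun z => (g z).det) y := by
      refine partialDeriv_congr i ?_
      filter_upwards [(contDiffAt_det hg).continuousAt.eventually (lt_mem_nhds hdet)] with z hz
      exact Real.mul_self_sqrt hz.le
    rw [partialDeriv_mul i (hsq.differentiableAt (by simp)) (hsq.differentiableAt (by simp)),
      partialDeriv_det hg hdet.ne'] at h1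
    have h2 : (g y).det = √(g y).det * √(g y).det := (Real.mul_self_sqrt hdet.le).symm
    have h3 : √(g y).det * (2 * partialDeriv i (fun z => √(g z).det) y)
        = √(g y).det * (√(g y).det * ((g y)⁻¹ * partialDerivMatrix i g y).trace) := by
      rw [← mul_assoc (√(g y).det) (√(g y).det), ← h2, ← h1]; ring
    have h4 := mul_left_cancel₀ hpos.ne' h3
    linarith
  have hterm : ∀ i, partialDeriv i
      (fun z => √(g z).det * ∑ j, (g z)⁻¹ i j * partialDeriv j F z) y
      = √(g y).det * ((1 / 2) * ∑ j, ((g y)⁻¹ * partialDerivMatrix i g y).trace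
            * (g y)⁻¹ i j * partialDeriv j F y
          - ∑ j, ((g y)⁻¹ * partialDerivMatrix i g y * (g y)⁻¹) i j * partialDeriv j F y
          + ∑ j, (g y)⁻¹ i j * partialDeriv i (partialDeriv j F) y) := fun i => by
    have hprod : ∀ j ∈ Finset.univ, DifferentiableAt ℝ
        (fun z => (g z)⁻¹ i j * partialDeriv j F z) y := fun j _ =>
      ((hinv i j).mul (hdF j)).differentiableAt (by simp)
    rw [partialDeriv_mul i (hsq.differentiableAt (by simp)) (DifferentiableAt.fun_sum hprod), hDs,
      partialDeriv_sum _ i hprod]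
    have h5 : ∀ j, partialDeriv i (fun z => (g z)⁻¹ i j * partialDeriv j F z) y
        = -((g y)⁻¹ * partialDerivMatrix i g y * (g y)⁻¹) i j * partialDeriv j F y
          + (g y)⁻¹ i j * partialDeriv i (partialDeriv j F) y := fun j => by
      rw [partialDeriv_mul i ((hinv i j).differentiableAt (by simp))
        ((hdF j).differentiableAt (by simp))]
      congr 2
      exact congrFun (congrFun (partialDerivMatrix_inv hg hdet.ne' i) i) j
    simp only [h5, Finset.sum_add_distrib, neg_mul, Finset.sum_neg_distrib, mul_assoc,
      ← Finset.mul_sum]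
    ring
  simp only [hterm, ← Finset.mul_sum]
  congr 1
  -- The terms that come from differentiating `√det g` and `g⁻¹` are together exactly minus the
  -- contracted Christoffel term.
  have := sum_inv_mul_coordChristoffel (y := y) hsymm (fun k => partialDeriv k F y)
  simp only [coordLaplacian, mul_sub, Finset.sum_sub_distrib, Finset.sum_add_distrib] at this ⊢
  rw [this, ← Finset.mul_sum]
  ring

end CoordinateCalculus

lemma two_le_infty : (2 : ℕ∞ω) ≤ (∞ : ℕ∞ω) := ENat.LEInfty.out

/-! ### Positivity of the Laplacian, and second derivatives along curves. -/

section Pointwise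

variable {n : ℕ} {M : Type*} [TopologicalSpace M] [ChartedSpace (Model n) M]
  [RiemannianBundle (fun x : M => TangentSpace (𝓡 n) x)]

lemma posSemidef_metricMatrix (c : M) (y : Model n) : (metricMatrix c y).PosSemidef :=
  Matrix.posSemidef_gram ℝ (coordField c y)

/-- Writing `A = CᵀC` turns the contraction into the sum of the values of the quadratic form of `B`
on the rows of `C`. -/
lemma sum_mul_nonneg_of_posSemidef {A B : Matrix (Fin n) (Fin n) ℝ} (hA : A.PosSemidef)
    (hB : ∀ v : Fin n → ℝ, 0 ≤ ∑ i, ∑ j, B i j * v i * v j) :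
    0 ≤ ∑ i, ∑ j, A i j * B i j := by
  open MatrixOrder in
  obtain ⟨C, hC⟩ := CStarAlgebra.nonneg_iff_eq_star_mul_self.1 hA.nonneg
  have hAe : ∀ i j, A i j = ∑ k, C k i * C k j := fun i j => by
    rw [hC, Matrix.mul_apply]; simp
  have : ∑ i, ∑ j, A i j * B i j = ∑ k, ∑ i, ∑ j, B i j * C k i * C k j := by
    simp only [hAe, Finset.sum_mul]
    conv_rhs => rw [Finset.sum_comm]
    refine Finset.sum_congr rfl fun i _ => ?_
    conv_rhs => rw [Finset.sum_comm]
    refine Finset.sum_congr rfl fun j _ => Finset.sum_congr rfl fun k _ => ?_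
    ring
  rw [this]
  exact Finset.sum_nonneg fun k _ => hB (C k)

lemma laplacian_nonneg {u : M → ℝ} {p : M} (h : ∀ v, 0 ≤ hessian (n := n) u p v v) :
    0 ≤ laplacian (n := n) u p :=
  sum_mul_nonneg_of_posSemidef (posSemidef_metricMatrix p _).inv fun v =>
    h (show TangentSpace (𝓡 n) p from (WithLp.toLp 2 v : Model n))

lemma laplaceRatio_nonneg {u : M → ℝ} {p : M} (h : ∀ v, 0 ≤ hessian (n := n) u p v v) :
    0 ≤ laplaceRatio (n := n) u p :=
  div_nonneg (laplacian_nonneg h) (sq_nonneg _)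

lemma IsConvexFun.lowerBound_spec {Ω : Set M} {f : M → ℝ}
    (hconv : IsConvexFun (n := n) Ω f) {t : ℝ} (ht : 0 < t) :
    ((levelSet Ω f t).Nonempty → IsGLB (laplaceRatio (n := n) f '' levelSet Ω f t)
      (lowerBound (n := n) Ω f t)) ∧ 0 ≤ lowerBound (n := n) Ω f t := by
  have h0 : ∀ r ∈ laplaceRatio (n := n) f '' levelSet Ω f t, 0 ≤ r := by
    rintro _ ⟨x, hx, rfl⟩
    exact laplaceRatio_nonneg (hconv x hx.1 (hx.2 ▸ ht))
  -- The second component also covers an empty level set, where `sInf ∅ = 0`.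
  exact ⟨fun hne => isGLB_csInf (hne.image _) ⟨0, fun r hr => h0 r hr⟩, Real.sInf_nonneg h0⟩

lemma fderiv_apply_eq_sum (F : Model n → ℝ) (y v : Model n) :
    fderiv ℝ F y v = ∑ i, partialDeriv i F y * v i := by
  conv_lhs => rw [← (EuclideanSpace.basisFun (Fin n) ℝ).sum_repr v]
  simp [partialDeriv, basisVec, mul_comm]

lemma hasDerivAt_comp_curve {F : Model n → ℝ} {c : ℝ → Model n} {s : ℝ}
    (hF : DifferentiableAt ℝ F (c s)) (hc : ∀ i, DifferentiableAt ℝ (fun τ => c τ i) s) :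
    HasDerivAt (fun τ => F (c τ)) (∑ i, partialDeriv i F (c s) * deriv (fun τ => c τ i) s) s := by
  have h1 : HasDerivAt c (deriv c s) s := (differentiableAt_euclidean.2 hc).hasDerivAt
  have h2 : ∀ i, deriv (fun τ => c τ i) s = deriv c s i := fun i =>
    ((EuclideanSpace.proj i : Model n →L[ℝ] ℝ).hasFDerivAt.comp_hasDerivAt s h1).deriv
  simp only [h2, ← fderiv_apply_eq_sum]
  exact hF.hasFDerivAt.comp_hasDerivAt s h1

lemma deriv_deriv_comp_curve {F : Model n → ℝ} {c : ℝ → Model n} {s : ℝ}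
    (hF : ContDiffAt ℝ 2 F (c s)) (hc : ∀ i, ContDiffAt ℝ 2 (fun τ => c τ i) s) :
    deriv (deriv (fun τ => F (c τ))) s
      = ∑ i, ∑ j, partialDeriv i (partialDeriv j F) (c s)
          * deriv (fun τ => c τ i) s * deriv (fun τ => c τ j) s
        + ∑ i, partialDeriv i F (c s) * deriv (deriv (fun τ => c τ i)) s := by
  have hcc : ContinuousAt c s := by
    have : ContDiffAt ℝ 2 c s := contDiffAt_euclidean.2 hc
    exact this.continuousAt
  have hev : deriv (fun τ => F (c τ)) =ᶠ[𝓝 s]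
      fun τ => ∑ i, partialDeriv i F (c τ) * deriv (fun τ => c τ i) τ := by
    have h1 : ∀ᶠ τ in 𝓝 s, ContDiffAt ℝ 2 F (c τ) :=
      hcc.eventually (hF.eventually (by simp))
    have h2 : ∀ᶠ τ in 𝓝 s, ∀ i, ContDiffAt ℝ 2 (fun τ => c τ i) τ :=
      Filter.eventually_all.2 fun i => (hc i).eventually (by simp)
    filter_upwards [h1, h2] with τ h1 h2
    exact (hasDerivAt_comp_curve (h1.differentiableAt (by simp))
      fun i => (h2 i).differentiableAt (by simp)).deriv
  rw [hev.deriv_eq]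
  have hD : ∀ i, HasDerivAt (fun τ => partialDeriv i F (c τ) * deriv (fun τ => c τ i) τ)
      ((∑ j, partialDeriv j (partialDeriv i F) (c s) * deriv (fun τ => c τ j) s)
        * deriv (fun τ => c τ i) s
        + partialDeriv i F (c s) * deriv (deriv (fun τ => c τ i)) s) s := fun i => by
    refine HasDerivAt.mul (hasDerivAt_comp_curve ?_ fun j => (hc j).differentiableAt (by simp)) ?_
    · exact (ContDiffAt.partialDeriv (k := 1) i hF (by norm_num)).differentiableAt (by simp)
    · have : ContDiffAt ℝ 1 (deriv (fun τ => c τ i)) s :=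
        ((hc i).fderiv_right (by norm_num)).clm_apply contDiffAt_const
      exact (this.differentiableAt (by simp)).hasDerivAt
  rw [(HasDerivAt.fun_sum fun i _ => hD i).deriv, Finset.sum_add_distrib]
  congr 1
  rw [Finset.sum_comm]
  refine Finset.sum_congr rfl fun i _ => ?_
  rw [Finset.sum_mul]

end Pointwise

/-! ### Functions read in charts. -/

section Charts

variable {n : ℕ} {M : Type*} [TopologicalSpace M] [ChartedSpace (Model n) M]
  [IsManifold (𝓡 n) ∞ M]

lemma contDiffAt_inChart {u : M → ℝ} {c p : M} {k : ℕ∞ω} (hk : k ≤ (∞ : ℕ∞ω))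
    (hp : p ∈ (extChartAt (𝓡 n) c).source)
    (hu : ContMDiffAt (𝓡 n) 𝓘(ℝ, ℝ) k u p) :
    ContDiffAt ℝ k (inChart c u) (extChartAt (𝓡 n) c p) := by
  rw [← contMDiffAt_iff_contDiffAt]
  have h1 : ContMDiffAt 𝓘(ℝ, Model n) (𝓡 n) (∞ : ℕ∞ω) (extChartAt (𝓡 n) c).symm
      (extChartAt (𝓡 n) c p) :=
    (contMDiffOn_extChartAt_symm c).contMDiffAt
      ((isOpen_extChartAt_target c).mem_nhds ((extChartAt (𝓡 n) c).map_source hp))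
  refine ContMDiffAt.comp (I' := 𝓡 n) _ ?_ (h1.of_le hk)
  rwa [(extChartAt (𝓡 n) c).left_inv hp]

end Charts

/-! ### Convexity along geodesics and total convexity. -/

section Geodesic

variable {n : ℕ} {M : Type*} [TopologicalSpace M] [ChartedSpace (Model n) M]
  [IsManifold (𝓡 n) ∞ M]
  [RiemannianBundle (fun x : M => TangentSpace (𝓡 n) x)]

/-- The vector `v` is the velocity in the chart centred at `γ s`. The geodesic equation expresses
the coordinate accelerations in the chain rule by Christoffel symbols, which are the correction
terms of the Hessian. -/
lemma IsGeodesicOn.deriv_deriv_comp {γ : ℝ → M} {a b s : ℝ} (hγ : IsGeodesicOn (n := n) γ a b)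
    (hs : s ∈ Set.Ioo a b) {u : M → ℝ} (hu : ContMDiffAt (𝓡 n) 𝓘(ℝ, ℝ) 2 u (γ s)) :
    ∃ v : TangentSpace (𝓡 n) (γ s),
      deriv (deriv (fun τ => u (γ τ))) s = hessian (n := n) u (γ s) v v := by
  set p := γ s with hp
  set c : ℝ → Model n := fun τ => extChartAt (𝓡 n) p (γ τ) with hc
  have hγs : ContMDiffAt 𝓘(ℝ, ℝ) (𝓡 n) 2 γ s := hγ.1.contMDiffAt (Icc_mem_nhds hs.1 hs.2)
  have hcs : ContDiffAt ℝ 2 c s := by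
    rw [← contMDiffAt_iff_contDiffAt]
    exact ContMDiffAt.comp s (contMDiffAt_extChartAt (n := 2)) hγs
  have hci : ∀ i, ContDiffAt ℝ 2 (fun τ => c τ i) s := contDiffAt_euclidean.1 hcs
  have hF : ContDiffAt ℝ 2 (inChart p u) (c s) :=
    contDiffAt_inChart two_le_infty (mem_extChartAt_source p) hu
  have hev : (fun τ => u (γ τ)) =ᶠ[𝓝 s] fun τ => inChart p u (c τ) := by
    filter_upwards [hγs.continuousAt.eventually (extChartAt_source_mem_nhds (I := 𝓡 n) p)]
      with τ hτ
    simp only [inChart, hc]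
    rw [(extChartAt (𝓡 n) p).left_inv hτ]
  refine ⟨(show TangentSpace (𝓡 n) p from
    (WithLp.toLp 2 fun i => deriv (fun τ => c τ i) s : Model n)), ?_⟩
  rw [hev.deriv.deriv_eq, deriv_deriv_comp_curve hF hci]
  have hgeo := hγ.2 s hs
  have h2 : ∀ k, deriv (deriv (fun τ => c τ k)) s = -∑ i, ∑ j, christoffel p k i j (c s)
      * deriv (fun τ => c τ i) s * deriv (fun τ => c τ j) s := fun k =>
    eq_neg_of_add_eq_zero_left (hgeo k)
  simp only [h2, hessian, hessianMatrix, Matrix.of_apply, component]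
  change _ = ∑ i, ∑ j, (partialDeriv i (partialDeriv j (inChart p u)) (c s)
      - ∑ k, christoffel p k i j (c s) * partialDeriv k (inChart p u) (c s))
      * deriv (fun τ => c τ i) s * deriv (fun τ => c τ j) s
  simp only [sub_mul, Finset.sum_sub_distrib, mul_neg, Finset.sum_neg_distrib, ← sub_eq_add_neg]
  congr 1
  simp only [Finset.mul_sum, Finset.sum_mul]
  rw [Finset.sum_comm]
  refine Finset.sum_congr rfl fun i _ => ?_
  rw [Finset.sum_comm]
  refine Finset.sum_congr rfl fun j _ => Finset.sum_congr rfl fun k _ => ?_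
  ring

/-- A function with nonnegative second derivative wherever it is at least `t` stays below `t` if it
does so at the end points. -/
lemma lt_of_deriv_deriv_nonneg {φ : ℝ → ℝ} {a b t : ℝ} (hab : a ≤ b)
    (hφ : ContinuousOn φ (Set.Icc a b)) (ha : φ a < t) (hb : φ b < t)
    (h2 : ∀ s ∈ Set.Ioo a b, t ≤ φ s →
      ∀ᶠ τ in 𝓝 s, ContDiffAt ℝ 2 φ τ ∧ 0 ≤ deriv (deriv φ) τ) :
    ∀ s ∈ Set.Icc a b, φ s < t := by
  obtain ⟨s₀, hs₀, hmax⟩ := isCompact_Icc.exists_isMaxOn (Set.nonempty_Icc.2 hab) hφ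
  by_contra! hcon
  obtain ⟨r, hr, hrt⟩ := hcon
  have hm : t ≤ φ s₀ := hrt.trans (hmax hr)
  -- The compact set of maximum points; its least element `s₁` is interior because the end values
  -- lie below `t`.
  set E := Set.Icc a b ∩ φ ⁻¹' {φ s₀} with hE
  have hEc : IsCompact E := isCompact_Icc.of_isClosed_subset
    (hφ.preimage_isClosed_of_isClosed isClosed_Icc isClosed_singleton) Set.inter_subset_left
  obtain ⟨s₁, hs₁, hleast⟩ := hEc.exists_isLeast ⟨s₀, hs₀, rfl⟩
  have hs1 : φ s₁ = φ s₀ := hs₁.2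
  have hIoo : s₁ ∈ Set.Ioo a b := by
    refine ⟨lt_of_le_of_ne hs₁.1.1 ?_, lt_of_le_of_ne hs₁.1.2 ?_⟩
    · rintro rfl; linarith
    · rintro rfl; linarith
  obtain ⟨δ, hδ, hball⟩ := Metric.eventually_nhds_iff_ball.1
    ((h2 s₁ hIoo (hs1 ▸ hm)).and (Ioo_mem_nhds hIoo.1 hIoo.2))
  have hin : ∀ τ ∈ Set.Icc (s₁ - δ / 2) (s₁ + δ / 2), τ ∈ Metric.ball s₁ δ := fun τ hτ => by
    rw [Real.ball_eq_Ioo]; exact ⟨by linarith [hτ.1], by linarith [hτ.2]⟩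
  -- Convexity around `s₁` bounds the maximum by the mean of two values that do not exceed it. Both
  -- are therefore equal to it, and the left one contradicts the minimality of `s₁`.
  have hconv : ConvexOn ℝ (Set.Icc (s₁ - δ / 2) (s₁ + δ / 2)) φ := by
    refine convexOn_of_deriv2_nonneg (convex_Icc _ _) ?_ ?_ ?_ ?_
    · exact fun τ hτ => (hball τ (hin τ hτ)).1.1.continuousAt.continuousWithinAt
    · exact fun τ hτ => ((hball τ (hin τ (interior_subset hτ))).1.1.differentiableAt
        (by simp)).differentiableWithinAt
    · intro τ hτ
      have : ContDiffAt ℝ 1 (deriv φ) τ := ((hball τ (hin τ (interior_subset hτ))).1.1.fderiv_right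
        (by norm_num)).clm_apply contDiffAt_const
      exact (this.differentiableAt (by simp)).differentiableWithinAt
    · exact fun τ hτ => (hball τ (hin τ (interior_subset hτ))).1.2
  have hl : s₁ - δ / 2 ∈ Set.Icc (s₁ - δ / 2) (s₁ + δ / 2) := ⟨le_rfl, by linarith⟩
  have hr' : s₁ + δ / 2 ∈ Set.Icc (s₁ - δ / 2) (s₁ + δ / 2) := ⟨by linarith, le_rfl⟩
  have hmid := hconv.2 hl hr' (by norm_num : (0 : ℝ) ≤ 1 / 2) (by norm_num : (0 : ℝ) ≤ 1 / 2)
    (by norm_num)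
  have e : (1 / 2 : ℝ) • (s₁ - δ / 2) + (1 / 2 : ℝ) • (s₁ + δ / 2) = s₁ := by
    simp only [smul_eq_mul]; ring
  rw [e] at hmid
  simp only [smul_eq_mul] at hmid
  have hl2 := (hball _ (hin _ hl)).2
  have h3 : φ (s₁ - δ / 2) ≤ φ s₀ := hmax ⟨hl2.1.le, hl2.2.le⟩
  have hr2 := (hball _ (hin _ hr')).2
  have h4 : φ (s₁ + δ / 2) ≤ φ s₀ := hmax ⟨hr2.1.le, hr2.2.le⟩
  have h5 : φ (s₁ - δ / 2) = φ s₀ := by linarith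
  have := hleast ⟨⟨hl2.1.le, hl2.2.le⟩, h5⟩
  linarith

variable [IsContMDiffRiemannianBundle (𝓡 n) ∞ (Model n) (fun x : M => TangentSpace (𝓡 n) x)]

variable (M) in
lemma isContinuousRiemannianBundle :
    IsContinuousRiemannianBundle (Model n) (fun x : M => TangentSpace (𝓡 n) x) := by
  obtain ⟨g, hg, h⟩ := IsContMDiffRiemannianBundle.exists_contMDiff (IB := 𝓡 n) (n := (∞ : ℕ∞ω))
    (F := Model n) (E := fun x : M => TangentSpace (𝓡 n) x)
  exact ⟨g, hg.continuous, h⟩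

variable [MeasurableSpace M]

/-- The Riemannian distance to `x` tends to `0` in the topology of the manifold, so a Lipschitz
bound in this distance gives continuity. Dividing by `C + 1` avoids the case `C = 0`. -/
lemma IsParameterizing.continuousOn {Ω : Set M} {R : EReal} {f : M → ℝ}
    (hf : IsParameterizing (n := n) Ω R f) : ContinuousOn f Ω := by
  have : IsManifold (𝓡 n) 1 M := IsManifold.of_le (n := ∞) (by simp)
  have := isContinuousRiemannianBundle (n := n) M
  obtain ⟨C, hC⟩ := hf.lipschitz
  intro x hx
  refine ContinuousAt.continuousWithinAt ?_
  rw [ContinuousAt, EMetric.tendsto_nhds]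
  intro ε hε
  have hδ : 0 < ε / (C + 1) := ENNReal.div_pos hε.ne' (by finiteness)
  filter_upwards [eventually_riemannianEDist_lt (𝓡 n) x hδ, hf.isOpen.mem_nhds hx] with y hy hyΩ
  rw [edist_comm]
  calc edist (f x) (f y) ≤ C * Manifold.riemannianEDist (𝓡 n) x y := hC x hx y hyΩ
    _ ≤ (C + 1) * Manifold.riemannianEDist (𝓡 n) x y := by gcongr; exact le_self_add
    _ < ε := by
      rw [mul_comm]
      exact (ENNReal.lt_div_iff_mul_lt (Or.inl (by simp)) (Or.inl (by finiteness))).1 hy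

lemma IsParameterizing.isOpen_pos {Ω : Set M} {R : EReal} {f : M → ℝ}
    (hf : IsParameterizing (n := n) Ω R f) : IsOpen {x ∈ Ω | 0 < f x} :=
  hf.continuousOn.isOpen_inter_preimage hf.isOpen isOpen_Ioi

lemma IsParameterizing.isTotallyConvexIn {Ω : Set M} {R : EReal} {f : M → ℝ}
    (hf : IsParameterizing (n := n) Ω R f) (hconv : IsConvexFun (n := n) Ω f) {t : ℝ}
    (ht : t ∈ levels R) : IsTotallyConvexIn (n := n) Ω (sublevelSet Ω f t) := by
  intro a b γ hab hγ hΩ ha hb s hs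
  have hcont : ContinuousOn (fun τ => f (γ τ)) (Set.Icc a b) :=
    hf.continuousOn.comp hγ.1.continuousOn hΩ
  refine ⟨hΩ s hs, (hf.mem_Ico _ (hΩ s hs)).1, ?_⟩
  -- Second derivatives matter only at times with `f (γ r) ≥ t > 0`, and near such points `f` is
  -- smooth with nonnegative Hessian.
  refine lt_of_deriv_deriv_nonneg hab hcont ha.2.2 hb.2.2 (fun r hr htr => ?_) s hs
  have hγr : ContinuousAt γ r := hγ.1.continuousOn.continuousAt (Icc_mem_nhds hr.1 hr.2)
  have hmem : γ r ∈ {x ∈ Ω | 0 < f x} := ⟨hΩ r (Set.Ioo_subset_Icc_self hr), ht.1.trans_le htr⟩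
  filter_upwards [hγr.eventually (hf.isOpen_pos.mem_nhds hmem), Ioo_mem_nhds hr.1 hr.2]
    with τ hτ hτab
  have hfτ : ContMDiffAt (𝓡 n) 𝓘(ℝ, ℝ) 2 f (γ τ) :=
    (hf.smooth.contMDiffAt (hf.isOpen_pos.mem_nhds hτ)).of_le two_le_infty
  constructor
  · rw [← contMDiffAt_iff_contDiffAt]
    exact hfτ.comp τ (hγ.1.contMDiffAt (Icc_mem_nhds hτab.1 hτab.2))
  · obtain ⟨v, hv⟩ := hγ.deriv_deriv_comp hτab hfτ
    rw [hv]
    exact hconv _ hτ.1 hτ.2 v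

end Geodesic

/-! ### Gram matrices. -/

section GramMatrix

/-- The inner product in terms of the pairings with a basis and the inverse Gram matrix. -/
lemma sum_gram_inv_mul_inner {n : ℕ} {E : Type*} [NormedAddCommGroup E] [InnerProductSpace ℝ E]
    {b : Fin n → E} (hb : LinearIndependent ℝ b) {x : E}
    (hx : x ∈ Submodule.span ℝ (Set.range b)) (w : E) :
    ∑ i, ∑ j, (Matrix.gram ℝ b)⁻¹ i j * inner ℝ x (b i) * inner ℝ w (b j) = inner ℝ x w := by
  have hG : (Matrix.gram ℝ b).PosDef := Matrix.posDef_gram_of_linearIndependent hb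
  set G := Matrix.gram ℝ b with hGd
  obtain ⟨a, rfl⟩ := (Submodule.mem_span_range_iff_exists_fun ℝ).1 hx
  have h1 : ∀ j, ∑ i, G⁻¹ i j * inner ℝ (∑ l, a l • b l) (b i) = a j := fun j => by
    have : ∀ i, inner ℝ (∑ l, a l • b l) (b i) = Matrix.vecMul a G i := fun i => by
      simp [Matrix.vecMul, dotProduct, sum_inner, inner_smul_left, hGd, Matrix.gram]
    simp only [this]
    have h2 : Matrix.vecMul (Matrix.vecMul a G) G⁻¹ j = a j := by
      rw [Matrix.vecMul_vecMul, Matrix.mul_nonsing_inv _ (isUnit_iff_ne_zero.2 hG.det_pos.ne'),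
        Matrix.vecMul_one]
    rw [← h2]
    simp [Matrix.vecMul, dotProduct, mul_comm]
  rw [Finset.sum_comm]
  simp only [← Finset.sum_mul, h1]
  simp [sum_inner, inner_smul_left, real_inner_comm]

end GramMatrix

/-! ### Parametrizations: coordinate fields, gradients and area elements. -/

section Param

variable {n k : ℕ} {M : Type*} [TopologicalSpace M] [ChartedSpace (Model n) M]
  [RiemannianBundle (fun x : M => TangentSpace (𝓡 n) x)]

/-- The coordinate vector field `∂_i` of a parametrization. -/
def paramField (ψ : Model k → M) (u : Model k) (i : Fin k) : TangentSpace (𝓡 n) (ψ u) :=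
  mfderiv (𝓡 k) (𝓡 n) ψ u (basisVec i)

/-- The matrix of the metric in a parametrization. -/
def paramMatrix (ψ : Model k → M) (u : Model k) : Matrix (Fin k) (Fin k) ℝ :=
  Matrix.gram ℝ (paramField (n := n) ψ u)

lemma areaElement_eq (ψ : Model k → M) (u : Model k) :
    areaElement (n := n) ψ u = √(paramMatrix (n := n) ψ u).det := rfl

lemma paramMatrix_symm (ψ : Model k → M) (u : Model k) (a b : Fin k) :
    paramMatrix (n := n) ψ u a b = paramMatrix (n := n) ψ u b a := by
  simp only [paramMatrix, Matrix.gram_apply]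
  exact real_inner_comm _ _

lemma linearIndependent_paramField {ψ : Model k → M} {u : Model k}
    (h : Function.Injective (mfderiv (𝓡 k) (𝓡 n) ψ u)) :
    LinearIndependent ℝ (paramField (n := n) ψ u) := by
  have h1 : LinearIndependent ℝ (basisVec : Fin k → Model k) := by
    have h := (EuclideanSpace.basisFun (Fin k) ℝ).toBasis.linearIndependent
    have e : (basisVec : Fin k → Model k) = (EuclideanSpace.basisFun (Fin k) ℝ).toBasis := by
      ext i
      simp [basisVec]
    rw [e]
    exact h
  exact h1.map' (mfderiv (𝓡 k) (𝓡 n) ψ u).toLinearMap (LinearMap.ker_eq_bot.2 h)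

lemma paramMatrix_posDef {ψ : Model k → M} {u : Model k}
    (h : Function.Injective (mfderiv (𝓡 k) (𝓡 n) ψ u)) : (paramMatrix (n := n) ψ u).PosDef :=
  Matrix.posDef_gram_of_linearIndependent (linearIndependent_paramField h)

lemma areaElement_pos {ψ : Model k → M} {u : Model k}
    (h : Function.Injective (mfderiv (𝓡 k) (𝓡 n) ψ u)) : 0 < areaElement (n := n) ψ u :=
  Real.sqrt_pos.2 (paramMatrix_posDef h).det_pos

lemma areaElement_nonneg (ψ : Model k → M) (u : Model k) : 0 ≤ areaElement (n := n) ψ u :=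
  Real.sqrt_nonneg _

lemma mfderiv_sum_smul_basisVec (ψ : Model k → M) (u : Model k) (a : Fin k → ℝ) :
    mfderiv (𝓡 k) (𝓡 n) ψ u (∑ i, a i • (basisVec i : Model k))
      = ∑ i, a i • paramField (n := n) ψ u i := by
  have h := map_sum (mfderiv (𝓡 k) (𝓡 n) ψ u) (fun i => a i • (basisVec i : Model k)) Finset.univ
  refine h.trans (Finset.sum_congr rfl fun i _ => ?_)
  exact map_smul (mfderiv (𝓡 k) (𝓡 n) ψ u) (a i) (basisVec i : Model k)

lemma sum_smul_basisVec (v : Model k) : ∑ i, v i • (basisVec i : Model k) = v := by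
  conv_rhs => rw [← (EuclideanSpace.basisFun (Fin k) ℝ).sum_repr v]
  simp [basisVec]

lemma mem_span_paramField {ψ : Model n → M} {u : Model n}
    (h : Function.Injective (mfderiv (𝓡 n) (𝓡 n) ψ u)) (v : TangentSpace (𝓡 n) (ψ u)) :
    v ∈ Submodule.span ℝ (Set.range (paramField (n := n) ψ u)) := by
  let L : Model n →ₗ[ℝ] Model n := (mfderiv (𝓡 n) (𝓡 n) ψ u).toLinearMap
  obtain ⟨w, hw⟩ := (LinearMap.injective_iff_surjective (f := L)).1 h v
  have hw' : mfderiv (𝓡 n) (𝓡 n) ψ u (∑ i, w i • (basisVec i : Model n)) = v :=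
    (congrArg L (sum_smul_basisVec w)).trans hw
  rw [← hw', mfderiv_sum_smul_basisVec]
  exact Submodule.sum_mem _ fun i _ => Submodule.smul_mem _ _
    (Submodule.subset_span (Set.mem_range_self i))

lemma inner_grad (u : M → ℝ) (p : M) (v : TangentSpace (𝓡 n) p) :
    inner ℝ (grad (n := n) u p) v = mfderiv (𝓡 n) 𝓘(ℝ, ℝ) u p v := by
  have : FiniteDimensional ℝ (TangentSpace (𝓡 n) p) :=
    inferInstanceAs (FiniteDimensional ℝ (Model n))
  have : CompleteSpace (TangentSpace (𝓡 n) p) := FiniteDimensional.complete ℝ _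
  exact InnerProductSpace.toDual_symm_apply

lemma grad_eq_zero_of_eventuallyEq {φ : M → ℝ} {x : M} (h : φ =ᶠ[𝓝 x] fun _ => 0) :
    grad (n := n) φ x = 0 := by
  have : mfderiv (𝓡 n) 𝓘(ℝ, ℝ) φ x = 0 := h.mfderiv_eq.trans mfderiv_const
  rw [grad, this]
  exact map_zero _

lemma grad_eq_zero_of_notMem {φ : M → ℝ} {K : Set M} (hK : IsClosed K)
    (h0 : ∀ x, x ∉ K → φ x = 0) {x : M} (hx : x ∉ K) : grad (n := n) φ x = 0 :=
  grad_eq_zero_of_eventuallyEq (Filter.eventually_of_mem (hK.isOpen_compl.mem_nhds hx) h0)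

lemma inner_grad_paramField {ψ : Model k → M} {y : Model k} {u : M → ℝ}
    (hψ : MDifferentiableAt (𝓡 k) (𝓡 n) ψ y) (hu : MDifferentiableAt (𝓡 n) 𝓘(ℝ, ℝ) u (ψ y))
    (i : Fin k) :
    inner ℝ (grad (n := n) u (ψ y)) (paramField (n := n) ψ y i)
      = partialDeriv i (fun z => u (ψ z)) y := by
  rw [inner_grad, partialDeriv, ← mfderiv_eq_fderiv]
  have := mfderiv_comp y hu hψ
  change _ = mfderiv (𝓡 k) 𝓘(ℝ, ℝ) (u ∘ ψ) y (basisVec i)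
  rw [this]
  rfl

lemma inner_grad_grad {ψ : Model n → M} {y : Model n} {u w : M → ℝ}
    (hψ : MDifferentiableAt (𝓡 n) (𝓡 n) ψ y)
    (hinj : Function.Injective (mfderiv (𝓡 n) (𝓡 n) ψ y))
    (hu : MDifferentiableAt (𝓡 n) 𝓘(ℝ, ℝ) u (ψ y))
    (hw : MDifferentiableAt (𝓡 n) 𝓘(ℝ, ℝ) w (ψ y)) :
    inner ℝ (grad (n := n) u (ψ y)) (grad (n := n) w (ψ y))
      = ∑ i, ∑ j, (paramMatrix (n := n) ψ y)⁻¹ i j * partialDeriv i (fun z => u (ψ z)) y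
          * partialDeriv j (fun z => w (ψ z)) y := by
  have key := sum_gram_inv_mul_inner (E := TangentSpace (𝓡 n) (ψ y))
    (linearIndependent_paramField (n := n) hinj)
    (mem_span_paramField hinj (grad (n := n) u (ψ y))) (grad (n := n) w (ψ y))
  rw [← key]
  refine Finset.sum_congr rfl fun i _ => Finset.sum_congr rfl fun j _ => ?_
  rw [inner_grad_paramField hψ hu, inner_grad_paramField hψ hw, paramMatrix]

/-- The inner product lives on the tangent space at `ψ z`. The base point and the derivative are
made separate arguments of `a` so that each can be rewritten. -/
lemma areaElement_congr {ψ ψ' : Model k → M} {z : Model k} (h : ψ =ᶠ[𝓝 z] ψ') :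
    areaElement (n := n) ψ z = areaElement (n := n) ψ' z := by
  let a : M → (Model k →L[ℝ] Model n) → ℝ := fun p L => √(Matrix.det (Matrix.of fun i j : Fin k =>
    (inner ℝ (show TangentSpace (𝓡 n) p from L (basisVec i))
      (show TangentSpace (𝓡 n) p from L (basisVec j)) : ℝ)))
  have h1 : areaElement (n := n) ψ z = a (ψ z) (mfderiv (𝓡 k) (𝓡 n) ψ z) := rfl
  have h2 : areaElement (n := n) ψ' z = a (ψ' z) (mfderiv (𝓡 k) (𝓡 n) ψ' z) := rfl
  rw [h1, h2, h.eq_of_nhds]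
  congr 1
  exact h.mfderiv_eq

/-- The area element of a reparametrization. -/
lemma areaElement_comp {ψ : Model k → M} {θ : Model k → Model k} {z : Model k}
    (hθ : DifferentiableAt ℝ θ z) (hψ : MDifferentiableAt (𝓡 k) (𝓡 n) ψ (θ z)) :
    areaElement (n := n) (fun w => ψ (θ w)) z
      = |(fderiv ℝ θ z).det| * areaElement (n := n) ψ (θ z) := by
  set J : Matrix (Fin k) (Fin k) ℝ := Matrix.of fun a i => fderiv ℝ θ z (basisVec i) a with hJ
  have h1 : ∀ i, paramField (n := n) (fun w => ψ (θ w)) z i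
      = ∑ a, J a i • paramField (n := n) ψ (θ z) a := fun i => by
    have hθ' : MDifferentiableAt (𝓡 k) (𝓡 k) θ z := hθ.mdifferentiableAt
    have hc := mfderiv_comp (I := 𝓡 k) (I' := 𝓡 k) (I'' := 𝓡 n) z hψ hθ'
    have h2 : paramField (n := n) (fun w => ψ (θ w)) z i
        = mfderiv (𝓡 k) (𝓡 n) ψ (θ z) (fderiv ℝ θ z (basisVec i)) := by
      change mfderiv (𝓡 k) (𝓡 n) (ψ ∘ θ) z (basisVec i) = _
      rw [hc, mfderiv_eq_fderiv]
      rfl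
    rw [h2]
    have h3 : fderiv ℝ θ z (basisVec i) = ∑ a, J a i • (basisVec a : Model k) :=
      (sum_smul_basisVec _).symm
    rw [h3]
    exact mfderiv_sum_smul_basisVec _ _ _
  -- The Gram matrix transforms as a bilinear form, so its determinant acquires the factor `(det
  -- J)²`.
  have h2 : paramMatrix (n := n) (fun w => ψ (θ w)) z
      = J.transpose * paramMatrix (n := n) ψ (θ z) * J := by
    ext i j
    simp only [paramMatrix, Matrix.gram_apply, h1, Matrix.mul_apply, sum_inner, inner_sum,
      inner_smul_left, inner_smul_right, Matrix.transpose_apply, Finset.sum_mul]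
    refine Finset.sum_congr rfl fun a _ => ?_
    rw [Finset.mul_sum]
    refine Finset.sum_congr rfl fun b _ => ?_
    simp only [conj_trivial]
    rw [real_inner_comm]
    ring
  have h3 : J.det = (fderiv ℝ θ z).det := by
    rw [ContinuousLinearMap.det, ← LinearMap.det_toMatrix (EuclideanSpace.basisFun (Fin k) ℝ).toBasis]
    congr 1
  rw [areaElement_eq, h2, Matrix.det_mul, Matrix.det_mul, Matrix.det_transpose, h3, areaElement_eq]
  rw [show ∀ a b : ℝ, a * b * a = a ^ 2 * b by intros; ring, Real.sqrt_mul (sq_nonneg _),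
    Real.sqrt_sq_eq_abs]

variable [IsManifold (𝓡 n) ∞ M]
  [IsContMDiffRiemannianBundle (𝓡 n) ∞ (Model n) (fun x : M => TangentSpace (𝓡 n) x)]

/-- The field `∂_i` along `ψ` is the tangent map of `ψ` applied to a constant vector field, hence a
smooth map into the tangent bundle; the metric is smooth on such maps. -/
lemma contDiffOn_paramMatrix {ψ : Model k → M} {U : Set (Model k)} (hU : IsOpen U)
    (hψ : ContMDiffOn (𝓡 k) (𝓡 n) ∞ ψ U) (a b : Fin k) :
    ContDiffOn ℝ ∞ (fun u => paramMatrix (n := n) ψ u a b) U := by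
  have : IsManifold (𝓡 n) 1 M := IsManifold.of_le (n := ∞) (by simp)
  have hsec : ∀ i : Fin k, ContMDiffOn (𝓡 k) ((𝓡 n).prod 𝓘(ℝ, Model n)) ∞
      (fun u => (⟨ψ u, paramField (n := n) ψ u i⟩ : TangentBundle (𝓡 n) M)) U := fun i => by
    have h1 := hψ.contMDiffOn_tangentMapWithin (m := ∞) (by simp) hU.uniqueMDiffOn
    have h2 : ContMDiff (𝓡 k) (𝓡 k).tangent ∞
        (fun y : Model k => (⟨y, (basisVec i : Model k)⟩ : TangentBundle (𝓡 k) (Model k))) := by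
      intro y
      refine (Bundle.contMDiffAt_section (n := ∞) (IB := 𝓡 k) (F := Model k)
        (E := TangentSpace (𝓡 k) (M := Model k)) (s := fun _ => (basisVec i : Model k)) y).2 ?_
      simpa using contMDiffAt_const
    have h3 := h1.comp h2.contMDiffOn (s := U) (fun y hy => hy)
    refine h3.congr fun y hy => ?_
    simp only [Function.comp, tangentMapWithin, mfderivWithin_of_isOpen hU hy]
    rfl
  exact ((hsec a).inner_bundle (hsec b)).contDiffOn

lemma contDiffOn_areaElement {ψ : Model k → M} {U : Set (Model k)} (hU : IsOpen U)
    (hψ : ContMDiffOn (𝓡 k) (𝓡 n) ∞ ψ U)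
    (hinj : ∀ u ∈ U, Function.Injective (mfderiv (𝓡 k) (𝓡 n) ψ u)) :
    ContDiffOn ℝ ∞ (areaElement (n := n) ψ) U := fun u hu => by
  refine ContDiffAt.contDiffWithinAt ?_
  refine ContDiffAt.sqrt (contDiffAt_det fun a b => ?_) (paramMatrix_posDef (hinj u hu)).det_pos.ne'
  exact (contDiffOn_paramMatrix hU hψ a b).contDiffAt (hU.mem_nhds hu)

end Param

/-! ### The Riemannian measure in a parametrization. -/

section Measure

variable {n k : ℕ} {M : Type*} [TopologicalSpace M] [ChartedSpace (Model n) M]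
  [RiemannianBundle (fun x : M => TangentSpace (𝓡 n) x)]
  [MeasurableSpace M] [BorelSpace M]

/-- A local parametrization of `S` that covers the part of `S` in the open set `O` and has the
smooth left inverse `ℓ` there. -/
structure IsAdaptedParam (S : Set M) (ψ : Model k → M) (U : Set (Model k)) (ℓ : M → Model k)
    (O : Set M) : Prop where
  isLocalParam : IsLocalParam (n := n) k S ψ U
  isOpen : IsOpen O
  contMDiffOn_inv : ContMDiffOn (𝓡 n) (𝓡 k) ∞ ℓ O
  mapsTo : Set.MapsTo ψ U O
  left_inv : ∀ u ∈ U, ℓ (ψ u) = u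
  subset_image : O ∩ S ⊆ ψ '' U

lemma measurableSet_inter_preimage {U : Set (Model k)} (hU : IsOpen U) {ψ : Model k → M}
    (hψ : ContinuousOn ψ U) {A : Set M} (hA : MeasurableSet A) : MeasurableSet (U ∩ ψ ⁻¹' A) := by
  have h1 : Measurable (fun u : U => ψ u) := (continuousOn_iff_continuous_domRestrict.1 hψ).measurable
  have h2 := hU.measurableSet.subtype_image (h1 hA)
  convert h2 using 1
  ext u
  simp [and_comm]

lemma paramMeasure_apply {U : Set (Model k)} (hU : IsOpen U) {ψ : Model k → M}
    (hψ : ContinuousOn ψ U) {A : Set M} (hA : MeasurableSet A) :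
    paramMeasure (n := n) ψ U A
      = ∫⁻ u in U ∩ ψ ⁻¹' A, ENNReal.ofReal (areaElement (n := n) ψ u) := by
  have hm : AEMeasurable ψ (volume.restrict U) := hψ.aemeasurable hU.measurableSet
  rw [paramMeasure, Measure.map_apply_of_aemeasurable
    (hm.mono_ac (withDensity_absolutelyContinuous _ _)) hA, withDensity_apply',
    Measure.restrict_restrict' hU.measurableSet, Set.inter_comm]

lemma paramMeasure_compl {U : Set (Model k)} (hU : IsOpen U) {ψ : Model k → M}
    (hψ : ContinuousOn ψ U) {A : Set M} (hA : MeasurableSet A) (h : Set.MapsTo ψ U A) :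
    paramMeasure (n := n) ψ U Aᶜ = 0 := by
  rw [paramMeasure_apply hU hψ hA.compl]
  have : U ∩ ψ ⁻¹' Aᶜ = ∅ := by
    ext u; simp only [Set.mem_inter_iff, Set.mem_preimage, Set.mem_compl_iff,
      Set.mem_empty_iff_false, iff_false, not_and, not_not]
    exact fun hu => h hu
  rw [this]
  simp

/-- Over `O` the other parametrization factors as `ψ' = ψ ∘ θ` with the injective transition map `θ
= ℓ ∘ ψ'`. The area elements differ by `|det Dθ|`, so the change of variables formula applies. Only
an inequality results, because `ψ'` may cover less of `A ∩ S`. -/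
lemma IsAdaptedParam.paramMeasure_le {S : Set M} {ψ : Model k → M} {U : Set (Model k)}
    {ℓ : M → Model k} {O : Set M} (h : IsAdaptedParam (n := n) S ψ U ℓ O)
    {ψ' : Model k → M} {U' : Set (Model k)} (h' : IsLocalParam (n := n) k S ψ' U')
    {A : Set M} (hA : MeasurableSet A) (hAO : A ⊆ O) :
    paramMeasure (n := n) ψ' U' A ≤ paramMeasure (n := n) ψ U A := by
  obtain ⟨hU, hψ, hinj, hmaps, himm⟩ := h.isLocalParam
  obtain ⟨hU', hψ', hinj', hmaps', himm'⟩ := h'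
  rw [paramMeasure_apply hU hψ.continuousOn hA, paramMeasure_apply hU' hψ'.continuousOn hA]
  set B := U' ∩ ψ' ⁻¹' A
  set θ : Model k → Model k := fun z => ℓ (ψ' z)
  have hopen : IsOpen (U' ∩ ψ' ⁻¹' O) := hψ'.continuousOn.isOpen_inter_preimage hU' h.isOpen
  have hθ : ∀ z ∈ U' ∩ ψ' ⁻¹' O, θ z ∈ U ∧ ψ (θ z) = ψ' z := fun z hz => by
    obtain ⟨u, hu, hue⟩ := h.subset_image ⟨hz.2, hmaps' hz.1⟩
    have : θ z = u := by simp only [θ]; rw [← hue, h.left_inv u hu]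
    exact ⟨this ▸ hu, this ▸ hue⟩
  have hBO : B ⊆ U' ∩ ψ' ⁻¹' O := fun z hz => ⟨hz.1, hAO hz.2⟩
  have hd : ∀ z ∈ B, DifferentiableAt ℝ θ z := fun z hz => by
    have h1 : ContMDiffAt (𝓡 k) (𝓡 k) ∞ (ℓ ∘ ψ') z :=
      ContMDiffAt.comp (I' := 𝓡 n) z
        (h.contMDiffOn_inv.contMDiffAt (h.isOpen.mem_nhds (hBO hz).2))
        (hψ'.contMDiffAt (hU'.mem_nhds hz.1))
    exact (h1.mdifferentiableAt (by simp)).differentiableAt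
  have harea : ∀ z ∈ B, areaElement (n := n) ψ' z
      = |(fderiv ℝ θ z).det| * areaElement (n := n) ψ (θ z) := fun z hz => by
    have hψd : MDifferentiableAt (𝓡 k) (𝓡 n) ψ (θ z) :=
      (hψ.contMDiffAt (hU.mem_nhds (hθ z (hBO hz)).1)).mdifferentiableAt (by simp)
    rw [← areaElement_comp (hd z hz) hψd]
    have he : (fun w => ψ (θ w)) =ᶠ[𝓝 z] ψ' := by
      filter_upwards [hopen.mem_nhds (hBO hz)] with w hw using (hθ w hw).2
    exact areaElement_congr he.symm
  have hBm : MeasurableSet B := measurableSet_inter_preimage hU' hψ'.continuousOn hA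
  have hθinj : Set.InjOn θ B := fun z hz w hw hzw => hinj' hz.1 hw.1 (by
    rw [← (hθ z (hBO hz)).2, ← (hθ w (hBO hw)).2, hzw])
  calc ∫⁻ u in B, ENNReal.ofReal (areaElement (n := n) ψ' u)
      = ∫⁻ u in B, ENNReal.ofReal |(fderiv ℝ θ u).det|
          * ENNReal.ofReal (areaElement (n := n) ψ (θ u)) := by
        refine setLIntegral_congr_fun hBm fun z hz => ?_
        rw [harea z hz, ENNReal.ofReal_mul (abs_nonneg _)]
    _ = ∫⁻ u in θ '' B, ENNReal.ofReal (areaElement (n := n) ψ u) :=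
        (lintegral_image_eq_lintegral_abs_det_fderiv_mul volume hBm
          (fun z hz => (hd z hz).hasFDerivAt.hasFDerivWithinAt) hθinj
          (fun u => ENNReal.ofReal (areaElement (n := n) ψ u))).symm
    _ ≤ ∫⁻ u in U ∩ ψ ⁻¹' A, ENNReal.ofReal (areaElement (n := n) ψ u) := by
        refine lintegral_mono_set ?_
        rintro _ ⟨z, hz, rfl⟩
        refine ⟨(hθ z (hBO hz)).1, ?_⟩
        rw [Set.mem_preimage, (hθ z (hBO hz)).2]
        exact hz.2

/-- On the range of an adapted parametrization, the Riemannian measure is the measure of the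
parametrization. -/
lemma IsAdaptedParam.restrict_riemannianMeasure {S : Set M} {ψ : Model k → M} {U : Set (Model k)}
    {ℓ : M → Model k} {O : Set M} (h : IsAdaptedParam (n := n) S ψ U ℓ O) :
    (riemannianMeasure (n := n) k S).restrict O = paramMeasure (n := n) ψ U := by
  have hO := h.isOpen.measurableSet
  have hself : (paramMeasure (n := n) ψ U).restrict O = paramMeasure (n := n) ψ U := by
    have hc := h.isLocalParam.2.1.continuousOn
    refine Measure.restrict_eq_self_of_ae_mem ?_
    rw [ae_iff]
    exact paramMeasure_compl h.isLocalParam.1 hc hO h.mapsTo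
  apply le_antisymm
  · have hle : riemannianMeasure (n := n) k S
        ≤ paramMeasure (n := n) ψ U + (⊤ : Measure M).restrict Oᶜ := by
      refine sSup_le ?_
      rintro μ ⟨ψ', U', h', rfl⟩
      rw [Measure.le_iff]
      intro A hA
      rw [← measure_inter_add_sdiff A hO, Measure.add_apply, Measure.restrict_apply hA]
      refine add_le_add ?_ ?_
      · exact (h.paramMeasure_le h' (hA.inter hO) Set.inter_subset_right).trans
          (measure_mono Set.inter_subset_left)
      · exact (le_top : paramMeasure (n := n) ψ' U' ≤ ⊤) (A ∩ Oᶜ)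
    refine (Measure.restrict_mono le_rfl hle).trans ?_
    rw [Measure.restrict_add, hself, Measure.restrict_restrict hO]
    simp
  · rw [← hself]
    exact Measure.restrict_mono le_rfl (le_sSup ⟨ψ, U, h.isLocalParam, rfl⟩)

/-- Every parametrized piece of `S` is concentrated on `S`, so `⊤` restricted to `S` bounds the
supremum. -/
lemma riemannianMeasure_compl {S : Set M} (hS : MeasurableSet S) :
    riemannianMeasure (n := n) k S Sᶜ = 0 := by
  have hle : riemannianMeasure (n := n) k S ≤ (⊤ : Measure M).restrict S := by
    refine sSup_le ?_
    rintro μ ⟨ψ', U', h', rfl⟩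
    rw [← Measure.restrict_eq_self_of_ae_mem (μ := paramMeasure (n := n) ψ' U') (s := S)]
    · exact Measure.restrict_mono le_rfl le_top
    · rw [ae_iff]
      exact paramMeasure_compl h'.1 h'.2.1.continuousOn hS h'.2.2.2.1
  refine le_antisymm ((hle _).trans ?_) zero_le
  rw [Measure.restrict_apply hS.compl]
  simp

lemma IsAdaptedParam.aestronglyMeasurable {S : Set M} {ψ : Model k → M} {U : Set (Model k)}
    {ℓ : M → Model k} {O : Set M} (h : IsAdaptedParam (n := n) S ψ U ℓ O)
    {φ : M → ℝ} (hφ : ContinuousOn φ O) :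
    AEStronglyMeasurable φ (paramMeasure (n := n) ψ U) := by
  rw [← h.restrict_riemannianMeasure]
  exact hφ.aestronglyMeasurable h.isOpen.measurableSet

end Measure

/-! ### Integrals over the range of a parametrization. -/

section MeasureIntegral

variable {n k : ℕ} {M : Type*} [TopologicalSpace M] [ChartedSpace (Model n) M]
  [IsManifold (𝓡 n) ∞ M]
  [RiemannianBundle (fun x : M => TangentSpace (𝓡 n) x)]
  [IsContMDiffRiemannianBundle (𝓡 n) ∞ (Model n) (fun x : M => TangentSpace (𝓡 n) x)]
  [MeasurableSpace M] [BorelSpace M]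
  {S : Set M} {ψ : Model k → M} {U : Set (Model k)} {ℓ : M → Model k} {O : Set M}

lemma IsAdaptedParam.integrableOn_iff (h : IsAdaptedParam (n := n) S ψ U ℓ O)
    {φ : M → ℝ} (hφ : ContinuousOn φ O) :
    IntegrableOn φ O (riemannianMeasure (n := n) k S)
      ↔ IntegrableOn (fun u => areaElement (n := n) ψ u * φ (ψ u)) U := by
  obtain ⟨hU, hψ, hinj, hmaps, himm⟩ := h.isLocalParam
  have hm : AEMeasurable ψ (volume.restrict U) := hψ.continuousOn.aemeasurable hU.measurableSet
  have ha : AEMeasurable (fun u => ENNReal.ofReal (areaElement (n := n) ψ u)) (volume.restrict U) :=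
    ((contDiffOn_areaElement hU hψ himm).continuousOn.aemeasurable hU.measurableSet).ennreal_ofReal
  have hφm := h.aestronglyMeasurable hφ
  rw [IntegrableOn, h.restrict_riemannianMeasure, paramMeasure, integrable_map_measure hφm
    (hm.mono_ac (withDensity_absolutelyContinuous _ _)),
    integrable_withDensity_iff_integrable_smul₀' ha (by simp)]
  simp only [ENNReal.toReal_ofReal (areaElement_nonneg _ _), smul_eq_mul, Function.comp]
  rfl

lemma IsAdaptedParam.setIntegral_eq (h : IsAdaptedParam (n := n) S ψ U ℓ O)
    {φ : M → ℝ} (hφ : ContinuousOn φ O) :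
    ∫ x in O, φ x ∂(riemannianMeasure (n := n) k S)
      = ∫ u in U, areaElement (n := n) ψ u * φ (ψ u) := by
  obtain ⟨hU, hψ, hinj, hmaps, himm⟩ := h.isLocalParam
  have hm : AEMeasurable ψ (volume.restrict U) := hψ.continuousOn.aemeasurable hU.measurableSet
  have ha : AEMeasurable (fun u => ENNReal.ofReal (areaElement (n := n) ψ u)) (volume.restrict U) :=
    ((contDiffOn_areaElement hU hψ himm).continuousOn.aemeasurable hU.measurableSet).ennreal_ofReal
  have hφm := h.aestronglyMeasurable hφ
  rw [h.restrict_riemannianMeasure, paramMeasure, integral_map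
    (hm.mono_ac (withDensity_absolutelyContinuous _ _)) hφm,
    integral_withDensity_eq_integral_toReal_smul₀ ha (by simp)]
  simp only [ENNReal.toReal_ofReal (areaElement_nonneg _ _), smul_eq_mul]

end MeasureIntegral

/-! ### Extension by zero and integration by parts on the model space. -/

section Extension

variable {E : Type*} [NormedAddCommGroup E] [NormedSpace ℝ E]

/-- `U` and the complement of `C` are open and cover the space; the extension is `F` on the former
and `0` on the latter. -/
lemma contDiff_indicator {U C : Set E} {F : E → ℝ} {k : ℕ∞ω} (hU : IsOpen U) (hC : IsClosed C)
    (hCU : C ⊆ U) (hF : ContDiffOn ℝ k F U) (h0 : ∀ x ∈ U, x ∉ C → F x = 0) :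
    ContDiff ℝ k (U.indicator F) := by
  rw [contDiff_iff_contDiffAt]
  intro x
  by_cases hx : x ∈ U
  · refine (hF.contDiffAt (hU.mem_nhds hx)).congr_of_eventuallyEq ?_
    filter_upwards [hU.mem_nhds hx] with y hy using Set.indicator_of_mem hy F
  · refine (contDiffAt_const (c := (0 : ℝ))).congr_of_eventuallyEq ?_
    filter_upwards [hC.isOpen_compl.mem_nhds (fun h => hx (hCU h))] with y hy
    by_cases hyU : y ∈ U
    · rw [Set.indicator_of_mem hyU, h0 y hyU hy]
    · exact Set.indicator_of_notMem hyU F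

lemma hasCompactSupport_indicator {X : Type*} [TopologicalSpace X] [T2Space X] {U C : Set X}
    {F : X → ℝ} (hC : IsCompact C) (h0 : ∀ x ∈ U, x ∉ C → F x = 0) :
    HasCompactSupport (U.indicator F) :=
  HasCompactSupport.intro hC fun x hx => by
    by_cases hxU : x ∈ U
    · rw [Set.indicator_of_mem hxU, h0 x hxU hx]
    · exact Set.indicator_of_notMem hxU F

/-- Integration by parts against the constant function `1`. -/
lemma integral_partialDeriv_eq_zero {n : ℕ} {F : Model n → ℝ} (hF : ContDiff ℝ 1 F)
    (hc : HasCompactSupport F) (i : Fin n) : ∫ y, partialDeriv i F y = 0 := by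
  have hcont : Continuous (fun y => fderiv ℝ F y (basisVec i)) :=
    (hF.continuous_fderiv (by simp)).clm_apply continuous_const
  have hsupp : HasCompactSupport (fun y => fderiv ℝ F y (basisVec i)) := hc.fderiv_apply ℝ _
  have h := integral_mul_fderiv_eq_neg_fderiv_mul_of_integrable (μ := (volume : Measure (Model n)))
    (f := fun _ => (1 : ℝ)) (g := F) (v := basisVec i) (by simp)
    (by simpa using hcont.integrable_of_hasCompactSupport hsupp)
    (by simpa using hF.continuous.integrable_of_hasCompactSupport hc)
    (fun x _ => differentiableAt_const _) (fun x _ => (hF.differentiable (by simp)) x)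
  simpa [partialDeriv] using h

lemma partialDeriv_indicator {n : ℕ} {U C : Set (Model n)} {F : Model n → ℝ} (hU : IsOpen U)
    (hC : IsClosed C) (hCU : C ⊆ U) (h0 : ∀ x ∈ U, x ∉ C → F x = 0) (i : Fin n) :
    partialDeriv i (U.indicator F) = U.indicator (partialDeriv i F) := by
  ext x
  by_cases hx : x ∈ U
  · rw [Set.indicator_of_mem hx]
    refine partialDeriv_congr i ?_
    filter_upwards [hU.mem_nhds hx] with y hy using Set.indicator_of_mem hy F
  · rw [Set.indicator_of_notMem hx, ← partialDeriv_const (n := n) (y := x) 0 i]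
    refine partialDeriv_congr i ?_
    filter_upwards [hC.isOpen_compl.mem_nhds (fun h => hx (hCU h))] with y hy
    by_cases hyU : y ∈ U
    · rw [Set.indicator_of_mem hyU, h0 y hyU hy]
    · exact Set.indicator_of_notMem hyU F

lemma continuousAt_coordLaplacian {n : ℕ} {g : Model n → Matrix (Fin n) (Fin n) ℝ} {y : Model n}
    {F : Model n → ℝ} (hg : ∀ a b, ContDiffAt ℝ 1 (fun z => g z a b) y) (hdet : (g y).det ≠ 0)
    (hF : ContDiffAt ℝ 2 F y) : ContinuousAt (coordLaplacian g F) y := by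
  have hinv : ∀ a b, ContinuousAt (fun z => (g z)⁻¹ a b) y := fun a b =>
    (contDiffAt_inv_apply hg hdet a b).continuousAt
  have hF1 : ∀ j, ContDiffAt ℝ 1 (partialDeriv j F) y := fun j =>
    ContDiffAt.partialDeriv j hF (by norm_num)
  have hF2 : ∀ i j, ContinuousAt (partialDeriv i (partialDeriv j F)) y := fun i j =>
    (ContDiffAt.partialDeriv (k := 0) i (hF1 j) (by simp)).continuousAt
  have hg1 : ∀ i a b, ContinuousAt (partialDeriv i (fun z => g z a b)) y := fun i a b =>
    (ContDiffAt.partialDeriv (k := 0) i (hg a b) (by simp)).continuousAt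
  have hG : ∀ k i j, ContinuousAt (coordChristoffel g k i j) y := fun k i j => by
    refine continuousAt_const.mul (tendsto_finsetSum _ fun l _ => ?_)
    exact (hinv k l).mul (((hg1 i j l).add (hg1 j i l)).sub (hg1 l i j))
  refine tendsto_finsetSum _ fun i _ => tendsto_finsetSum _ fun j _ => ?_
  refine (hinv i j).mul ((hF2 i j).sub (tendsto_finsetSum _ fun k _ => ?_))
  exact (hG k i j).mul (hF1 k).continuousAt

end Extension

/-! ### Compact supports in adapted parametrizations. -/

section AdaptedParam

variable {n k : ℕ} {M : Type*} [TopologicalSpace M] [ChartedSpace (Model n) M]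
  [RiemannianBundle (fun x : M => TangentSpace (𝓡 n) x)]
  {S : Set M} {ψ : Model k → M} {U : Set (Model k)} {ℓ : M → Model k} {O : Set M}

lemma IsAdaptedParam.right_inv (h : IsAdaptedParam (n := n) S ψ U ℓ O) {x : M} (hx : x ∈ O)
    (hxS : x ∈ S) : ℓ x ∈ U ∧ ψ (ℓ x) = x := by
  obtain ⟨u, hu, rfl⟩ := h.subset_image ⟨hx, hxS⟩
  rw [h.left_inv u hu]
  exact ⟨hu, rfl⟩

lemma IsAdaptedParam.inter_preimage_eq (h : IsAdaptedParam (n := n) S ψ U ℓ O) {K : Set M}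
    (hK : K ⊆ O) : U ∩ ψ ⁻¹' K = ℓ '' (K ∩ S) := by
  ext u
  constructor
  · rintro ⟨hu, huK⟩
    exact ⟨ψ u, ⟨huK, h.isLocalParam.2.2.2.1 hu⟩, h.left_inv u hu⟩
  · rintro ⟨x, ⟨hxK, hxS⟩, rfl⟩
    obtain ⟨h1, h2⟩ := h.right_inv (hK hxK) hxS
    exact ⟨h1, by rw [Set.mem_preimage, h2]; exact hxK⟩

/-- The set is the image of `K ∩ S` under the continuous left inverse `ℓ`. -/
lemma IsAdaptedParam.isCompact_inter_preimage (h : IsAdaptedParam (n := n) S ψ U ℓ O) {K : Set M}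
    (hK : K ⊆ O) (hKS : IsCompact (K ∩ S)) : IsCompact (U ∩ ψ ⁻¹' K) := by
  rw [h.inter_preimage_eq hK]
  exact hKS.image_of_continuousOn
    (h.contMDiffOn_inv.continuousOn.mono (Set.inter_subset_left.trans hK))

lemma IsAdaptedParam.inter (h : IsAdaptedParam (n := n) S ψ U ℓ O) {W : Set M} (hW : IsOpen W) :
    IsAdaptedParam (n := n) S ψ (U ∩ ψ ⁻¹' W) ℓ (O ∩ W) := by
  obtain ⟨hU, hψ, hinj, hmaps, himm⟩ := h.isLocalParam
  refine ⟨⟨hψ.continuousOn.isOpen_inter_preimage hU hW, hψ.mono Set.inter_subset_left,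
    hinj.mono Set.inter_subset_left, hmaps.mono_left Set.inter_subset_left,
    fun u hu => himm u hu.1⟩, h.isOpen.inter hW,
    h.contMDiffOn_inv.mono Set.inter_subset_left, fun u hu => ⟨h.mapsTo hu.1, hu.2⟩,
    fun u hu => h.left_inv u hu.1, ?_⟩
  rintro x ⟨⟨hxO, hxW⟩, hxS⟩
  obtain ⟨h1, h2⟩ := h.right_inv hxO hxS
  exact ⟨ℓ x, ⟨h1, by rw [Set.mem_preimage, h2]; exact hxW⟩, h2⟩

variable [IsManifold (𝓡 n) ∞ M]
  [IsContMDiffRiemannianBundle (𝓡 n) ∞ (Model n) (fun x : M => TangentSpace (𝓡 n) x)]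
  [MeasurableSpace M] [BorelSpace M]

/-- The integral of a continuous function with compact support in the range of an adapted
parametrization. -/
lemma IsAdaptedParam.integral_eq (h : IsAdaptedParam (n := n) S ψ U ℓ O) {K : Set M} (hK : K ⊆ O)
    (hKS : IsCompact (K ∩ S)) {G : M → ℝ} (hG : ContinuousOn G O) (h0 : ∀ x, x ∉ K → G x = 0) :
    Continuous (U.indicator fun u => areaElement (n := n) ψ u * G (ψ u)) ∧
    HasCompactSupport (U.indicator fun u => areaElement (n := n) ψ u * G (ψ u)) ∧
    Integrable G (riemannianMeasure (n := n) k S) ∧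
    ∫ x, G x ∂(riemannianMeasure (n := n) k S)
      = ∫ u, U.indicator (fun u => areaElement (n := n) ψ u * G (ψ u)) u := by
  obtain ⟨hU, hψ, hinj, hmaps, himm⟩ := h.isLocalParam
  have hC := h.isCompact_inter_preimage hK hKS
  have hzero : ∀ u ∈ U, u ∉ U ∩ ψ ⁻¹' K → areaElement (n := n) ψ u * G (ψ u) = 0 :=
    fun u hu huC => by rw [h0 _ fun hk => huC ⟨hu, hk⟩, mul_zero]
  have hcont : Continuous (U.indicator fun u => areaElement (n := n) ψ u * G (ψ u)) := by
    rw [← contDiff_zero (𝕜 := ℝ)]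
    refine contDiff_indicator hU hC.isClosed Set.inter_subset_left ?_ hzero
    rw [contDiffOn_zero]
    exact (contDiffOn_areaElement hU hψ himm).continuousOn.mul
      (hG.comp hψ.continuousOn h.mapsTo)
  have hsupp : HasCompactSupport (U.indicator fun u => areaElement (n := n) ψ u * G (ψ u)) :=
    hasCompactSupport_indicator hC hzero
  have hint := hcont.integrable_of_hasCompactSupport (μ := volume) hsupp
  have hsub : Function.support G ⊆ O := fun x hx => by
    by_contra hxO
    exact hx (h0 x fun hk => hxO (hK hk))
  refine ⟨hcont, hsupp, ?_, ?_⟩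
  · rw [← integrableOn_iff_integrable_of_support_subset hsub, h.integrableOn_iff hG,
      ← integrable_indicator_iff hU.measurableSet]
    exact hint
  · rw [← setIntegral_eq_integral_of_forall_compl_eq_zero
      (fun x hx => Function.notMem_support.1 fun hs => hx (hsub hs)), h.setIntegral_eq hG,
      integral_indicator hU.measurableSet]

end AdaptedParam

/-! ### Green's formula in one parametrization. -/

section Green

variable {n : ℕ} {M : Type*} [TopologicalSpace M] [T2Space M] [ChartedSpace (Model n) M]
  [RiemannianBundle (fun x : M => TangentSpace (𝓡 n) x)] [IsManifold (𝓡 n) ∞ M]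
  [IsContMDiffRiemannianBundle (𝓡 n) ∞ (Model n) (fun x : M => TangentSpace (𝓡 n) x)]
  {ψ : Model n → M} {U : Set (Model n)} {ℓ : M → Model n} {O : Set M}

/-- The Laplacian computed in a parametrization. -/
def paramLaplacian (ψ : Model n → M) (ℓ : M → Model n) (u : M → ℝ) (x : M) : ℝ :=
  coordLaplacian (paramMatrix (n := n) ψ) (fun y => u (ψ y)) (ℓ x)

lemma IsAdaptedParam.contDiffOn_comp (h : IsAdaptedParam (n := n) Set.univ ψ U ℓ O) {u : M → ℝ}
    {k : ℕ∞ω} (hk : k ≤ (∞ : ℕ∞ω)) (hu : ContMDiffOn (𝓡 n) 𝓘(ℝ, ℝ) k u O) :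
    ContDiffOn ℝ k (fun y => u (ψ y)) U :=
  (hu.comp (h.isLocalParam.2.1.of_le hk) h.mapsTo).contDiffOn

lemma IsAdaptedParam.inner_grad_grad (h : IsAdaptedParam (n := n) Set.univ ψ U ℓ O) {u w : M → ℝ}
    (hu : ContMDiffOn (𝓡 n) 𝓘(ℝ, ℝ) 1 u O) (hw : ContMDiffOn (𝓡 n) 𝓘(ℝ, ℝ) 1 w O)
    {y : Model n} (hy : y ∈ U) :
    inner ℝ (grad (n := n) u (ψ y)) (grad (n := n) w (ψ y))
      = ∑ i, ∑ j, (paramMatrix (n := n) ψ y)⁻¹ i j * partialDeriv i (fun z => u (ψ z)) y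
          * partialDeriv j (fun z => w (ψ z)) y := by
  obtain ⟨hU, hψ, hinj, hmaps, himm⟩ := h.isLocalParam
  exact LevelConvexity.inner_grad_grad
    ((hψ.contMDiffAt (hU.mem_nhds hy)).mdifferentiableAt (by simp)) (himm y hy)
    ((hu.contMDiffAt (h.isOpen.mem_nhds (h.mapsTo hy))).mdifferentiableAt (by simp))
    ((hw.contMDiffAt (h.isOpen.mem_nhds (h.mapsTo hy))).mdifferentiableAt (by simp))

lemma IsAdaptedParam.continuousOn_inner_grad_grad (h : IsAdaptedParam (n := n) Set.univ ψ U ℓ O)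
    {u w : M → ℝ} (hu : ContMDiffOn (𝓡 n) 𝓘(ℝ, ℝ) 1 u O)
    (hw : ContMDiffOn (𝓡 n) 𝓘(ℝ, ℝ) 1 w O) :
    ContinuousOn (fun x => inner ℝ (grad (n := n) u x) (grad (n := n) w x)) O := by
  obtain ⟨hU, hψ, hinj, hmaps, himm⟩ := h.isLocalParam
  have h1 := h.contDiffOn_comp ENat.LEInfty.out hu
  have h2 := h.contDiffOn_comp ENat.LEInfty.out hw
  have hP : ContinuousOn (fun y => ∑ i, ∑ j, (paramMatrix (n := n) ψ y)⁻¹ i j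
      * partialDeriv i (fun z => u (ψ z)) y * partialDeriv j (fun z => w (ψ z)) y) U := by
    intro y hy
    have hyU := hU.mem_nhds hy
    refine ContinuousAt.continuousWithinAt
      (tendsto_finsetSum _ fun i _ => tendsto_finsetSum _ fun j _ => ?_)
    refine ContinuousAt.mul (ContinuousAt.mul ?_ ?_) ?_
    · exact (contDiffAt_inv_apply (fun a b => (contDiffOn_paramMatrix hU hψ a b).contDiffAt hyU)
        (paramMatrix_posDef (himm y hy)).det_pos.ne' i j).continuousAt
    · exact (ContDiffAt.partialDeriv (k := 0) i (h1.contDiffAt hyU) (by simp)).continuousAt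
    · exact (ContDiffAt.partialDeriv (k := 0) j (h2.contDiffAt hyU) (by simp)).continuousAt
  refine (hP.comp h.contMDiffOn_inv.continuousOn
    fun x hx => (h.right_inv hx (Set.mem_univ x)).1).congr fun x hx => ?_
  obtain ⟨h3, h4⟩ := h.right_inv hx (Set.mem_univ x)
  have := h.inner_grad_grad hu hw h3
  rw [h4] at this
  exact this

lemma IsAdaptedParam.continuousOn_paramLaplacian (h : IsAdaptedParam (n := n) Set.univ ψ U ℓ O)
    {u : M → ℝ} (hu : ContMDiffOn (𝓡 n) 𝓘(ℝ, ℝ) 2 u O) :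
    ContinuousOn (paramLaplacian (n := n) ψ ℓ u) O := by
  obtain ⟨hU, hψ, hinj, hmaps, himm⟩ := h.isLocalParam
  have h1 := h.contDiffOn_comp two_le_infty hu
  have : ContinuousOn (coordLaplacian (paramMatrix (n := n) ψ) (fun y => u (ψ y))) U :=
    fun y hy => (continuousAt_coordLaplacian
      (fun a b => ((contDiffOn_paramMatrix hU hψ a b).contDiffAt (hU.mem_nhds hy)).of_le
        ENat.LEInfty.out) (paramMatrix_posDef (himm y hy)).det_pos.ne'
      (h1.contDiffAt (hU.mem_nhds hy))).continuousWithinAt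
  exact this.comp h.contMDiffOn_inv.continuousOn fun x hx => (h.right_inv hx (Set.mem_univ x)).1

variable [MeasurableSpace M] [BorelSpace M]

/-- Green's formula in the range of a parametrization. -/
lemma IsAdaptedParam.green (h : IsAdaptedParam (n := n) Set.univ ψ U ℓ O) {u φ : M → ℝ}
    (hu : ContMDiffOn (𝓡 n) 𝓘(ℝ, ℝ) 2 u O) (hφ : ContMDiffOn (𝓡 n) 𝓘(ℝ, ℝ) 1 φ O)
    {K : Set M} (hK : IsCompact K) (hKO : K ⊆ O) (h0 : ∀ x, x ∉ K → φ x = 0) :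
    Integrable (fun x => inner ℝ (grad (n := n) φ x) (grad (n := n) u x)) (vol (n := n)) ∧
    Integrable (fun x => φ x * paramLaplacian (n := n) ψ ℓ u x) (vol (n := n)) ∧
    ∫ x, inner ℝ (grad (n := n) φ x) (grad (n := n) u x) ∂(vol (n := n))
      = -∫ x, φ x * paramLaplacian (n := n) ψ ℓ u x ∂(vol (n := n)) := by
  obtain ⟨hU, hψ, hinj, hmaps, himm⟩ := h.isLocalParam
  have hK' : IsCompact (K ∩ Set.univ) := by simpa using hK
  have hC := h.isCompact_inter_preimage hKO hK'
  have hu1 : ContMDiffOn (𝓡 n) 𝓘(ℝ, ℝ) 1 u O := hu.of_le (by norm_num)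
  set F : Model n → ℝ := fun y => u (ψ y) with hFdef
  set Φ : Model n → ℝ := fun y => φ (ψ y) with hΦdef
  have hF := h.contDiffOn_comp two_le_infty hu
  have hΦ := h.contDiffOn_comp ENat.LEInfty.out hφ
  obtain ⟨c1, s1, i1, e1⟩ := h.integral_eq hKO hK' (h.continuousOn_inner_grad_grad hφ hu1)
    (fun x hx => by rw [grad_eq_zero_of_notMem hK.isClosed h0 hx, inner_zero_left])
  obtain ⟨c2, s2, i2, e2⟩ := h.integral_eq hKO hK'
    (G := fun x => φ x * paramLaplacian (n := n) ψ ℓ u x)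
    (hφ.continuousOn.mul (h.continuousOn_paramLaplacian hu))
    (fun x hx => by rw [h0 x hx, zero_mul])
  refine ⟨i1, i2, ?_⟩
  -- The components of `√det g · grad u`, whose coordinate divergence is `√det g · Δu`.
  set X : Fin n → Model n → ℝ := fun i z => √(paramMatrix (n := n) ψ z).det *
    ∑ j, (paramMatrix (n := n) ψ z)⁻¹ i j * partialDeriv j F z with hX
  have hg : ∀ y ∈ U, ∀ a b, ContDiffAt ℝ 1 (fun z => paramMatrix (n := n) ψ z a b) y :=
    fun y hy a b => ((contDiffOn_paramMatrix hU hψ a b).contDiffAt (hU.mem_nhds hy)).of_le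
        ENat.LEInfty.out
  have hdet : ∀ y ∈ U, 0 < (paramMatrix (n := n) ψ y).det := fun y hy =>
    (paramMatrix_posDef (himm y hy)).det_pos
  have hX1 : ∀ i, ∀ y ∈ U, ContDiffAt ℝ 1 (X i) y := fun i y hy => by
    refine ((contDiffAt_det (hg y hy)).sqrt (hdet y hy).ne').mul (ContDiffAt.sum fun j _ => ?_)
    exact (contDiffAt_inv_apply (hg y hy) (hdet y hy).ne' i j).mul
      (ContDiffAt.partialDeriv j (hF.contDiffAt (hU.mem_nhds hy)) (by norm_num))
  have hΦ1 : ∀ y ∈ U, ContDiffAt ℝ 1 Φ y := fun y hy => hΦ.contDiffAt (hU.mem_nhds hy)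
  have hz : ∀ i, ∀ y ∈ U, y ∉ U ∩ ψ ⁻¹' K → Φ y * X i y = 0 := fun i y hy hyC => by
    rw [hΦdef]; simp only; rw [h0 _ fun hk => hyC ⟨hy, hk⟩, zero_mul]
  have hE : ∀ i, ContDiff ℝ 1 (U.indicator fun y => Φ y * X i y) := fun i =>
    contDiff_indicator hU hC.isClosed Set.inter_subset_left
      (fun y hy => ((hΦ1 y hy).mul (hX1 i y hy)).contDiffWithinAt) (hz i)
  have hEs : ∀ i, HasCompactSupport (U.indicator fun y => Φ y * X i y) := fun i =>
    hasCompactSupport_indicator hC (hz i)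
  -- Both integrands together form the coordinate divergence of `Φ X`, extended by zero; it has
  -- compact support and so integrates to `0`.
  have hpt : ∀ y, U.indicator (fun y => areaElement (n := n) ψ y *
        inner ℝ (grad (n := n) φ (ψ y)) (grad (n := n) u (ψ y))) y
      + U.indicator (fun y => areaElement (n := n) ψ y *
        (φ (ψ y) * paramLaplacian (n := n) ψ ℓ u (ψ y))) y
      = ∑ i, partialDeriv i (U.indicator fun y => Φ y * X i y) y := fun y => by
    have hpi : ∀ i, partialDeriv i (U.indicator fun y => Φ y * X i y) y
        = U.indicator (partialDeriv i fun y => Φ y * X i y) y := fun i => by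
      rw [partialDeriv_indicator hU hC.isClosed Set.inter_subset_left (hz i)]
    simp only [hpi]
    by_cases hy : y ∈ U
    · simp only [Set.indicator_of_mem hy]
      have hd : ∀ i, partialDeriv i (fun y => Φ y * X i y) y
          = partialDeriv i Φ y * X i y + Φ y * partialDeriv i (X i) y := fun i =>
        partialDeriv_mul i ((hΦ1 y hy).differentiableAt (by simp))
          ((hX1 i y hy).differentiableAt (by simp))
      simp only [hd, Finset.sum_add_distrib, ← Finset.mul_sum]
      have hdiv := sum_partialDeriv_sqrt_det_mul (g := paramMatrix (n := n) ψ) (F := F)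
        (fun z a b => paramMatrix_symm ψ z a b) (hg y hy) (hdet y hy)
        (hF.contDiffAt (hU.mem_nhds hy))
      rw [hX]
      simp only
      rw [hdiv, h.inner_grad_grad hφ hu1 hy, areaElement_eq, paramLaplacian, h.left_inv y hy]
      congr 1
      · simp only [Finset.mul_sum]
        refine Finset.sum_congr rfl fun i _ => Finset.sum_congr rfl fun j _ => ?_
        ring
      · ring
    · simp [Set.indicator_of_notMem hy]
  have hsum : ∫ x, inner ℝ (grad (n := n) φ x) (grad (n := n) u x) ∂(vol (n := n))
      + ∫ x, φ x * paramLaplacian (n := n) ψ ℓ u x ∂(vol (n := n)) = 0 := by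
    rw [vol, e1, e2, ← integral_add (c1.integrable_of_hasCompactSupport s1)
      (c2.integrable_of_hasCompactSupport s2)]
    simp only [hpt]
    rw [integral_finsetSum]
    · exact Finset.sum_eq_zero fun i _ => integral_partialDeriv_eq_zero (hE i) (hEs i) i
    · intro i _
      refine Continuous.integrable_of_hasCompactSupport ?_ ((hEs i).fderiv_apply ℝ _)
      exact ((hE i).continuous_fderiv (by simp)).clm_apply continuous_const
  linarith

end Green

/-! ### Charts as adapted parametrizations. -/

section Charts

variable {n : ℕ} {M : Type*} [TopologicalSpace M] [ChartedSpace (Model n) M]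
  [IsManifold (𝓡 n) ∞ M]

lemma isAdaptedParam_extChartAt (c : M) :
    IsAdaptedParam (n := n) (k := n) Set.univ (extChartAt (𝓡 n) c).symm (extChartAt (𝓡 n) c).target
      (extChartAt (𝓡 n) c) (extChartAt (𝓡 n) c).source := by
  have : IsManifold (𝓡 n) 1 M := IsManifold.of_le (n := ∞) (by simp)
  refine ⟨⟨isOpen_extChartAt_target c, contMDiffOn_extChartAt_symm c,
    (extChartAt (𝓡 n) c).symm.injOn, fun _ _ => Set.mem_univ _, fun y hy => ?_⟩,
    isOpen_extChartAt_source c, by rw [extChartAt_source]; exact contMDiffOn_extChartAt,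
    (extChartAt (𝓡 n) c).symm.mapsTo,
    fun y hy => (extChartAt (𝓡 n) c).right_inv hy, fun x hx => ?_⟩
  · have h := (isInvertible_mfderivWithin_extChartAt_symm hy).injective
    rw [ModelWithCorners.range_eq_univ, mfderivWithin_univ] at h
    exact h
  · exact ⟨extChartAt (𝓡 n) c x, (extChartAt (𝓡 n) c).map_source hx.1,
      (extChartAt (𝓡 n) c).left_inv hx.1⟩

end Charts

/-! ### Calculus rules for gradients. -/

section Gradient

variable {n : ℕ} {M : Type*} [TopologicalSpace M] [ChartedSpace (Model n) M]
  [RiemannianBundle (fun x : M => TangentSpace (𝓡 n) x)]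

lemma inner_grad_sum {ι : Type*} (s : Finset ι) {φ : ι → M → ℝ} {p : M}
    (h : ∀ i ∈ s, MDifferentiableAt (𝓡 n) 𝓘(ℝ, ℝ) (φ i) p) (v : TangentSpace (𝓡 n) p) :
    inner ℝ (grad (n := n) (fun x => ∑ i ∈ s, φ i x) p) v
      = ∑ i ∈ s, inner ℝ (grad (n := n) (φ i) p) v := by
  classical
  have key : ∀ s' ⊆ s, MDifferentiableAt (𝓡 n) 𝓘(ℝ, ℝ) (fun x => ∑ i ∈ s', φ i x) p ∧
      inner ℝ (grad (n := n) (fun x => ∑ i ∈ s', φ i x) p) v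
        = ∑ i ∈ s', inner ℝ (grad (n := n) (φ i) p) v := fun s' => by
    induction s' using Finset.induction_on with
    | empty =>
      intro _
      simp only [Finset.sum_empty]
      refine ⟨mdifferentiableAt_const, ?_⟩
      rw [grad_eq_zero_of_eventuallyEq Filter.EventuallyEq.rfl, inner_zero_left]
    | insert a s' ha ih =>
      intro hs
      obtain ⟨h1, h2⟩ := ih ((Finset.subset_insert a s').trans hs)
      have h3 := h a (hs (Finset.mem_insert_self a s'))
      simp only [Finset.sum_insert ha]
      refine ⟨h3.add h1, ?_⟩
      rw [← h2]
      simp only [inner_grad]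
      have h4 : mfderiv (𝓡 n) 𝓘(ℝ, ℝ) (fun x => φ a x + ∑ i ∈ s', φ i x) p = _ :=
        (h3.hasMFDerivAt.add h1.hasMFDerivAt).mfderiv
      rw [h4]
      rfl
  exact (key s subset_rfl).2

lemma inner_grad_mul {φ χ : M → ℝ} {p : M} (hφ : MDifferentiableAt (𝓡 n) 𝓘(ℝ, ℝ) φ p)
    (hχ : MDifferentiableAt (𝓡 n) 𝓘(ℝ, ℝ) χ p) (v : TangentSpace (𝓡 n) p) :
    inner ℝ (grad (n := n) (fun x => φ x * χ x) p) v
      = φ p * inner ℝ (grad (n := n) χ p) v + χ p * inner ℝ (grad (n := n) φ p) v := by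
  have h1 := HasMFDerivAt.mul hφ.hasMFDerivAt hχ.hasMFDerivAt
  simp only [inner_grad]
  have h2 : mfderiv (𝓡 n) 𝓘(ℝ, ℝ) (fun x => φ x * χ x) p = _ := h1.mfderiv
  rw [h2]
  rfl

lemma inner_grad_comp {φ : M → ℝ} {η : ℝ → ℝ} {p : M}
    (hφ : MDifferentiableAt (𝓡 n) 𝓘(ℝ, ℝ) φ p) (hη : DifferentiableAt ℝ η (φ p))
    (v : TangentSpace (𝓡 n) p) :
    inner ℝ (grad (n := n) (fun x => η (φ x)) p) v
      = deriv η (φ p) * inner ℝ (grad (n := n) φ p) v := by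
  simp only [inner_grad]
  have h1 := mfderiv_comp p hη.mdifferentiableAt hφ
  change mfderiv (𝓡 n) 𝓘(ℝ, ℝ) (η ∘ φ) p v = _
  rw [h1, mfderiv_eq_fderiv]
  set w : ℝ := mfderiv (𝓡 n) 𝓘(ℝ, ℝ) φ p v
  change fderiv ℝ η (φ p) w = deriv η (φ p) * w
  rw [fderiv_eq_smul_deriv, smul_eq_mul, mul_comm]

end Gradient

/-! ### Chart independence of the Laplacian and the global Green formula. -/

section Invariance

variable {n : ℕ} {M : Type*} [TopologicalSpace M] [T2Space M] [ChartedSpace (Model n) M]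
  [RiemannianBundle (fun x : M => TangentSpace (𝓡 n) x)] [IsManifold (𝓡 n) ∞ M]
  [IsContMDiffRiemannianBundle (𝓡 n) ∞ (Model n) (fun x : M => TangentSpace (𝓡 n) x)]
  [MeasurableSpace M] [BorelSpace M]

/-- Transforming Christoffel symbols is avoided. The Dirichlet integral in Green's formula does not
mention the parametrization, so the difference `D` of the two Laplacians integrates to `0` against
every test function. A bump function supported where `D > 0` rules out such points. -/
lemma IsAdaptedParam.paramLaplacian_le {ψ₁ ψ₂ : Model n → M} {U₁ U₂ : Set (Model n)}
    {ℓ₁ ℓ₂ : M → Model n} {O : Set M} (h₁ : IsAdaptedParam (n := n) Set.univ ψ₁ U₁ ℓ₁ O)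
    (h₂ : IsAdaptedParam (n := n) Set.univ ψ₂ U₂ ℓ₂ O) {u : M → ℝ}
    (hu : ContMDiffOn (𝓡 n) 𝓘(ℝ, ℝ) 2 u O) {p : M} (hp : p ∈ O) :
    paramLaplacian (n := n) ψ₁ ℓ₁ u p ≤ paramLaplacian (n := n) ψ₂ ℓ₂ u p := by
  by_contra! hlt
  set D : M → ℝ := fun x => paramLaplacian (n := n) ψ₁ ℓ₁ u x - paramLaplacian (n := n) ψ₂ ℓ₂ u x
  have hD : ContinuousOn D O :=
    (h₁.continuousOn_paramLaplacian hu).sub (h₂.continuousOn_paramLaplacian hu)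
  have hV : {x ∈ O | 0 < D x} ∈ 𝓝 p :=
    (hD.isOpen_inter_preimage h₁.isOpen isOpen_Ioi).mem_nhds ⟨hp, sub_pos.2 hlt⟩
  obtain ⟨b, -, hb⟩ := (SmoothBumpFunction.nhds_basis_tsupport (I := 𝓡 n) p).mem_iff.1 hV
  have hK : IsCompact (tsupport b) := b.hasCompactSupport
  have hKO : tsupport b ⊆ O := fun x hx => (hb hx).1
  have h0 : ∀ x, x ∉ tsupport b → b x = 0 := fun x hx => image_eq_zero_of_notMem_tsupport hx
  have hbs : ContMDiffOn (𝓡 n) 𝓘(ℝ, ℝ) 1 b O := (b.contMDiff.of_le ENat.LEInfty.out).contMDiffOn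
  obtain ⟨-, i1, e1⟩ := h₁.green hu hbs hK hKO h0
  obtain ⟨-, i2, e2⟩ := h₂.green hu hbs hK hKO h0
  have hzero : ∫ x, b x * D x ∂(vol (n := n)) = 0 := by
    simp only [D, mul_sub]
    rw [integral_sub i1 i2]
    linarith
  obtain ⟨c, s, -, e⟩ := h₁.integral_eq hKO (by simpa using hK) (G := fun x => b x * D x)
    (hbs.continuousOn.mul hD) (fun x hx => by rw [h0 x hx, zero_mul])
  have hnonneg : ∀ x, 0 ≤ b x * D x := fun x => by
    by_cases hx : x ∈ tsupport b
    · exact mul_nonneg b.nonneg (hb hx).2.le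
    · rw [h0 x hx, zero_mul]
  have hpos : 0 < ∫ x, b x * D x ∂(vol (n := n)) := by
    rw [vol, e]
    obtain ⟨h3, h4⟩ := h₁.right_inv hp (Set.mem_univ p)
    refine c.integral_pos_of_hasCompactSupport_nonneg_nonzero (x := ℓ₁ p) s (fun y => ?_) ?_
    · exact Set.indicator_nonneg (fun y _ => mul_nonneg (areaElement_nonneg _ _) (hnonneg _)) y
    · rw [Set.indicator_of_mem h3, h4, b.eq_one, one_mul]
      exact (mul_pos (areaElement_pos (h₁.isLocalParam.2.2.2.2 _ h3)) (sub_pos.2 hlt)).ne'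
  exact hpos.ne' hzero

/-- The Laplacian can be computed in any parametrization. -/
lemma IsAdaptedParam.laplacian_eq {ψ : Model n → M} {U : Set (Model n)}
    {ℓ : M → Model n} {O : Set M} (h : IsAdaptedParam (n := n) Set.univ ψ U ℓ O) {u : M → ℝ}
    (hu : ContMDiffOn (𝓡 n) 𝓘(ℝ, ℝ) 2 u O) {p : M} (hp : p ∈ O) :
    laplacian (n := n) u p = paramLaplacian (n := n) ψ ℓ u p := by
  have hc := isAdaptedParam_extChartAt (n := n) p
  have h1 := h.inter hc.isOpen
  have h2 := hc.inter h.isOpen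
  rw [Set.inter_comm (extChartAt (𝓡 n) p).source O] at h2
  have hu' := hu.mono (Set.inter_subset_left (t := (extChartAt (𝓡 n) p).source))
  have hp' : p ∈ O ∩ (extChartAt (𝓡 n) p).source := ⟨hp, mem_extChartAt_source p⟩
  -- By definition `laplacian` at `p` is the Laplacian of the chart centred at `p`, so the claim
  -- compares two parametrizations over the same open set.
  exact le_antisymm (h2.paramLaplacian_le h1 hu' hp') (h1.paramLaplacian_le h2 hu' hp')

variable [SecondCountableTopology M]

/-- Compactness gives a finite subcover `t`; indices outside `t` get the zero function, so that the
family is indexed by all of `ι`. -/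
lemma exists_partition {ι : Type*} {K : Set M} (hK : IsCompact K) {V : ι → Set M}
    (hV : ∀ i, IsOpen (V i)) (hKV : K ⊆ ⋃ i, V i) :
    ∃ (t : Finset ι) (ρ : ι → M → ℝ), (∀ i, ContMDiff (𝓡 n) 𝓘(ℝ, ℝ) ∞ (ρ i)) ∧
      (∀ i, tsupport (ρ i) ⊆ V i) ∧ (∀ x ∈ K, ∑ i ∈ t, ρ i x = 1) := by
  have : LocallyCompactSpace M := ChartedSpace.locallyCompactSpace (Model n) M
  obtain ⟨t, ht⟩ := hK.elim_finite_subcover V hV hKV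
  obtain ⟨ρ, hρ⟩ := SmoothPartitionOfUnity.exists_isSubordinate (𝓡 n) hK.isClosed
    (fun i : t => V i) (fun i => hV i) (by simpa [Set.iUnion_subtype] using ht)
  classical
  refine ⟨t, fun i => if h : i ∈ t then ρ ⟨i, h⟩ else fun _ => 0, fun i => ?_, fun i => ?_,
    fun x hx => ?_⟩
  · by_cases h : i ∈ t
    · simpa [h] using (ρ ⟨i, h⟩).contMDiff
    · simpa [h] using contMDiff_const
  · by_cases h : i ∈ t
    · simpa [h] using hρ ⟨i, h⟩
    · simp only [h, dif_neg, not_false_eq_true]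
      rw [show (fun _ : M => (0 : ℝ)) = 0 from rfl, tsupport_zero]
      exact Set.empty_subset _
  · have h1 := ρ.sum_eq_one hx
    rw [finsum_eq_sum_of_fintype] at h1
    rw [← h1, ← Finset.sum_coe_sort]
    exact Finset.sum_congr rfl fun i _ => by simp

/-- Green's formula: `∫ ⟨∇φ, ∇u⟩ = -∫ φ Δu` for `φ` with compact support. -/
lemma green_formula {W : Set M} (hW : IsOpen W) {K : Set M} (hK : IsCompact K) (hKW : K ⊆ W)
    {u φ : M → ℝ} (hu : ContMDiffOn (𝓡 n) 𝓘(ℝ, ℝ) 2 u W)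
    (hφ : ContMDiffOn (𝓡 n) 𝓘(ℝ, ℝ) 1 φ W) (h0 : ∀ x, x ∉ K → φ x = 0) :
    Integrable (fun x => inner ℝ (grad (n := n) φ x) (grad (n := n) u x)) (vol (n := n)) ∧
    Integrable (fun x => φ x * laplacian (n := n) u x) (vol (n := n)) ∧
    ∫ x, inner ℝ (grad (n := n) φ x) (grad (n := n) u x) ∂(vol (n := n))
      = -∫ x, φ x * laplacian (n := n) u x ∂(vol (n := n)) := by
  obtain ⟨t, ρ, hρs, hρt, hρ1⟩ := exists_partition (n := n) hK
    (V := fun c : M => (extChartAt (𝓡 n) c).source) (fun c => isOpen_extChartAt_source c)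
    (fun x _ => Set.mem_iUnion.2 ⟨x, mem_extChartAt_source x⟩)
  have hρ0 : ∀ c x, x ∉ tsupport (ρ c) → ρ c x = 0 := fun c x hx =>
    image_eq_zero_of_notMem_tsupport hx
  set Kc : M → Set M := fun c => K ∩ tsupport (ρ c)
  have hKc : ∀ c, IsCompact (Kc c) := fun c => hK.inter_right (isClosed_tsupport _)
  have hKO : ∀ c, Kc c ⊆ (extChartAt (𝓡 n) c).source ∩ W := fun c x hx =>
    ⟨hρt c hx.2, hKW hx.1⟩
  have hφ0 : ∀ c x, x ∉ Kc c → ρ c x * φ x = 0 := fun c x hx => by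
    by_cases h1 : x ∈ K
    · rw [hρ0 c x fun h => hx ⟨h1, h⟩, zero_mul]
    · rw [h0 x h1, mul_zero]
  have hρφ : ∀ c, ContMDiffOn (𝓡 n) 𝓘(ℝ, ℝ) 1 (fun x => ρ c x * φ x) W := fun c =>
    ((hρs c).of_le ENat.LEInfty.out).contMDiffOn.mul hφ
  have hlocal := fun c => ((isAdaptedParam_extChartAt (n := n) c).inter hW).green
    (hu.mono Set.inter_subset_right) ((hρφ c).mono Set.inter_subset_right) (hKc c) (hKO c) (hφ0 c)
  -- Chart independence enters here: the local formula uses the chart at `c`, whereas `laplacian` at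
  -- `x` uses the chart at `x`.
  have hlap : ∀ c, (fun x => ρ c x * φ x * paramLaplacian (n := n) (extChartAt (𝓡 n) c).symm
      (extChartAt (𝓡 n) c) u x) = fun x => ρ c x * φ x * laplacian (n := n) u x := fun c => by
    ext x
    by_cases hx : x ∈ Kc c
    · rw [((isAdaptedParam_extChartAt (n := n) c).inter hW).laplacian_eq
        (hu.mono Set.inter_subset_right) (hKO c hx)]
    · rw [hφ0 c x hx, zero_mul, zero_mul]
  simp only [hlap] at hlocal
  have hsum : ∀ x, φ x = ∑ c ∈ t, ρ c x * φ x := fun x => by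
    by_cases hx : x ∈ K
    · rw [← Finset.sum_mul, hρ1 x hx, one_mul]
    · simp [h0 x hx]
  have e1 : (fun x => inner ℝ (grad (n := n) φ x) (grad (n := n) u x))
      = fun x => ∑ c ∈ t, inner ℝ (grad (n := n) (fun x => ρ c x * φ x) x) (grad (n := n) u x) := by
    ext x
    by_cases hx : x ∈ W
    · rw [← inner_grad_sum t fun c _ =>
        (((hρφ c).contMDiffAt (hW.mem_nhds hx)).mdifferentiableAt (by simp))]
      congr 2
      exact funext hsum
    · have hxK : x ∉ K := fun h => hx (hKW h)
      rw [grad_eq_zero_of_notMem hK.isClosed h0 hxK, inner_zero_left]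
      refine (Finset.sum_eq_zero fun c _ => ?_).symm
      rw [grad_eq_zero_of_notMem (hKc c).isClosed (hφ0 c) (fun h => hxK h.1), inner_zero_left]
  have e2 : (fun x => φ x * laplacian (n := n) u x)
      = fun x => ∑ c ∈ t, ρ c x * φ x * laplacian (n := n) u x := by
    ext x
    rw [← Finset.sum_mul, ← hsum]
  rw [e1, e2]
  refine ⟨integrable_finsetSum _ fun c _ => (hlocal c).1,
    integrable_finsetSum _ fun c _ => (hlocal c).2.1, ?_⟩
  rw [integral_finsetSum _ fun c _ => (hlocal c).1,
    integral_finsetSum _ fun c _ => (hlocal c).2.1, ← Finset.sum_neg_distrib]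
  exact Finset.sum_congr rfl fun c _ => (hlocal c).2.2

end Invariance

/-! ### Coordinate slices of the model space and Fubini's theorem. -/

section Slices

variable {m : ℕ}

/-- The point of the model space with `i`-th coordinate `τ` and the other coordinates `z`. -/
def insertCoord (i : Fin (m + 1)) (τ : ℝ) (z : Model m) : Model (m + 1) :=
  WithLp.toLp 2 (i.insertNth τ (WithLp.ofLp z))

/-- The coordinates other than the `i`-th one. -/
def removeCoord (i : Fin (m + 1)) (y : Model (m + 1)) : Model m :=
  WithLp.toLp 2 (i.removeNth (WithLp.ofLp y))

lemma insertCoord_same (i : Fin (m + 1)) (τ : ℝ) (z : Model m) : insertCoord i τ z i = τ := by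
  simp [insertCoord]

lemma insertCoord_succAbove (i : Fin (m + 1)) (τ : ℝ) (z : Model m) (j : Fin m) :
    insertCoord i τ z (i.succAbove j) = z j := by
  simp [insertCoord]

lemma removeCoord_insertCoord (i : Fin (m + 1)) (τ : ℝ) (z : Model m) :
    removeCoord i (insertCoord i τ z) = z := by
  ext j
  simp [removeCoord, insertCoord]

lemma insertCoord_removeCoord (i : Fin (m + 1)) (y : Model (m + 1)) :
    insertCoord i (y i) (removeCoord i y) = y := by
  simp [removeCoord, insertCoord]

lemma contDiff_insertCoord (i : Fin (m + 1)) {k : ℕ∞ω} :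
    ContDiff ℝ k (fun p : ℝ × Model m => insertCoord i p.1 p.2) := by
  refine contDiff_euclidean.2 fun j => ?_
  induction j using i.succAboveCases with
  | x => simpa [insertCoord_same] using contDiff_fst
  | p j =>
    simp only [insertCoord_succAbove]
    exact (contDiff_euclidean.1 contDiff_snd) j

lemma contDiff_removeCoord (i : Fin (m + 1)) {k : ℕ∞ω} :
    ContDiff ℝ k (removeCoord i : Model (m + 1) → Model m) :=
  contDiff_euclidean.2 fun j => (contDiff_euclidean.1 contDiff_id) (i.succAbove j)

/-- The values on basis vectors are read off along the lines `z + t e_j`, on which the map is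
affine. -/
lemma hasFDerivAt_insertCoord (i : Fin (m + 1)) (τ : ℝ) (z : Model m) :
    ∃ L : Model m →L[ℝ] Model (m + 1), HasFDerivAt (insertCoord i τ) L z ∧
      ∀ j, L (basisVec j) = basisVec (i.succAbove j) := by
  have hd : DifferentiableAt ℝ (insertCoord i τ) z :=
    ((contDiff_insertCoord i (k := 1)).comp (contDiff_const.prodMk contDiff_id)).differentiable
      (by simp) z
  refine ⟨_, hd.hasFDerivAt, fun j => ?_⟩
  have h1 : HasDerivAt (fun t : ℝ => insertCoord i τ (z + t • basisVec j))
      (fderiv ℝ (insertCoord i τ) z (basisVec j)) 0 := by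
    have hl : HasDerivAt (fun t : ℝ => z + t • (basisVec j : Model m)) (basisVec j) 0 := by
      simpa using ((hasDerivAt_id (0 : ℝ)).smul_const (basisVec j : Model m)).const_add z
    have hd' : HasFDerivAt (insertCoord i τ) (fderiv ℝ (insertCoord i τ) z)
        (z + (0 : ℝ) • (basisVec j : Model m)) := by simpa using hd.hasFDerivAt
    exact hd'.comp_hasDerivAt (0 : ℝ) hl
  have h2 : HasDerivAt (fun t : ℝ => insertCoord i τ (z + t • basisVec j))
      (basisVec (i.succAbove j)) 0 := by
    have e : (fun t : ℝ => insertCoord i τ (z + t • basisVec j))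
        = fun t => insertCoord i τ z + t • (basisVec (i.succAbove j) : Model (m + 1)) := by
      ext t a
      induction a using i.succAboveCases with
      | x => simp [insertCoord_same, basisVec]
      | p a => simp [insertCoord_succAbove, basisVec]
    rw [e]
    simpa using ((hasDerivAt_id (0 : ℝ)).smul_const
      (basisVec (i.succAbove j) : Model (m + 1))).const_add (insertCoord i τ z)
  exact h1.unique h2

lemma measurePreserving_insertCoord (i : Fin (m + 1)) :
    MeasurePreserving (fun p : ℝ × Model m => insertCoord i p.1 p.2)
      ((volume : Measure ℝ).prod (volume : Measure (Model m))) volume := by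
  have h1 := (MeasurePreserving.id (volume : Measure ℝ)).prod (PiLp.volume_preserving_ofLp (Fin m))
  have h2 := (volume_preserving_piFinSuccAbove (fun _ : Fin (m + 1) => ℝ) i).symm
  have h3 := (PiLp.volume_preserving_toLp (Fin (m + 1))).comp (h2.comp h1)
  exact h3

lemma integral_eq_integral_integral_insertCoord (i : Fin (m + 1)) {Q : Model (m + 1) → ℝ}
    (hQ : Continuous Q) (hc : HasCompactSupport Q) :
    ∫ y, Q y = ∫ τ, ∫ z, Q (insertCoord i τ z) := by
  have hmp := measurePreserving_insertCoord i
  have hint : Integrable Q := hQ.integrable_of_hasCompactSupport hc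
  have hint' : Integrable (fun p : ℝ × Model m => Q (insertCoord i p.1 p.2))
      ((volume : Measure ℝ).prod (volume : Measure (Model m))) :=
    hmp.integrable_comp_of_integrable hint
  have h1 : ∫ y, Q y = ∫ p : ℝ × Model m, Q (insertCoord i p.1 p.2)
      ∂((volume : Measure ℝ).prod (volume : Measure (Model m))) := by
    rw [← hmp.map_eq]
    exact integral_map hmp.measurable.aemeasurable hQ.aestronglyMeasurable
  rw [h1, integral_prod _ hint']

/-- All slices are supported in one compact set, the projection of the support of `Q`, so the
parametric integral is continuous. -/
lemma continuous_integral_insertCoord (i : Fin (m + 1)) {Q : Model (m + 1) → ℝ}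
    (hQ : Continuous Q) (hc : HasCompactSupport Q) :
    Continuous fun τ : ℝ => ∫ z, Q (insertCoord i τ z) := by
  have hs : IsCompact (removeCoord i '' tsupport Q) :=
    hc.isCompact.image (contDiff_removeCoord i (k := 0)).continuous
  have hcont : Continuous (Function.uncurry fun (τ : ℝ) (z : Model m) => Q (insertCoord i τ z)) :=
    hQ.comp (contDiff_insertCoord i (k := 0)).continuous
  have h := continuous_parametric_integral_of_continuous (μ := (volume : Measure (Model m)))
    hcont hs
  convert h using 2 with τ
  refine (setIntegral_eq_integral_of_forall_compl_eq_zero fun z hz => ?_).symm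
  by_contra hne
  exact hz ⟨insertCoord i τ z, subset_tsupport Q hne, removeCoord_insertCoord i τ z⟩

end Slices

/-! ### Straightening a function at a regular point. -/

section Straightening

variable {n k : ℕ} {M : Type*} [TopologicalSpace M] [ChartedSpace (Model n) M]

/-- A smooth map with a smooth left inverse is a parametrization. -/
lemma isAdaptedParam_of_left_inv {S : Set M} {ψ : Model k → M} {U : Set (Model k)}
    {ℓ : M → Model k} {O : Set M} (hU : IsOpen U) (hψ : ContMDiffOn (𝓡 k) (𝓡 n) ∞ ψ U)
    (hO : IsOpen O) (hℓ : ContMDiffOn (𝓡 n) (𝓡 k) ∞ ℓ O) (hmaps : Set.MapsTo ψ U O)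
    (hS : Set.MapsTo ψ U S) (hleft : ∀ u ∈ U, ℓ (ψ u) = u) (hsub : O ∩ S ⊆ ψ '' U) :
    IsAdaptedParam (n := n) S ψ U ℓ O := by
  refine ⟨⟨hU, hψ, fun u hu v hv huv => ?_, hS, fun u hu => ?_⟩, hO, hℓ, hmaps, hleft, hsub⟩
  · rw [← hleft u hu, ← hleft v hv, huv]
  · have h1 : MDifferentiableAt (𝓡 k) (𝓡 n) ψ u :=
      (hψ.contMDiffAt (hU.mem_nhds hu)).mdifferentiableAt (by simp)
    have h2 : MDifferentiableAt (𝓡 n) (𝓡 k) ℓ (ψ u) :=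
      (hℓ.contMDiffAt (hO.mem_nhds (hmaps hu))).mdifferentiableAt (by simp)
    have h3 := mfderiv_comp (I := 𝓡 k) (I' := 𝓡 n) (I'' := 𝓡 k) u h2 h1
    have h4 : mfderiv (𝓡 k) (𝓡 k) (ℓ ∘ ψ) u = ContinuousLinearMap.id ℝ (Model k) := by
      have : (ℓ ∘ ψ) =ᶠ[𝓝 u] id := by
        filter_upwards [hU.mem_nhds hu] with v hv using hleft v hv
      exact this.mfderiv_eq.trans mfderiv_id
    intro v w hvw
    have h5 : ∀ v : Model k, mfderiv (𝓡 n) (𝓡 k) ℓ (ψ u) (mfderiv (𝓡 k) (𝓡 n) ψ u v) = v :=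
      fun v => by
        have := congrArg (fun L : Model k →L[ℝ] Model k => L v) (h3.symm.trans h4)
        exact this
    exact (h5 v).symm.trans ((congrArg _ hvw).trans (h5 w))

end Straightening

section Straightening

variable {m : ℕ}

/-- Replacing the `i`-th coordinate by a function with `∂_i F ≠ 0` is a local diffeomorphism. -/
lemma exists_straightening_homeomorph {F : Model (m + 1) → ℝ} {V : Set (Model (m + 1))}
    (hV : IsOpen V) (hF : ContDiffOn ℝ ∞ F V) {i : Fin (m + 1)} {y₀ : Model (m + 1)}
    (hy₀ : y₀ ∈ V) (hi : partialDeriv i F y₀ ≠ 0) :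
    ∃ T : OpenPartialHomeomorph (Model (m + 1)) (Model (m + 1)), y₀ ∈ T.source ∧ T.source ⊆ V ∧
      (∀ y, T y i = F y) ∧ ContDiffOn ℝ ∞ T T.source ∧ ContDiffOn ℝ ∞ T.symm T.target := by
  set Φ : Model (m + 1) → Model (m + 1) := fun y => y + (F y - y i) • basisVec i with hΦ
  have hΦi : ∀ y, Φ y i = F y := fun y => by simp [hΦ, basisVec]
  have hΦs : ∀ y ∈ V, ContDiffAt ℝ ∞ Φ y := fun y hy =>
    contDiffAt_id.add (((hF.contDiffAt (hV.mem_nhds hy)).sub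
      ((contDiffAt_euclidean.1 contDiffAt_id) i)).smul contDiffAt_const)
  have hequiv : ∀ y ∈ V, partialDeriv i F y ≠ 0 →
      ∃ L : Model (m + 1) ≃L[ℝ] Model (m + 1),
        HasFDerivAt Φ (L : Model (m + 1) →L[ℝ] Model (m + 1)) y := by
    intro y hy hiy
    have hFd : HasFDerivAt F (fderiv ℝ F y) y :=
      ((hF.contDiffAt (hV.mem_nhds hy)).differentiableAt (by simp)).hasFDerivAt
    have hd : HasFDerivAt Φ (ContinuousLinearMap.id ℝ (Model (m + 1)) +
        (fderiv ℝ F y - (EuclideanSpace.proj i : Model (m + 1) →L[ℝ] ℝ)).smulRight (basisVec i)) y :=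
      (hasFDerivAt_id y).add ((hFd.sub
        (EuclideanSpace.proj i : Model (m + 1) →L[ℝ] ℝ).hasFDerivAt).smul_const (basisVec i))
    set A := ContinuousLinearMap.id ℝ (Model (m + 1)) +
        (fderiv ℝ F y - (EuclideanSpace.proj i : Model (m + 1) →L[ℝ] ℝ)).smulRight (basisVec i)
      with hA
    -- The `i`-th component of `A v = 0` says `dF(v) = 0`. Then `v = v_i e_i`, so `v_i ∂_i F = 0`
    -- and `v = 0`.
    have hinj : Function.Injective A.toLinearMap := by
      rw [← LinearMap.ker_eq_bot, LinearMap.ker_eq_bot']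
      intro v hv
      have hv' : v + (fderiv ℝ F y v - v i) • (basisVec i : Model (m + 1)) = 0 := hv
      have hvi : fderiv ℝ F y v = 0 := by
        have := congrArg (fun w : Model (m + 1) => w i) hv'
        simpa [basisVec] using this
      have hve : v = v i • (basisVec i : Model (m + 1)) := by
        rw [hvi, zero_sub, neg_smul, add_neg_eq_zero] at hv'
        exact hv'
      rw [hve, map_smul, smul_eq_mul] at hvi
      have : v i = 0 := (mul_eq_zero.1 hvi).resolve_right hiy
      rw [hve, this, zero_smul]
    refine ⟨(LinearEquiv.ofInjectiveEndo A.toLinearMap hinj).toContinuousLinearEquiv, ?_⟩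
    convert hd using 1
    ext v
    rfl
  obtain ⟨L₀, hL₀⟩ := hequiv y₀ hy₀ hi
  set T₀ := (hΦs y₀ hy₀).toOpenPartialHomeomorph Φ hL₀ (by simp) with hT₀
  have hT₀c : ∀ y, T₀ y = Φ y := fun y => rfl
  -- Restricting to `∂_i F ≠ 0` makes the derivative invertible at every source point, so the
  -- inverse is smooth on the whole target.
  have hV₁ : IsOpen (V ∩ partialDeriv i F ⁻¹' {0}ᶜ) := by
    refine ContinuousOn.isOpen_inter_preimage (fun y hy => ?_) hV isOpen_compl_singleton
    exact ((ContDiffAt.partialDeriv (k := 0) i (hF.contDiffAt (hV.mem_nhds hy))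
      (by simp)).continuousAt).continuousWithinAt
  refine ⟨T₀.restrOpen _ hV₁, ?_, ?_, ?_, ?_, ?_⟩
  · rw [OpenPartialHomeomorph.restrOpen_source]
    exact ⟨(hΦs y₀ hy₀).mem_toOpenPartialHomeomorph_source hL₀ (by simp), hy₀, hi⟩
  · rw [OpenPartialHomeomorph.restrOpen_source]
    exact fun y hy => hy.2.1
  · exact hΦi
  · rw [OpenPartialHomeomorph.restrOpen_source]
    exact fun y hy => (hΦs y hy.2.1).contDiffWithinAt
  · intro a ha
    have hs := (T₀.restrOpen _ hV₁).map_target ha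
    rw [OpenPartialHomeomorph.restrOpen_source] at hs
    obtain ⟨L, hL⟩ := hequiv _ hs.2.1 hs.2.2
    exact ((T₀.restrOpen _ hV₁).contDiffAt_symm ha (f₀' := L) hL
      (hΦs _ hs.2.1)).contDiffWithinAt

end Straightening

section Straightening

variable {m : ℕ} {M : Type*} [TopologicalSpace M] [ChartedSpace (Model (m + 1)) M] [T2Space M]
  [IsManifold (𝓡 (m + 1)) ∞ M]
  [RiemannianBundle (fun x : M => TangentSpace (𝓡 (m + 1)) x)]
  [IsContMDiffRiemannianBundle (𝓡 (m + 1)) ∞ (Model (m + 1))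
    (fun x : M => TangentSpace (𝓡 (m + 1)) x)]
  [MeasurableSpace M] [BorelSpace M]

/-- Near a regular point, a function is a coordinate of a parametrization. -/
lemma exists_straightening {f : M → ℝ} {W : Set M} (hW : IsOpen W)
    (hf : ContMDiffOn (𝓡 (m + 1)) 𝓘(ℝ, ℝ) ∞ f W) {p : M} (hp : p ∈ W)
    (hgrad : grad (n := m + 1) f p ≠ 0) :
    ∃ (i : Fin (m + 1)) (ψ : Model (m + 1) → M) (U : Set (Model (m + 1)))
      (ℓ : M → Model (m + 1)) (O : Set M),
      IsAdaptedParam (n := m + 1) Set.univ ψ U ℓ O ∧ p ∈ O ∧ O ⊆ W ∧ ∀ u ∈ U, f (ψ u) = u i := by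
  set e := extChartAt (𝓡 (m + 1)) p with he
  have hc := (isAdaptedParam_extChartAt (n := m + 1) p).inter hW
  set V := e.target ∩ e.symm ⁻¹' W
  have hV : IsOpen V := hc.isLocalParam.1
  have hpe : p ∈ e.source ∩ W := ⟨mem_extChartAt_source p, hp⟩
  have hF : ContDiffOn ℝ ∞ (fun y => f (e.symm y)) V :=
    hc.contDiffOn_comp le_rfl (hf.mono Set.inter_subset_right)
  obtain ⟨hpV, hpe'⟩ := hc.right_inv hpe (Set.mem_univ p)
  -- If all partial derivatives vanished, then so would `|grad f|² = ∑ g^{ij} ∂_i f ∂_j f`.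
  obtain ⟨i, hi⟩ : ∃ i, partialDeriv i (fun y => f (e.symm y)) (e p) ≠ 0 := by
    by_contra! hcon
    have h1 := hc.inner_grad_grad ((hf.mono Set.inter_subset_right).of_le ENat.LEInfty.out)
      ((hf.mono Set.inter_subset_right).of_le ENat.LEInfty.out) hpV
    rw [Finset.sum_eq_zero fun a _ => Finset.sum_eq_zero fun b _ => by rw [hcon a]; ring] at h1
    rw [inner_self_eq_zero, hpe'] at h1
    exact hgrad h1
  obtain ⟨T, hT0, hTV, hTi, hTs, hTs'⟩ := exists_straightening_homeomorph hV hF hpV hi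
  have hO : IsOpen ((e.source ∩ W) ∩ e ⁻¹' T.source) :=
    hc.contMDiffOn_inv.continuousOn.isOpen_inter_preimage hc.isOpen T.open_source
  have hsymm : ∀ u ∈ T.target, T.symm u ∈ V := fun u hu => hTV (T.map_target hu)
  refine ⟨i, fun u => e.symm (T.symm u), T.target, fun x => T (e x),
    (e.source ∩ W) ∩ e ⁻¹' T.source, ?_, ⟨hpe, hT0⟩, fun x hx => hx.1.2, fun u hu => ?_⟩
  · refine isAdaptedParam_of_left_inv T.open_target ?_ hO ?_ ?_ (fun _ _ => Set.mem_univ _) ?_ ?_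
    · exact hc.isLocalParam.2.1.comp hTs'.contMDiffOn hsymm
    · exact ContMDiffOn.comp (t := T.source) hTs.contMDiffOn
        (hc.contMDiffOn_inv.mono Set.inter_subset_left) fun x hx => hx.2
    · intro u hu
      refine ⟨hc.mapsTo (hsymm u hu), ?_⟩
      change e (e.symm (T.symm u)) ∈ T.source
      rw [hc.left_inv _ (hsymm u hu)]
      exact T.map_target hu
    · intro u hu
      rw [hc.left_inv _ (hsymm u hu), T.right_inv hu]
    · rintro x ⟨⟨hx1, hx2⟩, -⟩
      refine ⟨T (e x), T.map_source hx2, ?_⟩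
      simp only
      rw [T.left_inv hx2]
      exact (hc.right_inv hx1 (Set.mem_univ x)).2
  · have := hTi (T.symm u)
    rw [T.right_inv hu] at this
    exact this.symm

end Straightening

/-! ### Level sets as slices, and the coarea formula. -/

section Slice

variable {m : ℕ} {M : Type*} [TopologicalSpace M] [ChartedSpace (Model (m + 1)) M] [T2Space M]
  [IsManifold (𝓡 (m + 1)) ∞ M]
  [RiemannianBundle (fun x : M => TangentSpace (𝓡 (m + 1)) x)]
  [IsContMDiffRiemannianBundle (𝓡 (m + 1)) ∞ (Model (m + 1))
    (fun x : M => TangentSpace (𝓡 (m + 1)) x)]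
  [MeasurableSpace M] [BorelSpace M]
  {Ω : Set M} {f : M → ℝ} {i : Fin (m + 1)} {ψ : Model (m + 1) → M} {U : Set (Model (m + 1))}
  {ℓ : M → Model (m + 1)} {O : Set M}

/-- In coordinates of which `f` is one, the slices parametrize the level sets of `f`. -/
lemma IsAdaptedParam.slice (h : IsAdaptedParam (n := m + 1) Set.univ ψ U ℓ O) (hO : O ⊆ Ω)
    (hfi : ∀ u ∈ U, f (ψ u) = u i) (τ : ℝ) :
    IsAdaptedParam (n := m + 1) (levelSet Ω f τ) (fun z => ψ (insertCoord i τ z))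
      {z | insertCoord i τ z ∈ U} (fun x => removeCoord i (ℓ x)) O := by
  have hins : ContDiff ℝ ∞ (insertCoord i τ : Model m → Model (m + 1)) :=
    (contDiff_insertCoord i).comp (contDiff_const.prodMk contDiff_id)
  refine isAdaptedParam_of_left_inv (h.isLocalParam.1.preimage hins.continuous)
    (h.isLocalParam.2.1.comp hins.contMDiff.contMDiffOn fun _ hz => hz) h.isOpen
    ((contDiff_removeCoord i).contMDiff.comp_contMDiffOn h.contMDiffOn_inv)
    (fun z hz => h.mapsTo hz) (fun z hz => ⟨hO (h.mapsTo hz), ?_⟩) (fun z hz => ?_) ?_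
  · rw [hfi _ hz, insertCoord_same]
  · rw [h.left_inv _ hz, removeCoord_insertCoord]
  · rintro x ⟨hxO, -, hx⟩
    obtain ⟨h1, h2⟩ := h.right_inv hxO (Set.mem_univ x)
    have h3 : insertCoord i τ (removeCoord i (ℓ x)) = ℓ x := by
      have : ℓ x i = τ := by rw [← hfi _ h1, h2, hx]
      rw [← this, insertCoord_removeCoord]
    refine ⟨removeCoord i (ℓ x), ?_, ?_⟩
    · rw [Set.mem_ofPred_eq, h3]
      exact h1
    · change ψ (insertCoord i τ (removeCoord i (ℓ x))) = x
      rw [h3, h2]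

/-- As `f` is the `i`-th coordinate, `|grad f|² = g^{ii}`, and by Cramer's rule this is the `(i, i)`
minor divided by the determinant; the sign `(-1)^{i+i}` is `1`. -/
lemma IsAdaptedParam.det_submatrix_paramMatrix
    (h : IsAdaptedParam (n := m + 1) Set.univ ψ U ℓ O)
    (hf : ContMDiffOn (𝓡 (m + 1)) 𝓘(ℝ, ℝ) 1 f O) (hfi : ∀ u ∈ U, f (ψ u) = u i)
    {u : Model (m + 1)} (hu : u ∈ U) :
    ((paramMatrix (n := m + 1) ψ u).submatrix i.succAbove i.succAbove).det
      = (paramMatrix (n := m + 1) ψ u).det * ‖grad (n := m + 1) f (ψ u)‖ ^ 2 := by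
  obtain ⟨hU, hψ, hinj, hmaps, himm⟩ := h.isLocalParam
  have hpd : ∀ a, partialDeriv a (fun z => f (ψ z)) u = if a = i then 1 else 0 := fun a => by
    have h1 : (fun z => f (ψ z)) =ᶠ[𝓝 u] (EuclideanSpace.proj i : Model (m + 1) →L[ℝ] ℝ) := by
      filter_upwards [hU.mem_nhds hu] with z hz using hfi z hz
    rw [partialDeriv_congr a h1, partialDeriv, ContinuousLinearMap.fderiv]
    simp [basisVec, eq_comm]
  have h2 := h.inner_grad_grad hf hf hu
  simp only [hpd, mul_ite, mul_one, mul_zero, Finset.sum_ite_eq', Finset.mem_univ, if_true] at h2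
  have hdet := (paramMatrix_posDef (himm u hu)).det_pos.ne'
  rw [← real_inner_self_eq_norm_sq, h2, Matrix.inv_def, Ring.inverse_eq_inv, Matrix.smul_apply,
    Matrix.adjugate_fin_succ_eq_det_submatrix, smul_eq_mul, mul_inv_cancel_left₀ hdet,
    ← two_mul, pow_mul]
  simp

/-- The area element of a level set of `f` in coordinates of which `f` is one. -/
lemma IsAdaptedParam.areaElement_slice (h : IsAdaptedParam (n := m + 1) Set.univ ψ U ℓ O)
    (hf : ContMDiffOn (𝓡 (m + 1)) 𝓘(ℝ, ℝ) 1 f O) (hfi : ∀ u ∈ U, f (ψ u) = u i)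
    {τ : ℝ} {z : Model m} (hz : insertCoord i τ z ∈ U) :
    areaElement (n := m + 1) (fun z => ψ (insertCoord i τ z)) z
      = areaElement (n := m + 1) ψ (insertCoord i τ z)
        * ‖grad (n := m + 1) f (ψ (insertCoord i τ z))‖ := by
  have hψ : MDifferentiableAt (𝓡 (m + 1)) (𝓡 (m + 1)) ψ (insertCoord i τ z) :=
    (h.isLocalParam.2.1.contMDiffAt (h.isLocalParam.1.mem_nhds hz)).mdifferentiableAt (by simp)
  obtain ⟨L, hL, hLe⟩ := hasFDerivAt_insertCoord i τ z
  have hfield : ∀ j, paramField (n := m + 1) (fun z => ψ (insertCoord i τ z)) z j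
      = paramField (n := m + 1) ψ (insertCoord i τ z) (i.succAbove j) := fun j => by
    have hc := mfderiv_comp (I := 𝓡 m) (I' := 𝓡 (m + 1)) (I'' := 𝓡 (m + 1)) z hψ
      hL.differentiableAt.mdifferentiableAt
    change mfderiv (𝓡 m) (𝓡 (m + 1)) (ψ ∘ insertCoord i τ) z (basisVec j) = _
    rw [hc, mfderiv_eq_fderiv, hL.fderiv]
    change mfderiv (𝓡 (m + 1)) (𝓡 (m + 1)) ψ (insertCoord i τ z) (L (basisVec j)) = _
    rw [hLe]
    rfl
  have hmat : paramMatrix (n := m + 1) (fun z => ψ (insertCoord i τ z)) z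
      = (paramMatrix (n := m + 1) ψ (insertCoord i τ z)).submatrix i.succAbove i.succAbove := by
    ext a b
    simp only [paramMatrix, Matrix.gram_apply, Matrix.submatrix_apply]
    rw [hfield, hfield]
  rw [areaElement_eq, areaElement_eq, hmat, h.det_submatrix_paramMatrix hf hfi hz,
    Real.sqrt_mul (paramMatrix_posDef (h.isLocalParam.2.2.2.2 _ hz)).det_pos.le,
    Real.sqrt_sq (norm_nonneg _)]

/-- The coarea formula in coordinates of which `f` is one. -/
lemma IsAdaptedParam.coarea (h : IsAdaptedParam (n := m + 1) Set.univ ψ U ℓ O) (hO : O ⊆ Ω)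
    (hf : ContMDiffOn (𝓡 (m + 1)) 𝓘(ℝ, ℝ) 1 f O) (hfi : ∀ u ∈ U, f (ψ u) = u i)
    {K : Set M} (hK : IsCompact K) (hKO : K ⊆ O) {G : M → ℝ} (hG : ContinuousOn G O)
    (h0 : ∀ x, x ∉ K → G x = 0) :
    (∀ τ, Integrable G (surfaceMeasure (n := m + 1) (levelSet Ω f τ))) ∧
    (Continuous fun τ => ∫ x, G x ∂(surfaceMeasure (n := m + 1) (levelSet Ω f τ))) ∧
    (HasCompactSupport fun τ => ∫ x, G x ∂(surfaceMeasure (n := m + 1) (levelSet Ω f τ))) ∧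
    ∀ ζ : ℝ → ℝ, Continuous ζ →
      Integrable (fun x => ζ (f x) * (G x * ‖grad (n := m + 1) f x‖)) (vol (n := m + 1)) ∧
      ∫ τ, ζ τ * ∫ x, G x ∂(surfaceMeasure (n := m + 1) (levelSet Ω f τ))
        = ∫ x, ζ (f x) * (G x * ‖grad (n := m + 1) f x‖) ∂(vol (n := m + 1)) := by
  have hKu : IsCompact (K ∩ Set.univ) := by simpa using hK
  have hgrad : ContinuousOn (fun x => ‖grad (n := m + 1) f x‖) O := by
    simp only [norm_eq_sqrt_real_inner]
    exact (h.continuousOn_inner_grad_grad hf hf).sqrt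
  obtain ⟨hQ, hQc, -, -⟩ := h.integral_eq hKO hKu (hG.mul hgrad) (fun x hx => by simp [h0 x hx])
  set Q : Model (m + 1) → ℝ :=
    U.indicator fun u => areaElement (n := m + 1) ψ u * (G (ψ u) * ‖grad (n := m + 1) f (ψ u)‖)
  -- The factor `|grad f|` in `Q` is the ratio of the area element of the slice to that of `ψ`.
  have hslice : ∀ τ, Integrable G (surfaceMeasure (n := m + 1) (levelSet Ω f τ)) ∧
      ∫ x, G x ∂(surfaceMeasure (n := m + 1) (levelSet Ω f τ))
        = ∫ z, Q (insertCoord i τ z) := fun τ => by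
    have hKτ : IsCompact (K ∩ levelSet Ω f τ) := by
      have e : K ∩ levelSet Ω f τ = K ∩ f ⁻¹' {τ} := by
        ext x
        exact ⟨fun hx => ⟨hx.1, hx.2.2⟩, fun hx => ⟨hx.1, hO (hKO hx.1), hx.2⟩⟩
      rw [e]
      exact hK.of_isClosed_subset ((hf.continuousOn.mono hKO).preimage_isClosed_of_isClosed
        hK.isClosed isClosed_singleton) Set.inter_subset_left
    obtain ⟨-, -, h1, h2⟩ := (h.slice hO hfi τ).integral_eq hKO hKτ hG h0
    refine ⟨h1, h2.trans (integral_congr_ae (Filter.Eventually.of_forall fun z => ?_))⟩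
    by_cases hz : insertCoord i τ z ∈ U
    · simp only [Q]
      rw [Set.indicator_of_mem hz, Set.indicator_of_mem (by exact hz),
        h.areaElement_slice hf hfi hz]
      ring
    · simp only [Q]
      rw [Set.indicator_of_notMem hz, Set.indicator_of_notMem (by exact hz)]
  refine ⟨fun τ => (hslice τ).1, ?_, ?_, fun ζ hζ => ?_⟩
  · simp only [fun τ => (hslice τ).2]
    exact continuous_integral_insertCoord i hQ hQc
  · simp only [fun τ => (hslice τ).2]
    refine HasCompactSupport.intro (K := (EuclideanSpace.proj i : Model (m + 1) →L[ℝ] ℝ) ''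
      tsupport Q) (hQc.isCompact.image (EuclideanSpace.proj i).continuous) fun τ hτ => ?_
    have hzero : ∀ z, Q (insertCoord i τ z) = 0 := fun z =>
      image_eq_zero_of_notMem_tsupport fun hz => hτ ⟨_, hz, insertCoord_same i τ z⟩
    simp [hzero]
  · have hcont : ContinuousOn (fun x => ζ (f x) * (G x * ‖grad (n := m + 1) f x‖)) O :=
      (hζ.comp_continuousOn hf.continuousOn).mul (hG.mul hgrad)
    obtain ⟨hP, hPc, h1, h2⟩ := h.integral_eq hKO hKu hcont (fun x hx => by simp [h0 x hx])
    refine ⟨h1, Eq.trans ?_ h2.symm⟩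
    rw [integral_eq_integral_integral_insertCoord i hP hPc]
    refine integral_congr_ae (Filter.Eventually.of_forall fun τ => ?_)
    simp only
    rw [(hslice τ).2, ← integral_const_mul]
    refine integral_congr_ae (Filter.Eventually.of_forall fun z => ?_)
    simp only [Q]
    by_cases hz : insertCoord i τ z ∈ U
    · rw [Set.indicator_of_mem hz, Set.indicator_of_mem hz, hfi _ hz, insertCoord_same]
      ring
    · rw [Set.indicator_of_notMem hz, Set.indicator_of_notMem hz, mul_zero]

variable [SecondCountableTopology M]

/-- The coarea formula near the regular points of `f`. -/
lemma coarea_formula {W : Set M} (hW : IsOpen W) (hWΩ : W ⊆ Ω)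
    (hf : ContMDiffOn (𝓡 (m + 1)) 𝓘(ℝ, ℝ) ∞ f W) (hreg : ∀ x ∈ W, grad (n := m + 1) f x ≠ 0)
    {K : Set M} (hK : IsCompact K) (hKW : K ⊆ W) {G : M → ℝ} (hG : ContinuousOn G W)
    (h0 : ∀ x, x ∉ K → G x = 0) :
    (∀ τ, Integrable G (surfaceMeasure (n := m + 1) (levelSet Ω f τ))) ∧
    (Continuous fun τ => ∫ x, G x ∂(surfaceMeasure (n := m + 1) (levelSet Ω f τ))) ∧
    ∀ ζ : ℝ → ℝ, Continuous ζ →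
      Integrable (fun x => ζ (f x) * (G x * ‖grad (n := m + 1) f x‖)) (vol (n := m + 1)) ∧
      ∫ τ, ζ τ * ∫ x, G x ∂(surfaceMeasure (n := m + 1) (levelSet Ω f τ))
        = ∫ x, ζ (f x) * (G x * ‖grad (n := m + 1) f x‖) ∂(vol (n := m + 1)) := by
  choose i ψ U ℓ O hA hpO hOW hfi using
    fun p : W => exists_straightening (m := m) hW hf p.2 (hreg p p.2)
  obtain ⟨t, ρ, hρ, hρO, hρ1⟩ := exists_partition (n := m + 1) hK (fun p => (hA p).isOpen)
    (fun x hx => Set.mem_iUnion.2 ⟨⟨x, hKW hx⟩, hpO _⟩)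
  have hsum : ∀ x, G x = ∑ p ∈ t, ρ p x * G x := fun x => by
    by_cases hx : x ∈ K
    · rw [← Finset.sum_mul, hρ1 x hx, one_mul]
    · simp [h0 x hx]
  have hloc := fun p : W => (hA p).coarea ((hOW p).trans hWΩ)
    ((hf.mono (hOW p)).of_le ENat.LEInfty.out) (hfi p)
    (hK.inter_right (isClosed_tsupport (ρ p))) (Set.inter_subset_right.trans (hρO p))
    (G := fun x => ρ p x * G x)
    ((hρ p).continuous.continuousOn.mul (hG.mono (hOW p))) (fun x hx => by
      by_cases hxK : x ∈ K
      · rw [image_eq_zero_of_notMem_tsupport fun hxt => hx ⟨hxK, hxt⟩, zero_mul]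
      · simp [h0 x hxK])
  have hint : ∀ τ, ∫ x, G x ∂(surfaceMeasure (n := m + 1) (levelSet Ω f τ))
      = ∑ p ∈ t, ∫ x, ρ p x * G x ∂(surfaceMeasure (n := m + 1) (levelSet Ω f τ)) := fun τ => by
    rw [← integral_finsetSum _ fun p _ => (hloc p).1 τ]
    exact integral_congr_ae (Filter.Eventually.of_forall hsum)
  have hcont : Continuous fun τ => ∫ x, G x ∂(surfaceMeasure (n := m + 1) (levelSet Ω f τ)) := by
    simp only [hint]
    exact continuous_finsetSum _ fun p _ => (hloc p).2.1
  refine ⟨fun τ => ?_, hcont, fun ζ hζ => ?_⟩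
  · exact (integrable_finsetSum t fun p _ => (hloc p).1 τ).congr
      (Filter.Eventually.of_forall fun x => (hsum x).symm)
  · have hterm : ∀ x, ζ (f x) * (G x * ‖grad (n := m + 1) f x‖)
        = ∑ p ∈ t, ζ (f x) * (ρ p x * G x * ‖grad (n := m + 1) f x‖) := fun x => by
      rw [← Finset.mul_sum, ← Finset.sum_mul, ← hsum x]
    have hi : ∀ p ∈ t, Integrable (fun τ => ζ τ * ∫ x, ρ p x * G x
        ∂(surfaceMeasure (n := m + 1) (levelSet Ω f τ))) := fun p _ =>
      (hζ.mul (hloc p).2.1).integrable_of_hasCompactSupport (hloc p).2.2.1.mul_left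
    refine ⟨(integrable_finsetSum t fun p _ => ((hloc p).2.2.2 ζ hζ).1).congr
      (Filter.Eventually.of_forall fun x => (hterm x).symm), ?_⟩
    simp only [hint, hterm, Finset.mul_sum]
    rw [integral_finsetSum _ hi, integral_finsetSum _ fun p _ => ((hloc p).2.2.2 ζ hζ).1]
    exact Finset.sum_congr rfl fun p _ => ((hloc p).2.2.2 ζ hζ).2

end Slice

/-! ### The weak differential inequality for `H`. -/

section Inequality

variable {n : ℕ} {M : Type*} [TopologicalSpace M] [T2Space M] [ChartedSpace (Model n) M]
  [RiemannianBundle (fun x : M => TangentSpace (𝓡 n) x)] [IsManifold (𝓡 n) ∞ M]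
  [IsContMDiffRiemannianBundle (𝓡 n) ∞ (Model n) (fun x : M => TangentSpace (𝓡 n) x)]
  [MeasurableSpace M] [BorelSpace M] {Ω : Set M} {R : EReal} {f : M → ℝ}

lemma inner_grad_congr {φ χ : M → ℝ} {x : M} (h : φ =ᶠ[𝓝 x] χ) (v : TangentSpace (𝓡 n) x) :
    inner ℝ (grad (n := n) φ x) v = inner ℝ (grad (n := n) χ x) v := by
  rw [inner_grad, inner_grad]
  exact congrArg (fun L : Model n →L[ℝ] ℝ => L v) h.mfderiv_eq

/-- The part of `Ω` where `a ≤ f ≤ d`. -/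
def slab (Ω : Set M) (f : M → ℝ) (a d : ℝ) : Set M := closure (sublevelSet Ω f d) ∩ f ⁻¹' Set.Ici a

lemma IsParameterizing.isCompact_slab (hf : IsParameterizing (n := n) Ω R f) {a d : ℝ}
    (hd : d ∈ levels R) : IsCompact (slab Ω f a d) :=
  (hf.isCompact_closure d hd).of_isClosed_subset
    ((hf.continuousOn.mono (hf.closure_subset d hd)).preimage_isClosed_of_isClosed isClosed_closure
      isClosed_Ici) Set.inter_subset_left

lemma IsParameterizing.slab_subset (hf : IsParameterizing (n := n) Ω R f) {a d : ℝ}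
    (ha : 0 < a) (hd : d ∈ levels R) : slab Ω f a d ⊆ {x ∈ Ω | 0 < f x} :=
  fun _ hx => ⟨hf.closure_subset d hd hx.1, ha.trans_le hx.2⟩

lemma IsParameterizing.le_of_notMem_closure (hf : IsParameterizing (n := n) Ω R f) {d : ℝ} {x : M}
    (hx : x ∈ Ω) (hxd : x ∉ closure (sublevelSet Ω f d)) : d ≤ f x := by
  by_contra! hlt
  exact hxd (subset_closure ⟨hx, (hf.mem_Ico x hx).1, hlt⟩)

lemma IsParameterizing.lt_or_le_of_notMem_slab (hf : IsParameterizing (n := n) Ω R f) {a d : ℝ}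
    {x : M} (hx : x ∈ Ω) (hxs : x ∉ slab Ω f a d) : f x < a ∨ d ≤ f x := by
  by_contra! hcon
  exact hxs ⟨by_contra fun h => hcon.2.not_ge (hf.le_of_notMem_closure hx h), hcon.1⟩

variable [SecondCountableTopology M]

/-- The weak form of `H' ≥ 0`. -/
lemma IsParameterizing.integral_le_zero (hf : IsParameterizing (n := n) Ω R f)
    (hconv : IsConvexFun (n := n) Ω f) {h : M → ℝ} (hh : IsHarmonicOn (n := n) h Ω)
    {a d : ℝ} (ha : 0 < a) (hd : d ∈ levels R) {N η ζ : ℝ → ℝ}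
    (hN : ∀ τ, HasDerivAt N (η τ) τ) (hη : ∀ τ, HasDerivAt η (ζ τ) τ) (hζ : Continuous ζ)
    (hN0 : ∀ τ, N τ ≤ 0) (hNd : ∀ τ, d ≤ τ → N τ = 0) (hNa : ∀ τ, τ < a → N τ = N a)
    (hη0 : ∀ τ, 0 ≤ η τ) (hηd : ∀ τ, d ≤ τ → η τ = 0) (hηa : ∀ τ, τ < a → η τ = 0)
    (hζa : ∀ τ, τ < a → ζ τ = 0)
    (hint : Integrable (Ω.indicator fun x => ζ (f x) * (h x ^ 2 * ‖grad (n := n) f x‖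
      * ‖grad (n := n) f x‖)) (vol (n := n))) :
    ∫ x, Ω.indicator (fun x => ζ (f x) * (h x ^ 2 * ‖grad (n := n) f x‖
      * ‖grad (n := n) f x‖)) x ∂(vol (n := n)) ≤ 0 := by
  set W : Set M := {x ∈ Ω | 0 < f x} with hWdef
  have hW : IsOpen W := hf.isOpen_pos
  have hWΩ : W ⊆ Ω := fun x hx => hx.1
  have hηc : ContDiff ℝ 1 η := contDiff_one_iff_deriv.2
    ⟨fun τ => (hη τ).differentiableAt, by simpa only [funext fun τ => (hη τ).deriv] using hζ⟩
  have hNc : ContDiff ℝ 1 N := contDiff_one_iff_deriv.2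
    ⟨fun τ => (hN τ).differentiableAt,
      by simpa only [funext fun τ => (hN τ).deriv] using hηc.continuous⟩
  have hf1 : ContMDiffOn (𝓡 n) 𝓘(ℝ, ℝ) 1 f W := hf.smooth.of_le ENat.LEInfty.out
  have hh1 : ContMDiffOn (𝓡 n) 𝓘(ℝ, ℝ) 1 h Ω := hh.1.of_le (by norm_num)
  have hfsmall : ∀ x ∈ Ω, f x < a → ∀ᶠ y in 𝓝 x, f y < a := fun x hx hxa =>
    (hf.continuousOn.continuousAt (hf.isOpen.mem_nhds hx)).eventually_lt_const hxa
  have hηf : ContMDiffOn (𝓡 n) 𝓘(ℝ, ℝ) 1 (fun x => η (f x)) W :=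
    hηc.contMDiff.comp_contMDiffOn hf1
  -- Where `f < a`, possibly without smoothness of `f`, `N ∘ f` is locally constant; elsewhere `f ≥
  -- a > 0` is smooth.
  have hNf : ContMDiffOn (𝓡 n) 𝓘(ℝ, ℝ) 1 (fun x => N (f x)) Ω := fun x hx => by
    refine ContMDiffAt.contMDiffWithinAt ?_
    by_cases hxa : f x < a
    · refine (contMDiffAt_const (c := N a)).congr_of_eventuallyEq ?_
      filter_upwards [hfsmall x hx hxa] with y hy using hNa _ hy
    · have hxW : x ∈ W := ⟨hx, ha.trans_le (not_lt.1 hxa)⟩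
      exact (hNc.contMDiff.comp_contMDiffOn hf1).contMDiffAt (hW.mem_nhds hxW)
  -- `φ₁` is paired with `f` and `φ₂` with `h`. Since `N' = η`, the mixed terms `2 η(f) h ⟨grad h,
  -- grad f⟩` cancel in the first pairing minus twice the second.
  set φ₁ : M → ℝ := Ω.indicator fun x => η (f x) * (h x * h x) with hφ₁
  set φ₂ : M → ℝ := Ω.indicator fun x => N (f x) * h x with hφ₂
  have hφ₁0 : ∀ x, x ∉ slab Ω f a d → φ₁ x = 0 := fun x hx => by
    by_cases hxΩ : x ∈ Ω
    · rw [hφ₁, Set.indicator_of_mem hxΩ]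
      rcases hf.lt_or_le_of_notMem_slab hxΩ hx with h1 | h1
      · rw [hηa _ h1, zero_mul]
      · rw [hηd _ h1, zero_mul]
    · exact Set.indicator_of_notMem hxΩ _
  have hφ₂0 : ∀ x, x ∉ closure (sublevelSet Ω f d) → φ₂ x = 0 := fun x hx => by
    by_cases hxΩ : x ∈ Ω
    · rw [hφ₂, Set.indicator_of_mem hxΩ, hNd _ (hf.le_of_notMem_closure hxΩ hx), zero_mul]
    · exact Set.indicator_of_notMem hxΩ _
  have hφ₁c : ContMDiffOn (𝓡 n) 𝓘(ℝ, ℝ) 1 φ₁ W :=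
    (hηf.mul ((hh1.mono hWΩ).mul (hh1.mono hWΩ))).congr fun x hx =>
      Set.indicator_of_mem (hWΩ hx) _
  have hφ₂c : ContMDiffOn (𝓡 n) 𝓘(ℝ, ℝ) 1 φ₂ Ω :=
    (hNf.mul hh1).congr fun x hx => Set.indicator_of_mem hx _
  obtain ⟨hi1, -, he1⟩ := green_formula hW (hf.isCompact_slab hd) (hf.slab_subset ha hd)
    (hf.smooth.of_le two_le_infty) hφ₁c hφ₁0
  obtain ⟨hi2, -, he2⟩ := green_formula hf.isOpen (hf.isCompact_closure d hd)
    (hf.closure_subset d hd) hh.1 hφ₂c hφ₂0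
  have h1 : ∫ x, inner ℝ (grad (n := n) φ₁ x) (grad (n := n) f x) ∂(vol (n := n)) ≤ 0 := by
    rw [he1, neg_nonpos]
    refine integral_nonneg fun x => ?_
    by_cases hx : x ∈ slab Ω f a d
    · obtain ⟨hxΩ, hx0⟩ := hf.slab_subset ha hd hx
      refine mul_nonneg ?_ (laplacian_nonneg (hconv x hxΩ hx0))
      rw [hφ₁, Set.indicator_of_mem hxΩ]
      exact mul_nonneg (hη0 _) (mul_self_nonneg _)
    · simp [hφ₁0 x hx]
  have h2 : ∫ x, inner ℝ (grad (n := n) φ₂ x) (grad (n := n) h x) ∂(vol (n := n)) = 0 := by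
    rw [he2, neg_eq_zero]
    refine integral_eq_zero_of_ae (Filter.Eventually.of_forall fun x => ?_)
    by_cases hx : x ∈ Ω
    · simp [hh.2 x hx]
    · simp [hφ₂, Set.indicator_of_notMem hx]
  have hnh : ∀ (u : M → ℝ) (x : M), 0 ≤ inner ℝ (grad (n := n) u x) (grad (n := n) u x) :=
    fun u x => real_inner_self_nonneg
  -- On `Ω` the right side minus the left side is `-2 N(f) |grad h|²`, which is nonnegative because
  -- `N ≤ 0`.
  have hpt : ∀ x, Ω.indicator (fun x => ζ (f x) * (h x ^ 2 * ‖grad (n := n) f x‖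
      * ‖grad (n := n) f x‖)) x ≤ inner ℝ (grad (n := n) φ₁ x) (grad (n := n) f x)
        - 2 * inner ℝ (grad (n := n) φ₂ x) (grad (n := n) h x) := fun x => by
    by_cases hx : x ∈ Ω
    · have hΩx := hf.isOpen.mem_nhds hx
      have hhx : MDifferentiableAt (𝓡 n) 𝓘(ℝ, ℝ) h x :=
        (hh1.contMDiffAt hΩx).mdifferentiableAt (by simp)
      have hNx : MDifferentiableAt (𝓡 n) 𝓘(ℝ, ℝ) (fun x => N (f x)) x :=
        (hNf.contMDiffAt hΩx).mdifferentiableAt (by simp)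
      have e2 : ∀ v, inner ℝ (grad (n := n) φ₂ x) v = N (f x) * inner ℝ (grad (n := n) h x) v
          + h x * inner ℝ (grad (n := n) (fun x => N (f x)) x) v := fun v => by
        have : φ₂ =ᶠ[𝓝 x] fun x => N (f x) * h x := by
          filter_upwards [hΩx] with y hy using Set.indicator_of_mem hy _
        rw [inner_grad_congr this, inner_grad_mul hNx hhx]
      rw [Set.indicator_of_mem hx, e2]
      by_cases hxa : f x < a
      · have e1 : grad (n := n) φ₁ x = 0 := by
          refine grad_eq_zero_of_eventuallyEq ?_
          filter_upwards [hΩx, hfsmall x hx hxa] with y hy hya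
          rw [hφ₁, Set.indicator_of_mem hy, hηa _ hya, zero_mul]
        have e3 : inner ℝ (grad (n := n) (fun x => N (f x)) x) (grad (n := n) h x) = (0 : ℝ) := by
          have : (fun x => N (f x)) =ᶠ[𝓝 x] fun _ => N a := by
            filter_upwards [hfsmall x hx hxa] with y hy using hNa _ hy
          rw [inner_grad_congr this, inner_grad]
          exact congrArg (fun L : Model n →L[ℝ] ℝ => L (grad (n := n) h x)) mfderiv_const
        rw [e1, inner_zero_left, e3, hζa _ hxa]
        nlinarith [mul_nonneg (neg_nonneg.2 (hN0 (f x))) (hnh h x)]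
      · have hxW : x ∈ W := ⟨hx, ha.trans_le (not_lt.1 hxa)⟩
        have hfx : MDifferentiableAt (𝓡 n) 𝓘(ℝ, ℝ) f x :=
          (hf1.contMDiffAt (hW.mem_nhds hxW)).mdifferentiableAt (by simp)
        have hηx : MDifferentiableAt (𝓡 n) 𝓘(ℝ, ℝ) (fun x => η (f x)) x :=
          (hηf.contMDiffAt (hW.mem_nhds hxW)).mdifferentiableAt (by simp)
        have hhhx : MDifferentiableAt (𝓡 n) 𝓘(ℝ, ℝ) (fun x => h x * h x) x :=
          ((hh1.mul hh1).contMDiffAt hΩx).mdifferentiableAt (by simp)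
        have : φ₁ =ᶠ[𝓝 x] fun x => η (f x) * (h x * h x) := by
          filter_upwards [hΩx] with y hy using Set.indicator_of_mem hy _
        rw [inner_grad_congr this, inner_grad_mul hηx hhhx, inner_grad_mul hhx hhx,
          inner_grad_comp hfx (hη _).differentiableAt, inner_grad_comp hfx (hN _).differentiableAt,
          (hη _).deriv, (hN _).deriv, mul_assoc (h x ^ 2), ← real_inner_self_eq_norm_mul_norm,
          real_inner_comm (grad (n := n) h x) (grad (n := n) f x)]
        nlinarith [mul_nonneg (neg_nonneg.2 (hN0 (f x))) (hnh h x)]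
    · rw [Set.indicator_of_notMem hx, grad_eq_zero_of_notMem (hf.isCompact_slab hd).isClosed hφ₁0
        fun hxs => hx (hWΩ (hf.slab_subset ha hd hxs)), grad_eq_zero_of_notMem isClosed_closure hφ₂0
        fun hxs => hx (hf.closure_subset d hd hxs), inner_zero_left, inner_zero_left]
      simp
  refine (integral_mono (g := fun x => inner ℝ (grad (n := n) φ₁ x) (grad (n := n) f x)
    - 2 * inner ℝ (grad (n := n) φ₂ x) (grad (n := n) h x)) hint
    (hi1.sub (hi2.const_mul 2)) hpt).trans ?_
  rw [integral_sub hi1 (hi2.const_mul 2), integral_const_mul, h2]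
  linarith

end Inequality

/-! ### Test functions on the line. -/

section TestFunctions

/-- A nonpositive antiderivative of a bump between `s` and `s + δ`. -/
lemma exists_testFunctions {s ε δ : ℝ} (hε : 0 < ε) (hδ : 0 ≤ δ) :
    ∃ N η κ : ℝ → ℝ, Continuous κ ∧ (∀ τ, 0 ≤ κ τ) ∧ (∀ τ, ε ≤ |τ - s| → κ τ = 0) ∧ 0 < κ s ∧
      (∀ τ, HasDerivAt N (η τ) τ) ∧ (∀ τ, HasDerivAt η (κ τ - κ (τ - δ)) τ) ∧
      (∀ τ, N τ ≤ 0) ∧ (∀ τ, s + δ + ε ≤ τ → N τ = 0) ∧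
      (∀ τ, τ < s - ε → N τ = N (s - ε)) ∧ (∀ τ, 0 ≤ η τ) ∧ (∀ τ, s + δ + ε ≤ τ → η τ = 0) ∧
      (∀ τ, τ < s - ε → η τ = 0) := by
  set κ : ℝ → ℝ := fun τ => max 0 (ε - |τ - s|) with hκ
  have hκc : Continuous κ := by fun_prop
  have hκ0 : ∀ τ, 0 ≤ κ τ := fun τ => le_max_left _ _
  have hκz : ∀ τ, ε ≤ |τ - s| → κ τ = 0 := fun τ hτ => max_eq_left (by linarith)
  have hκi : ∀ a b, IntervalIntegrable κ volume a b := fun a b => hκc.intervalIntegrable a b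
  -- Integrating `κ` over a moving window of length `δ` gives a nonnegative function with derivative
  -- `κ τ - κ (τ - δ)`, and it vanishes once the window has left the bump.
  set η : ℝ → ℝ := fun τ => ∫ x in (τ - δ)..τ, κ x with hη
  have hηd : ∀ τ, HasDerivAt η (κ τ - κ (τ - δ)) τ := fun τ => by
    have e : η = fun τ => (∫ x in (0 : ℝ)..τ, κ x) - ∫ x in (0 : ℝ)..(τ - δ), κ x := by
      ext τ
      rw [intervalIntegral.integral_interval_sub_left (hκi _ _) (hκi _ _)]
    rw [e]
    refine HasDerivAt.sub (hκc.integral_hasStrictDerivAt 0 τ).hasDerivAt ?_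
    exact (hκc.integral_hasStrictDerivAt 0 (τ - δ)).hasDerivAt.comp_sub_const τ δ
  have hηc : Continuous η := continuous_iff_continuousAt.2 fun τ => (hηd τ).continuousAt
  have hη0 : ∀ τ, 0 ≤ η τ := fun τ =>
    intervalIntegral.integral_nonneg (by linarith) fun x _ => hκ0 x
  have hηr : ∀ τ, s + δ + ε ≤ τ → η τ = 0 := fun τ hτ => by
    refine intervalIntegral.integral_zero_ae (Filter.Eventually.of_forall fun x hx => hκz x ?_)
    rw [Set.uIoc_of_le (by linarith)] at hx
    exact (by linarith [hx.1] : ε ≤ x - s).trans (le_abs_self _)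
  have hηl : ∀ τ, τ ≤ s - ε → η τ = 0 := fun τ hτ => by
    refine intervalIntegral.integral_zero_ae (Filter.Eventually.of_forall fun x hx => hκz x ?_)
    rw [Set.uIoc_of_le (by linarith)] at hx
    exact (by linarith [hx.2] : ε ≤ -(x - s)).trans (neg_le_abs _)
  have hηi : ∀ a b, IntervalIntegrable η volume a b := fun a b => hηc.intervalIntegrable a b
  -- The base point is the right end of the support of `η`, so `N` vanishes beyond it and is
  -- nonpositive before it.
  set N : ℝ → ℝ := fun τ => ∫ x in (s + δ + ε)..τ, η x with hN
  have hNr : ∀ τ, s + δ + ε ≤ τ → N τ = 0 := fun τ hτ => by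
    refine intervalIntegral.integral_zero_ae (Filter.Eventually.of_forall fun x hx => hηr x ?_)
    rw [Set.uIoc_of_le hτ] at hx
    exact hx.1.le
  refine ⟨N, η, κ, hκc, hκ0, hκz, by simp [hκ, hε],
    fun τ => (hηc.integral_hasStrictDerivAt _ τ).hasDerivAt, hηd, fun τ => ?_, hNr, fun τ hτ => ?_,
    hη0, hηr, fun τ hτ => hηl τ hτ.le⟩
  · rcases le_total (s + δ + ε) τ with h | h
    · exact (hNr τ h).le
    · simp only [hN]
      rw [intervalIntegral.integral_symm, neg_nonpos]
      exact intervalIntegral.integral_nonneg h fun x _ => hη0 x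
  · rw [← sub_eq_zero]
    simp only [hN]
    rw [intervalIntegral.integral_interval_sub_left (hηi _ _) (hηi _ _)]
    refine intervalIntegral.integral_zero_ae (Filter.Eventually.of_forall fun x hx => hηl x ?_)
    rw [Set.uIoc_of_ge hτ.le] at hx
    exact hx.2

end TestFunctions

/-! ### Continuity and monotonicity of `H`. -/

section Monotone

variable {m : ℕ} {M : Type*} [TopologicalSpace M] [ChartedSpace (Model (m + 1)) M] [T2Space M]
  [IsManifold (𝓡 (m + 1)) ∞ M]
  [RiemannianBundle (fun x : M => TangentSpace (𝓡 (m + 1)) x)]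
  [IsContMDiffRiemannianBundle (𝓡 (m + 1)) ∞ (Model (m + 1))
    (fun x : M => TangentSpace (𝓡 (m + 1)) x)]
  [MeasurableSpace M] [BorelSpace M] [SecondCountableTopology M]
  {Ω : Set M} {R : EReal} {f h : M → ℝ}

lemma continuousOn_norm_grad {W : Set M} (hW : IsOpen W)
    (hf : ContMDiffOn (𝓡 (m + 1)) 𝓘(ℝ, ℝ) 1 f W) :
    ContinuousOn (fun x => ‖grad (n := m + 1) f x‖) W := fun x hx => by
  have hA := (isAdaptedParam_extChartAt (n := m + 1) x).inter hW
  have hc := hA.continuousOn_inner_grad_grad (hf.mono Set.inter_subset_right)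
    (hf.mono Set.inter_subset_right)
  simp only [norm_eq_sqrt_real_inner]
  exact (hc.continuousAt (hA.isOpen.mem_nhds ⟨mem_extChartAt_source x, hx⟩)).sqrt.continuousWithinAt

/-- The integrals `H(τ)` depend continuously on `τ` and satisfy the coarea formula. -/
lemma IsParameterizing.exists_continuous_weightedL2 (hf : IsParameterizing (n := m + 1) Ω R f)
    (hh : ContinuousOn h Ω) {a b c d : ℝ} (ha : 0 < a) (hab : a < b) (hcd : c < d)
    (hd : d ∈ levels R) :
    ∃ H : ℝ → ℝ, Continuous H ∧
      (∀ τ ∈ Set.Icc b c, Integrable (fun x => h x ^ 2 * ‖grad (n := m + 1) f x‖)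
        (surfaceMeasure (n := m + 1) (levelSet Ω f τ)) ∧
        weightedL2 (n := m + 1) Ω f h τ = H τ) ∧
      ∀ ζ : ℝ → ℝ, Continuous ζ → (∀ τ, τ ∉ Set.Icc b c → ζ τ = 0) →
        Integrable (Ω.indicator fun x => ζ (f x) * (h x ^ 2 * ‖grad (n := m + 1) f x‖
          * ‖grad (n := m + 1) f x‖)) (vol (n := m + 1)) ∧
        ∫ τ, ζ τ * H τ = ∫ x, Ω.indicator (fun x => ζ (f x) * (h x ^ 2
          * ‖grad (n := m + 1) f x‖ * ‖grad (n := m + 1) f x‖)) x ∂(vol (n := m + 1)) := by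
  -- The cutoff `χ ∘ f` confines the integrand to the compact slab `a ≤ f ≤ d` in the regular region
  -- and equals `1` on the levels in `[b, c]`.
  obtain ⟨χ, hχ0, hχ1, -⟩ := exists_continuous_zero_one_of_isClosed
    (isOpen_Ioo (a := a) (b := d)).isClosed_compl (isClosed_Icc (a := b) (b := c))
    (Set.disjoint_left.2 fun τ h1 h2 => h1 ⟨hab.trans_le h2.1, h2.2.trans_lt hcd⟩)
  set G : M → ℝ := Ω.indicator fun x => χ (f x) * (h x ^ 2 * ‖grad (n := m + 1) f x‖) with hG
  have hWΩ : {x ∈ Ω | 0 < f x} ⊆ Ω := fun x hx => hx.1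
  have hGc : ContinuousOn G {x ∈ Ω | 0 < f x} := by
    refine ContinuousOn.congr ?_ fun x hx => Set.indicator_of_mem (hWΩ hx) _
    exact (χ.continuous.comp_continuousOn (hf.continuousOn.mono hWΩ)).mul
      (((hh.mono hWΩ).pow 2).mul
        (continuousOn_norm_grad hf.isOpen_pos (hf.smooth.of_le ENat.LEInfty.out)))
  have hG0 : ∀ x, x ∉ slab Ω f a d → G x = 0 := fun x hx => by
    by_cases hxΩ : x ∈ Ω
    · have hχ : χ (f x) = 0 := by
        refine hχ0 fun hI => ?_
        rcases hf.lt_or_le_of_notMem_slab hxΩ hx with h1 | h1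
        · exact h1.not_gt hI.1
        · exact h1.not_gt hI.2
      rw [hG, Set.indicator_of_mem hxΩ, hχ, zero_mul]
    · exact Set.indicator_of_notMem hxΩ _
  obtain ⟨hi, hc, hζ⟩ := coarea_formula hf.isOpen_pos hWΩ hf.smooth
    (fun x hx => hf.regular x hx.1 hx.2) (hf.isCompact_slab hd) (hf.slab_subset ha hd) hGc hG0
  refine ⟨_, hc, fun τ hτ => ?_, fun ζ hζc hζ0 => ?_⟩
  · have hτl : τ ∈ levels R := ⟨ha.trans (hab.trans_le hτ.1),
      lt_of_le_of_lt (EReal.coe_le_coe_iff.2 (hτ.2.trans hcd.le)) hd.2⟩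
    -- The surface measure is concentrated on `S_τ`, where `χ ∘ f = 1`; hence the cutoff does not
    -- change the integral.
    have hS : surfaceMeasure (n := m + 1) (levelSet Ω f τ) (levelSet Ω f τ)ᶜ = 0 :=
      riemannianMeasure_compl (hf.isCompact_levelSet τ hτl).isClosed.measurableSet
    have hae : G =ᵐ[surfaceMeasure (n := m + 1) (levelSet Ω f τ)]
        fun x => h x ^ 2 * ‖grad (n := m + 1) f x‖ := by
      filter_upwards [mem_ae_iff.2 hS] with x hx
      rw [hG, Set.indicator_of_mem hx.1, hx.2, hχ1 hτ, Pi.one_apply, one_mul]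
    exact ⟨(hi τ).congr hae, (integral_congr_ae hae).symm⟩
  · have he : (fun x => ζ (f x) * (G x * ‖grad (n := m + 1) f x‖))
        = Ω.indicator fun x => ζ (f x) * (h x ^ 2 * ‖grad (n := m + 1) f x‖
          * ‖grad (n := m + 1) f x‖) := by
      ext x
      by_cases hx : x ∈ Ω
      · rw [hG, Set.indicator_of_mem hx, Set.indicator_of_mem hx]
        by_cases hfx : f x ∈ Set.Icc b c
        · rw [hχ1 hfx, Pi.one_apply, one_mul]
        · rw [hζ0 _ hfx, zero_mul, zero_mul]
      · rw [hG, Set.indicator_of_notMem hx, Set.indicator_of_notMem hx, zero_mul, mul_zero]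
    have := hζ ζ hζc
    rw [he] at this
    exact this

lemma exists_gt_mem_levels {t : ℝ} (ht : t ∈ levels R) : ∃ d, t < d ∧ d ∈ levels R := by
  obtain ⟨d, h1, h2⟩ := EReal.lt_iff_exists_real_btwn.1 ht.2
  have h1 := EReal.coe_lt_coe_iff.1 h1
  exact ⟨d, h1, ht.1.trans h1, h2⟩

lemma IsParameterizing.integrable_weightedL2 (hf : IsParameterizing (n := m + 1) Ω R f)
    (hh : ContinuousOn h Ω) {t : ℝ} (ht : t ∈ levels R) :
    Integrable (fun x => h x ^ 2 * ‖grad (n := m + 1) f x‖)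
      (surfaceMeasure (n := m + 1) (levelSet Ω f t)) := by
  obtain ⟨d, htd, hd⟩ := exists_gt_mem_levels ht
  obtain ⟨H, -, hH, -⟩ := hf.exists_continuous_weightedL2 hh (half_pos ht.1)
    (half_lt_self ht.1) htd hd
  exact (hH t ⟨le_rfl, le_rfl⟩).1

lemma IsParameterizing.monotoneOn_weightedL2 (hf : IsParameterizing (n := m + 1) Ω R f)
    (hconv : IsConvexFun (n := m + 1) Ω f) (hh : IsHarmonicOn (n := m + 1) h Ω) :
    MonotoneOn (weightedL2 (n := m + 1) Ω f h) (levels R) := by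
  intro s hs t ht hst
  obtain ⟨d, htd, hd⟩ := exists_gt_mem_levels ht
  have hs0 : 0 < s := hs.1
  obtain ⟨H, hHc, hH, hζ⟩ := hf.exists_continuous_weightedL2 hh.1.continuousOn
    (a := s / 4) (b := s / 2) (c := (t + d) / 2) (d := d) (by linarith) (by linarith)
    (by linarith) hd
  rw [(hH s ⟨by linarith, by linarith⟩).2, (hH t ⟨by linarith, by linarith⟩).2]
  by_contra! hlt
  set δ := t - s with hδ
  have hDc : Continuous fun τ => H τ - H (τ + δ) := by fun_prop
  have hDs : 0 < H s - H (s + δ) := by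
    rw [hδ, add_sub_cancel]
    linarith
  obtain ⟨ε₀, hε₀, hball⟩ := Metric.eventually_nhds_iff.1
    (hDc.continuousAt.eventually_const_lt hDs)
  -- The bound `ε₀` keeps `H τ - H (τ + δ)` positive on the bump. The other two keep the bumps at
  -- `s` and at `t` within `[s / 2, (t + d) / 2]`, where `H` agrees with `weightedL2`.
  set ε := min ε₀ (min (s / 2) ((d - t) / 2)) with hε
  have hε1 : ε ≤ ε₀ := min_le_left _ _
  have hε2 : ε ≤ s / 2 := (min_le_right _ _).trans (min_le_left _ _)
  have hε3 : ε ≤ (d - t) / 2 := (min_le_right _ _).trans (min_le_right _ _)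
  have hεpos : 0 < ε := lt_min hε₀ (lt_min (by linarith) (by linarith))
  obtain ⟨N, η, κ, hκc, hκ0, hκz, hκs, hN, hη, hN0, hNd, hNa, hη0, hηd, hηa⟩ :=
    exists_testFunctions (s := s) hεpos (sub_nonneg.2 hst)
  have hζc : Continuous fun τ => κ τ - κ (τ - δ) := by fun_prop
  have hκl : ∀ τ, τ ≤ s - ε → κ τ = 0 := fun τ hτ =>
    hκz τ ((by linarith : ε ≤ -(τ - s)).trans (neg_le_abs _))
  have hκr : ∀ τ, s + ε ≤ τ → κ τ = 0 := fun τ hτ =>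
    hκz τ ((by linarith : ε ≤ τ - s).trans (le_abs_self _))
  obtain ⟨hint, heq⟩ := hζ _ hζc fun τ hτ => by
    by_cases h1 : s / 2 ≤ τ
    · have h2 : (t + d) / 2 < τ := by
        by_contra! h2
        exact hτ ⟨h1, h2⟩
      rw [hκr τ (by linarith), hκr (τ - δ) (by linarith), sub_zero]
    · rw [hκl τ (by linarith), hκl (τ - δ) (by linarith), sub_zero]
  have hd' : s + δ + ε ∈ levels R := ⟨by linarith,
    lt_of_le_of_lt (EReal.coe_le_coe_iff.2 (by linarith)) hd.2⟩
  have hle := hf.integral_le_zero hconv hh (by linarith) hd' hN hη hζc hN0 hNd hNa hη0 hηd hηa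
    (fun τ hτ => by rw [hκl τ hτ.le, hκl (τ - δ) (by linarith), sub_zero]) hint
  rw [← heq] at hle
  have hκsupp : HasCompactSupport κ := HasCompactSupport.intro (isCompact_closedBall s ε)
    fun τ hτ => hκz τ (by
      rw [Metric.mem_closedBall, Real.dist_eq] at hτ
      linarith)
  have hi1 : Integrable fun τ => κ τ * H τ :=
    (hκc.mul hHc).integrable_of_hasCompactSupport hκsupp.mul_right
  have hi2 : Integrable fun τ => κ τ * H (τ + δ) :=
    (hκc.mul (by fun_prop)).integrable_of_hasCompactSupport hκsupp.mul_right
  have hi3 : Integrable fun τ => κ (τ - δ) * H τ := by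
    simpa using hi2.comp_sub_right δ
  have hshift : ∫ τ, κ (τ - δ) * H τ = ∫ τ, κ τ * H (τ + δ) := by
    simpa using integral_sub_right_eq_self (fun τ => κ τ * H (τ + δ)) δ (μ := volume)
  -- Translating the second bump back to `s` turns the weak inequality into a comparison of `H τ`
  -- with `H (τ + δ)`.
  have hcalc : ∫ τ, (κ τ - κ (τ - δ)) * H τ = ∫ τ, κ τ * (H τ - H (τ + δ)) := by
    simp only [sub_mul, mul_sub]
    rw [integral_sub hi1 hi3, integral_sub hi1 hi2, hshift]
  have hpos : 0 < ∫ τ, κ τ * (H τ - H (τ + δ)) := by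
    refine Continuous.integral_pos_of_hasCompactSupport_nonneg_nonzero (hκc.mul hDc)
      hκsupp.mul_right (fun τ => ?_) (x := s) (mul_pos hκs hDs).ne'
    rcases lt_or_ge |τ - s| ε with h1 | h1
    · exact mul_nonneg (hκ0 τ) (hball (by rw [Real.dist_eq]; linarith)).le
    · simp [hκz τ h1]
  linarith

end Monotone

/-! ### Dimension zero. -/

section ZeroDimensional

variable {M : Type*} [TopologicalSpace M] [ChartedSpace (Model 0) M]
  [RiemannianBundle (fun x : M => TangentSpace (𝓡 0) x)] [MeasurableSpace M] [BorelSpace M]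
  {Ω : Set M} {R : EReal} {f : M → ℝ}

/-- Tangent spaces are trivial, so every gradient is `0` and regularity leaves no point with `f >
0`. -/
lemma IsParameterizing.surfaceMeasure_eq_zero (hf : IsParameterizing (n := 0) Ω R f) {t : ℝ}
    (ht : 0 < t) : surfaceMeasure (n := 0) (levelSet Ω f t) = 0 := by
  have he : levelSet Ω f t = ∅ := by
    refine Set.eq_empty_of_forall_notMem fun x hx => hf.regular x hx.1 (hx.2 ▸ ht) ?_
    exact Subsingleton.elim (α := Model 0) _ _
  have h0 : surfaceMeasure (n := 0) (∅ : Set M) ∅ᶜ = 0 := riemannianMeasure_compl .empty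
  rw [Set.compl_empty] at h0
  rw [he]
  exact Measure.measure_univ_eq_zero.1 h0

end ZeroDimensional

end LevelConvexity

end

theorem corollary1 {n : ℕ} {M : Type*} [TopologicalSpace M] [T2Space M]
    [SecondCountableTopology M] [ChartedSpace (EuclideanSpace ℝ (Fin n)) M]
    [IsManifold (𝓡 n) ∞ M]
    [RiemannianBundle (fun x : M => TangentSpace (𝓡 n) x)]
    [IsContMDiffRiemannianBundle (𝓡 n) ∞ (EuclideanSpace ℝ (Fin n))
      (fun x : M => TangentSpace (𝓡 n) x)]
    [MeasurableSpace M] [BorelSpace M]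
    (Ω : Set M) (R : EReal) (f : M → ℝ)
    (hf : LevelConvexity.IsParameterizing (n := n) Ω R f)
    (hconv : LevelConvexity.IsConvexFun (n := n) Ω f) :
    (∀ t ∈ LevelConvexity.levels R,
      ((LevelConvexity.levelSet Ω f t).Nonempty →
        IsGLB (LevelConvexity.laplaceRatio (n := n) f '' LevelConvexity.levelSet Ω f t)
          (LevelConvexity.lowerBound (n := n) Ω f t)) ∧
      0 ≤ LevelConvexity.lowerBound (n := n) Ω f t) ∧
    (∀ h : M → ℝ, LevelConvexity.IsHarmonicOn (n := n) h Ω →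
      (∀ t ∈ LevelConvexity.levels R,
        Integrable (fun x => h x ^ 2 * ‖LevelConvexity.grad (n := n) f x‖)
          (LevelConvexity.surfaceMeasure (n := n) (LevelConvexity.levelSet Ω f t))) ∧
      MonotoneOn (LevelConvexity.weightedL2 (n := n) Ω f h) (LevelConvexity.levels R)) ∧
    (∀ t ∈ LevelConvexity.levels R,
      LevelConvexity.IsTotallyConvexIn (n := n) Ω (LevelConvexity.sublevelSet Ω f t)) := by
  refine ⟨fun t ht => hconv.lowerBound_spec ht.1, fun h hh => ?_,
    fun t ht => hf.isTotallyConvexIn hconv ht⟩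
  -- The slicing argument needs `n = m + 1`. For `n = 0` the dimension `n - 1` truncates to `0`, but
  -- the level sets are empty and both claims are trivial.
  cases n with
  | zero =>
    refine ⟨fun t ht => ?_, fun s hs t ht _ => ?_⟩
    · rw [hf.surfaceMeasure_eq_zero ht.1]
      exact integrable_zero_measure
    · rw [LevelConvexity.weightedL2, LevelConvexity.weightedL2, hf.surfaceMeasure_eq_zero hs.1,
        hf.surfaceMeasure_eq_zero ht.1]
  | succ m =>
    exact ⟨fun t ht => hf.integrable_weightedL2 hh.1.continuousOn ht,
      hf.monotoneOn_weightedL2 hconv hh⟩
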